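/- Let $n\ge 0$, let $\lambda=(\lambda_1\ge\dots\ge\lambda_n\ge 0)$ be a partition with largest part $r$, and let $\alpha>0$ be real. For a partition $\lambda$ and real $q,t$ let $P_\lambda(x_1,\dots,x_n;q,t)$ be the Macdonald polynomial: the restriction to $n$ variables of the symmetric function $P_\lambda = m_\lambda+\sum_{\mu<\lambda}c_{\lambda\mu}m_\mu$ (dominance order), with $\langle P_\lambda,P_\mu\rangle=0$ for $\lambda\ne\mu$, where $\langle p_\lambda,p_\mu\rangle=\delta_{\lambda\mu}\,z_\lambda\prod_{i=1}^{\ell(\lambda)}\frac{1-q^{\lambda_i}}{1-t^{\lambda_i}}$ on products of power sums. The Jack polynomial is $P^{(\alpha)}_\lambda(x_1,\dots,x_n)=\lim_{t\to1}P_\lambda(x_1,\dots,x_n;t^\alpha,t)$ (limit of coefficients). Notation. For $0\le k\le r$, $\lambda[k]$ is obtained from $\lambda$ by replacing all parts of size $\le k$ by $0$. For a composition $\mu=(\mu_1,\dots,\mu_n)$ put $x_\mu=\prod_{k:\,\mu_k>0}x_k$ and $\mu'_j=\#\{k:\mu_k\ge j\}$. A permutation $\sigma\in S_n$ acts on compositions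 by $(\sigma\circ\mu)_k=\mu_{\sigma^{-1}(k)}$ and on polynomials by $s_\sigma: x_k\mapsto x_{\sigma(k)}$ (also written $\sigma\circ$). Let $S_\mu\subset S_n$ be any complete system of representatives of the left cosets of the stabilizer of $\mu$, so that each rearrangement of $\mu$ is $\sigma\circ\mu$ for exactly one $\sigma\in S_\mu$. For compositions $\lambda,\mu$ put $a_j(\lambda,\mu)=\#\{k:\lambda_k=0,\ \mu_k=j\}$ and $b_j(\lambda,\mu)=\#\{k: j=\lambda_k>\mu_k\}$. With $r$ fixed, let $C_i(\lambda,\mu;q,t)$ and $C_i^{(\alpha)}(\lambda,\mu)$ be $0$ if $0<\lambda_k<\mu_k$ for some $k$, and otherwise $$C_i(\lambda,\mu;q,t)=\prod_{j=i+1}^{r}\Bigl(q^{(j-i)a_j(\lambda,\mu)}\prod_{k=1}^{b_j(\lambda,\mu)}\frac{1-t^k}{1-q^{j-i}t^{\lambda'_i-\lambda'_j+k}}\Bigr),\qquad C_i^{(\alpha)}(\lambda,\mu)=\prod_{j=i+1}^{r}\prod_{k=1}^{b_j(\lambda,\mu)}\frac{k}{(j-i)\alpha+\lambda'_i-\lambda'_j+k}.$$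 Then: 1. $\lim_{t\to1}C_i(\lambda,\mu;t^\alpha,t)=C_i^{(\alpha)}(\lambda,\mu)$ for all compositions $\lambda,\mu$ and all $i$, $r$. 2. The limit defining the Jack polynomial exists and $$P^{(\alpha)}_\lambda(x_1,\dots,x_n)=\sum_{\sigma\in S_\lambda}s_\sigma\circ x_\lambda\circ\prod_{i=1}^{r-1}\Bigl(\sum_{\sigma\in S_{\lambda[i]}}C_i^{(\alpha)}\bigl(\lambda[i-1],\sigma\circ\lambda[i]\bigr)\,s_\sigma\circ x_{\lambda[i]}\circ\Bigr)1,$$ where $x_\mu$ stands for the operator of multiplication by $x_\mu$ and the factors are composed from left to right. 3. Equivalently, with $\bar r=r-1$ (for $r=0$ only the sum over $\sigma[0]$ is present), $$P^{(\alpha)}_\lambda(x_1,\dots,x_n)=\sum_{\sigma[0]\in S_{\lambda[0]}}\ \sum_{\sigma[1]\in S_{\lambda[1]}}\cdots\sum_{\sigma[\bar r]\in S_{\lambda[\bar r]}}\ \prod_{i=1}^{\bar r}C_i^{(\alpha)}\bigl(\lambda[i-1],\sigma[i]\circ\lambda[i]\bigr)\ \prod_{i=0}^{\bar r}\Bigl\{\sigma[0]\circ\sigma[1]\circ\cdots\circ\sigma[i]\circ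 x_{\lambda[i]}\Bigr\}.$$ -/

import Mathlib

noncomputable section

open MvPolynomial Filter Topology

namespace JackSum

/-! ### Symmetric functions and Macdonald's scalar product -/

/-- The ring of symmetric functions over `ℝ`, presented as the polynomial ring
`ℝ[p₁, p₂, …]` in the power sums: the variable `X k` is the power sum `p_k`. -/
abbrev SymFun : Type := MvPolynomial ℕ+ ℝ

/-- The image of a symmetric function in the polynomial ring in `x_1, …, x_n`
(the power sum `p_k` goes to `x_1 ^ k + ⋯ + x_n ^ k`). -/
def toVars (n : ℕ) : SymFun →ₐ[ℝ] MvPolynomial (Fin n) ℝ :=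
  aeval fun k : ℕ+ => psum (Fin n) ℝ (k : ℕ)

/-- For the product of power sums `p_1 ^ (m 1) * p_2 ^ (m 2) * ⋯`, i.e. for `p_μ` with `μ` the
partition having `m k` parts equal to `k`, this is
`z_μ * ∏_i (1 - q ^ μ_i) / (1 - t ^ μ_i)` where `z_μ = ∏_k k ^ (m k) * (m k)!`. -/
def powerSumNorm (q t : ℝ) (m : ℕ+ →₀ ℕ) : ℝ :=
  ∏ k ∈ m.support,
    ((k : ℕ) : ℝ) ^ m k * ((m k).factorial : ℝ) *
      ((1 - q ^ (k : ℕ)) / (1 - t ^ (k : ℕ))) ^ m k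

/-- Macdonald's scalar product: products of power sums are pairwise orthogonal,
with squared norms given by `powerSumNorm`. -/
def scalarProduct (q t : ℝ) (f g : SymFun) : ℝ :=
  ∑ m ∈ f.support, coeff m f * coeff m g * powerSumNorm q t m

/-! ### The dominance order -/

/-- The sum of the `k` largest parts of a partition. -/
def partialSum {d : ℕ} (mu : d.Partition) (k : ℕ) : ℕ :=
  ((mu.parts.sort (· ≥ ·)).take k).sum

/-- The dominance order, `mu ≤ lam`. -/
def DomLE {d : ℕ} (mu lam : d.Partition) : Prop :=
  ∀ k, partialSum mu k ≤ partialSum lam k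

/-- The strict dominance order, `mu < lam`. -/
def DomLT {d : ℕ} (mu lam : d.Partition) : Prop :=
  DomLE mu lam ∧ ¬ DomLE lam mu

/-! ### Macdonald polynomials -/

/-- `Q = ∑_{mu < lam} c_mu m_mu` with real coefficients `c_mu`: an identity of symmetric functions,
that is, it holds in any number `n` of variables. Here `m_mu` is the monomial
symmetric polynomial. -/
def IsLower {d : ℕ} (lam : d.Partition) (Q : SymFun) : Prop :=
  ∃ c : d.Partition → ℝ, ∀ n : ℕ,
    toVars n Q = ∑ᶠ (mu : d.Partition) (_ : DomLT mu lam), c mu • msymm (Fin n) ℝ mu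

/-- `P = m_lam + ∑_{mu < lam} c_mu m_mu` with real coefficients `c_mu`. -/
def IsMonicTriangular {d : ℕ} (lam : d.Partition) (P : SymFun) : Prop :=
  ∃ c : d.Partition → ℝ, ∀ n : ℕ,
    toVars n P = msymm (Fin n) ℝ lam +
      ∑ᶠ (mu : d.Partition) (_ : DomLT mu lam), c mu • msymm (Fin n) ℝ mu

/-- The characterization of `P_lam` by Gram--Schmidt orthogonalization along the dominance order:
`P_lam` is `m_lam` plus lower terms, and it is orthogonal to all `m_mu` with `mu < lam`
(equivalently, to all `P_mu` with `mu < lam`). Any family `P` of monic triangular symmetric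
functions with `⟨P_lam, P_mu⟩ = 0` for all `lam ≠ mu` is given by this characterization:
see `macdonaldSym_eq_of_orthogonal_family` below. -/
def IsMacdonald (q t : ℝ) {d : ℕ} (lam : d.Partition) (P : SymFun) : Prop :=
  IsMonicTriangular lam P ∧ ∀ Q, IsLower lam Q → scalarProduct q t P Q = 0

open Classical in
/-- The Macdonald symmetric function `P_lam(q, t)`. -/
def macdonaldSym (q t : ℝ) {d : ℕ} (lam : d.Partition) : SymFun :=
  if h : ∃! P, IsMacdonald q t lam P then h.choose else 0

/-- The partition of `lam_1 + ⋯ + lam_n` whose parts are the nonzero `lam_i`. -/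
def toPartition {n : ℕ} (lam : Fin n → ℕ) : (Multiset.map lam Finset.univ.val).sum.Partition :=
  Nat.Partition.ofMultiset (Multiset.map lam Finset.univ.val)

/-- The Macdonald polynomial `P_lam(x_1, …, x_n; q, t)`, for a partition
`lam = (lam_1 ≥ ⋯ ≥ lam_n ≥ 0)`. -/
def macdonaldPoly (q t : ℝ) {n : ℕ} (lam : Fin n → ℕ) : MvPolynomial (Fin n) ℝ :=
  toVars n (macdonaldSym q t (toPartition lam))

/-- `J` is the Jack polynomial `P_lam^{(α)}(x_1, …, x_n)`: the limit, coefficient by coefficient, of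
the Macdonald polynomial `P_lam(x_1, …, x_n; q, t)` with `q = t ^ α` as `t → 1`. -/
def IsJackPoly (α : ℝ) {n : ℕ} (lam : Fin n → ℕ) (J : MvPolynomial (Fin n) ℝ) : Prop :=
  ∀ m : Fin n →₀ ℕ,
    Tendsto (fun t : ℝ => coeff m (macdonaldPoly (t ^ α) t lam)) (𝓝[≠] 1) (𝓝 (coeff m J))

/-! ### The ingredients of the sum formula -/

/-- The largest part `r`. -/
def largestPart {n : ℕ} (lam : Fin n → ℕ) : ℕ := Finset.univ.sup lam

/-- `lam[k]`: all parts of size at most `k` are replaced by `0`. -/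
def trunc {n : ℕ} (lam : Fin n → ℕ) (k : ℕ) : Fin n → ℕ :=
  fun i => if lam i ≤ k then 0 else lam i

/-- The monomial `x_lam`: the product of the variables `x_i` with `lam_i > 0`. -/
def xMon {n : ℕ} (lam : Fin n → ℕ) : MvPolynomial (Fin n) ℝ :=
  ∏ i with 0 < lam i, X i

/-- The `j`-th part of the conjugate partition, `lam'_j = #{k : lam_k ≥ j}`. -/
def conj {n : ℕ} (lam : Fin n → ℕ) (j : ℕ) : ℕ :=
  (Finset.univ.filter fun k => j ≤ lam k).card

/-- `a_j(lam, mu) = #{k : lam_k = 0, mu_k = j}`. -/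
def aFun {n : ℕ} (j : ℕ) (lam mu : Fin n → ℕ) : ℕ :=
  (Finset.univ.filter fun k => lam k = 0 ∧ mu k = j).card

/-- `b_j(lam, mu) = #{k : j = lam_k > mu_k}`. -/
def bFun {n : ℕ} (j : ℕ) (lam mu : Fin n → ℕ) : ℕ :=
  (Finset.univ.filter fun k => lam k = j ∧ mu k < lam k).card

open Classical in
/-- The coefficient `C_i(lam, mu)` of the sum formula for Macdonald polynomials
(`r` is the largest part of the partition under consideration). -/
def macdonaldCoeff (q t : ℝ) (r i : ℕ) {n : ℕ} (lam mu : Fin n → ℕ) : ℝ :=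
  if ∃ k, 0 < lam k ∧ lam k < mu k then 0
  else ∏ j ∈ Finset.Icc (i + 1) r,
    (q ^ ((j - i) * aFun j lam mu) *
      ∏ k ∈ Finset.Icc 1 (bFun j lam mu),
        (1 - t ^ k) / (1 - q ^ (j - i) * t ^ (conj lam i - conj lam j + k)))

open Classical in
/-- The coefficient `C_i(lam, mu)` of the sum formula for Jack polynomials
(`r` is the largest part of the partition under consideration). -/
def jackCoeff (α : ℝ) (r i : ℕ) {n : ℕ} (lam mu : Fin n → ℕ) : ℝ :=
  if ∃ k, 0 < lam k ∧ lam k < mu k then 0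
  else ∏ j ∈ Finset.Icc (i + 1) r, ∏ k ∈ Finset.Icc 1 (bFun j lam mu),
    (k : ℝ) / (((j : ℝ) - (i : ℝ)) * α + (conj lam i : ℝ) - (conj lam j : ℝ) + (k : ℝ))

/-- The action of permutations on compositions: `sigma` moves the part in position `k` to
position `sigma k`. Accordingly `s_sigma = rename sigma` acts on polynomials by
`x_k ↦ x_{sigma k}`. -/
def permComp {n : ℕ} (sigma : Equiv.Perm (Fin n)) (mu : Fin n → ℕ) : Fin n → ℕ :=
  fun k => mu (sigma⁻¹ k)

/-- `S` is the set `S_mu` of all permutations with a distinct action on `mu`: a complete system of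
representatives of the cosets in `S_n` of the stabilizer of `mu`. -/
def IsReps {n : ℕ} (mu : Fin n → ℕ) (S : Finset (Equiv.Perm (Fin n))) : Prop :=
  ∀ tau : Equiv.Perm (Fin n), ∃! sigma, sigma ∈ S ∧ permComp sigma mu = permComp tau mu

/-- The nested expression
`∏_{i' = i+1}^{i+s} (∑_{sigma ∈ S i'} C_{i'}(lam[i'-1], sigma ∘ lam[i']) s_sigma ∘ x_{lam[i']} ∘) 1`,
by recursion on the number `s` of factors. -/
def jackNestedTail (α : ℝ) {n : ℕ} (lam : Fin n → ℕ) (S : ℕ → Finset (Equiv.Perm (Fin n))) :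
    ℕ → ℕ → MvPolynomial (Fin n) ℝ
  | _, 0 => 1
  | i, s + 1 =>
    ∑ sigma ∈ S (i + 1),
      jackCoeff α (largestPart lam) (i + 1) (trunc lam i) (permComp sigma (trunc lam (i + 1))) •
        rename sigma (xMon (trunc lam (i + 1)) * jackNestedTail α lam S (i + 1) s)

/-- The nested form of the sum formula:
`∑_{sigma ∈ S 0} s_sigma ∘ x_lam ∘
  ∏_{i=1}^{r-1} (∑_{sigma ∈ S i} C_i(lam[i-1], sigma ∘ lam[i]) s_sigma ∘ x_{lam[i]} ∘) 1`. -/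
def jackNestedSum (α : ℝ) {n : ℕ} (lam : Fin n → ℕ) (S : ℕ → Finset (Equiv.Perm (Fin n))) :
    MvPolynomial (Fin n) ℝ :=
  ∑ sigma ∈ S 0, rename sigma (xMon lam * jackNestedTail α lam S 0 (largestPart lam - 1))

/-- The multiple sum over `sigma[0] ∈ S 0, …, sigma[r-1] ∈ S (r-1)` of
`∏_{i=1}^{r-1} C_i(lam[i-1], sigma[i] ∘ lam[i])` times the product over `i = 0, …, r-1` of the
monomials `sigma[0] ∘ sigma[1] ∘ ⋯ ∘ sigma[i] ∘ x_{lam[i]}`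
(`Fin.partialProd sigma i.succ` is `sigma 0 * sigma 1 * ⋯ * sigma i`). -/
def jackMultiSum (α : ℝ) {n : ℕ} (lam : Fin n → ℕ) (S : ℕ → Finset (Equiv.Perm (Fin n))) :
    MvPolynomial (Fin n) ℝ :=
  ∑ sigma ∈ Fintype.piFinset fun i : Fin (largestPart lam - 1 + 1) => S i,
    (∏ i : Fin (largestPart lam - 1),
      jackCoeff α (largestPart lam) (i + 1) (trunc lam i)
        (permComp (sigma i.succ) (trunc lam (i + 1)))) •
    ∏ i : Fin (largestPart lam - 1 + 1),
      rename (Fin.partialProd sigma i.succ : Equiv.Perm (Fin n)) (xMon (trunc lam i))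

/-! ### Agreement with the definition through a full orthogonal family

A family `P` indexed by all partitions of `d` which is monic triangular for the dominance order and
satisfies `⟨P_lam, P_mu⟩ = 0` whenever `lam ≠ mu` consists of the functions `macdonaldSym`. -/

theorem domLT_wf {d : ℕ} : WellFounded (DomLT (d := d)) := by
  have : IsTrans d.Partition DomLT :=
    ⟨fun a b c h1 h2 => ⟨fun k => (h1.1 k).trans (h2.1 k),
      fun h => h1.2 fun k => (h2.1 k).trans (h k)⟩⟩
  have : Std.Irrefl (DomLT (d := d)) := ⟨fun a h => h.2 h.1⟩
  exact Finite.wellFounded_of_trans_of_irrefl _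

theorem scalarProduct_eq (q t : ℝ) (f g : SymFun) (s : Finset (ℕ+ →₀ ℕ)) (h : f.support ⊆ s) :
    scalarProduct q t f g = ∑ m ∈ s, coeff m f * coeff m g * powerSumNorm q t m := by
  refine Finset.sum_subset h fun m _ hm => ?_
  rw [notMem_support_iff.1 hm]
  simp

theorem scalarProduct_sub_left (q t : ℝ) (f f' g : SymFun) :
    scalarProduct q t (f - f') g = scalarProduct q t f g - scalarProduct q t f' g := by
  classical
  rw [scalarProduct_eq q t (f - f') g (f.support ∪ f'.support) (support_sub _ _ _),
    scalarProduct_eq q t f g _ Finset.subset_union_left,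
    scalarProduct_eq q t f' g _ Finset.subset_union_right, ← Finset.sum_sub_distrib]
  refine Finset.sum_congr rfl fun m _ => ?_
  rw [coeff_sub]
  ring

theorem eq_zero_of_scalarProduct_self {q t : ℝ}
    (hpos : ∀ k : ℕ+, 0 < (1 - q ^ (k : ℕ)) / (1 - t ^ (k : ℕ))) {f : SymFun}
    (h : scalarProduct q t f f = 0) : f = 0 := by
  have hn : ∀ m, 0 < powerSumNorm q t m := fun m => by
    refine Finset.prod_pos fun k _ => ?_
    have := hpos k
    have := k.pos
    positivity
  rw [scalarProduct, Finset.sum_eq_zero_iff_of_nonneg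
    (fun m _ => mul_nonneg (mul_self_nonneg _) (hn m).le)] at h
  by_contra hf
  obtain ⟨m, hm⟩ := Finset.nonempty_iff_ne_empty.2 (support_eq_empty.not.2 hf)
  have := h m hm
  have h2 := mem_support_iff.1 hm
  simp [h2, (hn m).ne'] at this

/-- A symmetric function is determined by its values in finitely many variables. -/
theorem eq_zero_of_toVars {f : SymFun} (h : ∀ n, toVars n f = 0) : f = 0 := by
  obtain ⟨D, hD⟩ : ∃ D : ℕ, ∀ k ∈ f.vars, (k : ℕ) ≤ D :=
    ⟨f.vars.sup fun k => (k : ℕ), fun k hk => Finset.le_sup (f := fun k : ℕ+ => (k : ℕ)) hk⟩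
  -- `p_k` becomes `∑ j, c_j * (j + 1) ^ k`
  let G : SymFun →ₐ[ℝ] MvPolynomial (Fin D) ℝ :=
    aeval fun k : ℕ+ => ∑ j : Fin D, X j * C (((j : ℕ) + 1 : ℝ) ^ (k : ℕ))
  have hG : G f = 0 := by
    refine funext_set (fun _ => Set.range fun c : ℕ => (c : ℝ))
      (fun _ => Set.infinite_range_of_injective Nat.cast_injective) fun x hx => ?_
    choose c hc using fun j => hx j (Set.mem_univ j)
    let e := Fintype.equivFin (Σ j : Fin D, Fin (c j))
    let y : Fin (Fintype.card (Σ j : Fin D, Fin (c j))) → ℝ := fun i => ((e.symm i).1 : ℕ) + 1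
    have h0 := congrArg (aeval (R := ℝ) y) (h (Fintype.card (Σ j : Fin D, Fin (c j))))
    have hcomp : ((aeval (R := ℝ) x).comp G) = (aeval (R := ℝ) y).comp (toVars _) := by
      ext k
      simp only [AlgHom.comp_apply, G, toVars, aeval_X, psum, map_sum, map_mul, map_pow,
        aeval_C, Algebra.algebraMap_self, RingHom.id_apply]
      rw [← e.sum_comp, Fintype.sum_sigma]
      refine Finset.sum_congr rfl fun j _ => ?_
      simp [y, ← hc j]
    have h1 := AlgHom.congr_fun hcomp f
    simp only [AlgHom.comp_apply] at h1
    rw [h0, map_zero] at h1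
    simpa [aeval_eq_eval] using h1
  refine MvPolynomial.funext fun v => ?_
  let V : Matrix (Fin D) (Fin D) ℝ := (Matrix.vandermonde fun j : Fin D => ((j : ℕ) + 1 : ℝ)).transpose
  have hV : IsUnit V.det := by
    rw [isUnit_iff_ne_zero, Matrix.det_transpose, Matrix.det_vandermonde_ne_zero_iff]
    intro a b hab
    exact Fin.ext (by exact_mod_cast add_right_cancel hab)
  obtain ⟨c, hc⟩ := (Matrix.mulVec_surjective_iff_isUnit.2 ((Matrix.isUnit_iff_isUnit_det _).2 hV))
    (fun i : Fin D => v ⟨i + 1, Nat.succ_pos _⟩)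
  have h1 := congrArg (eval fun j : Fin D => c j / ((j : ℕ) + 1 : ℝ)) hG
  rw [map_zero] at h1 ⊢
  rw [← h1]
  change eval v f = ((eval fun j : Fin D => c j / ((j : ℕ) + 1 : ℝ)).comp G.toRingHom) f
  refine hom_congr_vars (by ext; simp) (fun k hk _ => ?_) rfl
  obtain ⟨i, hi⟩ : ∃ i, (k : ℕ) = i + 1 := ⟨k - 1, by have := k.pos; omega⟩
  have hiD : i < D := by have := hD k hk; omega
  have h2 := congrFun hc ⟨i, hiD⟩
  have hk' : (⟨i + 1, Nat.succ_pos _⟩ : ℕ+) = k := PNat.eq hi.symm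
  simp only [hk'] at h2
  simp only [eval_X, RingHom.comp_apply, AlgHom.toRingHom_eq_coe, RingHom.coe_coe, G, aeval_X,
    map_sum, map_mul, eval_C]
  rw [← h2, Matrix.mulVec, dotProduct]
  refine Finset.sum_congr rfl fun j _ => ?_
  have : ((j : ℕ) + 1 : ℝ) ≠ 0 := by positivity
  simp only [V, Matrix.transpose_apply, Matrix.vandermonde_apply, hi]
  field_simp
  ring

theorem isMacdonald_unique {q t : ℝ}
    (hpos : ∀ k : ℕ+, 0 < (1 - q ^ (k : ℕ)) / (1 - t ^ (k : ℕ))) {d : ℕ} {lam : d.Partition}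
    {P P' : SymFun} (h : IsMacdonald q t lam P) (h' : IsMacdonald q t lam P') : P = P' := by
  have hlow : IsLower lam (P - P') := by
    obtain ⟨c, hc⟩ := h.1
    obtain ⟨c', hc'⟩ := h'.1
    refine ⟨fun mu => c mu - c' mu, fun n => ?_⟩
    classical
    rw [map_sub, hc, hc']
    simp only [finsum_eq_sum_of_fintype, finsum_eq_if, add_sub_add_left_eq_sub,
      ← Finset.sum_sub_distrib]
    refine Finset.sum_congr rfl fun mu _ => ?_
    split_ifs
    · rw [sub_smul]
    · simp
  have := eq_zero_of_scalarProduct_self hpos (f := P - P') (by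
    rw [scalarProduct_sub_left, h.2 _ hlow, h'.2 _ hlow, sub_zero])
  exact sub_eq_zero.1 this

theorem macdonaldSym_eq_of_orthogonal_family {q t : ℝ}
    (hpos : ∀ k : ℕ+, 0 < (1 - q ^ (k : ℕ)) / (1 - t ^ (k : ℕ))) {d : ℕ}
    (P : d.Partition → SymFun) (htri : ∀ lam, IsMonicTriangular lam (P lam))
    (horth : ∀ lam mu, lam ≠ mu → scalarProduct q t (P lam) (P mu) = 0) (lam : d.Partition) :
    macdonaldSym q t lam = P lam := by
  classical
  have hmon : ∀ nu : d.Partition, ∃ M : SymFun, (∀ n, toVars n M = msymm (Fin n) ℝ nu) ∧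
      ∀ lam, DomLE nu lam → ¬ DomLE lam nu → scalarProduct q t (P lam) M = 0 := by
    intro nu
    induction nu using domLT_wf.induction with
    | _ nu ih =>
      obtain ⟨c, hc⟩ := htri nu
      choose! M hM hM' using ih
      refine ⟨P nu - ∑ mu with DomLT mu nu, c mu • M mu, fun n => ?_, fun lam h1 h2 => ?_⟩
      · rw [map_sub, hc, map_sum, sub_eq_iff_eq_add]
        congr 1
        simp only [finsum_eq_sum_of_fintype, finsum_eq_if, Finset.sum_filter]
        refine Finset.sum_congr rfl fun mu _ => ?_
        split_ifs with hmu
        · rw [map_smul, hM mu hmu]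
        · rfl
      · have hz : ∀ mu, DomLT mu nu → scalarProduct q t (P lam) (M mu) = 0 := fun mu hmu =>
          hM' mu hmu lam (fun k => (hmu.1 k).trans (h1 k)) fun h => hmu.2 fun k =>
            (h1 k).trans (h k)
        have h0 : scalarProduct q t (P lam) (P nu) = 0 :=
          horth _ _ fun h => h2 (h ▸ fun _ => le_rfl)
        have hlin : scalarProduct q t (P lam) (P nu - ∑ mu with DomLT mu nu, c mu • M mu) =
            scalarProduct q t (P lam) (P nu) -
              ∑ mu with DomLT mu nu, c mu * scalarProduct q t (P lam) (M mu) := by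
          simp only [scalarProduct, coeff_sub, coeff_sum, coeff_smul, smul_eq_mul, mul_sub, sub_mul,
            Finset.sum_sub_distrib, Finset.mul_sum, Finset.sum_mul]
          rw [Finset.sum_comm]
          congr 1
          refine Finset.sum_congr rfl fun _ _ => Finset.sum_congr rfl fun _ _ => by ring
        rw [hlin, h0, Finset.sum_eq_zero, sub_zero]
        intro mu hmu
        rw [hz mu (Finset.mem_filter.1 hmu).2, mul_zero]
  choose M hM hM' using hmon
  have hP : IsMacdonald q t lam (P lam) := by
    refine ⟨htri lam, fun Q ⟨c, hc⟩ => ?_⟩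
    have hQ : Q = ∑ mu with DomLT mu lam, c mu • M mu := by
      rw [← sub_eq_zero]
      refine eq_zero_of_toVars fun n => ?_
      rw [map_sub, hc, map_sum, sub_eq_zero]
      simp only [finsum_eq_sum_of_fintype, finsum_eq_if, Finset.sum_filter, map_smul, hM]
    have hlin : scalarProduct q t (P lam) Q =
        ∑ mu with DomLT mu lam, c mu * scalarProduct q t (P lam) (M mu) := by
      rw [hQ]
      simp only [scalarProduct, coeff_sum, coeff_smul, smul_eq_mul, Finset.mul_sum, Finset.sum_mul]
      rw [Finset.sum_comm]
      refine Finset.sum_congr rfl fun _ _ => Finset.sum_congr rfl fun _ _ => by ring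
    rw [hlin]
    refine Finset.sum_eq_zero fun mu hmu => ?_
    have := (Finset.mem_filter.1 hmu).2
    rw [hM' mu lam this.1 this.2, mul_zero]
  have hex : ∃! R, IsMacdonald q t lam R :=
    ⟨P lam, hP, fun R hR => isMacdonald_unique hpos hR hP⟩
  rw [macdonaldSym, dif_pos hex]
  exact isMacdonald_unique hpos hex.choose_spec.1 hP

end JackSum

end

/-! The sum formula is regrouped as `symSum`: the sum, over all rearrangements of λ, of nonsymmetric
polynomials f_μ (`fPoly`). These satisfy the recursion f_μ = x_μ · Σ_ν w(μ,ν) f_ν, where ν runs over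
the rearrangements of μ with its nonzero parts lowered by one. After a shift of parts, the Jack
coefficients are exactly the weights w (`jackCoeff_trunc`), so unrolling the recursion gives the
nested sum (`jackNestedSum_eq`), and expanding products gives the multiple sum (`jackMultiSum_eq`).

The heart of the matter is that the f_μ satisfy Knizhnik–Zamolodchikov equations (`kz_fPoly`), which
express α x_i ∂_i f_μ through f_μ, the polynomials f of μ with two entries exchanged, and divided
differences. Induction along the recursion reduces them to exchange identities between weights
(`pairWeight_exchange_zero`, `pairWeight_exchange_pos`). These are proved by counting: exchanging
two entries of ν makes the weight vanish, leaves it unchanged, or multiplies or divides it by the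
last factor k/((a-1)α + b + k) of one product. With b the number of parts strictly between 0 and a,
all contributions add up to an expression linear in α.

Summing the equations over the orbit, without and with the weight ν_i, shows that the symmetric sum
is an eigenfunction of a Laplace–Beltrami operator (`laplaceAt_symSum`), normalized so as not to
depend on the number of variables. In power sums this operator is self-adjoint for ⟨p_μ,p_μ⟩ = z_μ
α^ℓ(μ) (`diagForm_symLaplace`), and its eigenvalue is strictly monotone for dominance
(`partsEigenval_lt`). The symmetric sum is monic triangular in the m_μ and stable in the number of
variables, so it comes from one symmetric function `sumSym`. Eigenfunctions of comparable partitions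
are orthogonal, which makes `sumSym` the Gram–Schmidt vector of m_λ for the Jack scalar product.

Macdonald's P_λ is the Gram–Schmidt vector for the (q,t)-scalar product (`macdonaldSym_eq`).
Gram–Schmidt coefficients are read off from the inverse of a Gram matrix, hence are continuous in
the norms where these are positive (`tendsto_gramCoeff`). Since the norms at q = t^α converge to the
Jack norms, the limit exists and is the symmetric sum (`isJackPoly_symSum`). -/

noncomputable section

open MvPolynomial Filter Topology

namespace JackSum

variable {n m : ℕ}

/-! ### The coefficients of one step of the recursion -/

/-- All rearrangements of a composition. -/
def orbit (mu : Fin n → ℕ) : Finset (Fin n → ℕ) :=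
  Finset.univ.image fun sigma : Equiv.Perm (Fin n) => permComp sigma mu

/-- All nonzero parts are lowered by one. -/
def dec (mu : Fin n → ℕ) : Fin n → ℕ := fun k => mu k - 1

/-- The number of `k` with `mu_k = a` and `nu_k + 1 < a`. -/
def unfixed (mu nu : Fin n → ℕ) (a : ℕ) : ℕ :=
  (Finset.univ.filter fun k => mu k = a ∧ nu k + 1 < a).card

/-- The number of `k` with `0 < mu_k < a`. -/
def between (mu : Fin n → ℕ) (a : ℕ) : ℕ :=
  (Finset.univ.filter fun k => 0 < mu k ∧ mu k < a).card

/-- Some part of `mu` is too small for the part of `nu` in the same position. -/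
def Blocked (mu nu : Fin n → ℕ) : Prop := ∃ k, 0 < mu k ∧ mu k ≤ nu k

open Classical in
/-- The coefficient with which a rearrangement `nu` of `dec mu` enters the recursion. -/
def pairWeight (α : ℝ) (R : ℕ) (mu nu : Fin n → ℕ) : ℝ :=
  if Blocked mu nu then 0
  else ∏ a ∈ Finset.Icc 2 R, ∏ k ∈ Finset.Icc 1 (unfixed mu nu a),
    (k : ℝ) / (((a : ℝ) - 1) * α + between mu a + k)

/-! ### Permutations acting on compositions, and orbits -/

theorem permComp_one (mu : Fin n → ℕ) : permComp 1 mu = mu := by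
  funext k; simp [permComp]

theorem permComp_mul (s t : Equiv.Perm (Fin n)) (mu : Fin n → ℕ) :
    permComp (s * t) mu = permComp s (permComp t mu) := by
  funext k; simp [permComp]

theorem permComp_swap_apply (i j k : Fin n) (mu : Fin n → ℕ) :
    permComp (Equiv.swap i j) mu k = mu (Equiv.swap i j k) := by
  simp [permComp]

theorem permComp_swap_swap (i j : Fin n) (mu : Fin n → ℕ) :
    permComp (Equiv.swap i j) (permComp (Equiv.swap i j) mu) = mu := by
  rw [← permComp_mul, Equiv.swap_mul_self, permComp_one]

theorem permComp_swap_eq_self {i j : Fin n} {mu : Fin n → ℕ} (h : mu i = mu j) :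
    permComp (Equiv.swap i j) mu = mu := by
  funext k
  rw [permComp_swap_apply]
  rcases eq_or_ne k i with rfl | hi
  · simp [h]
  rcases eq_or_ne k j with rfl | hj
  · simp [h]
  rw [Equiv.swap_apply_of_ne_of_ne hi hj]

theorem mem_orbit {mu nu : Fin n → ℕ} : nu ∈ orbit mu ↔ ∃ s, permComp s mu = nu := by
  simp [orbit]

theorem self_mem_orbit (mu : Fin n → ℕ) : mu ∈ orbit mu := mem_orbit.2 ⟨1, permComp_one mu⟩

theorem permComp_mem_orbit {mu nu : Fin n → ℕ} (s : Equiv.Perm (Fin n)) :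
    permComp s nu ∈ orbit mu ↔ nu ∈ orbit mu := by
  simp only [mem_orbit]
  constructor
  · rintro ⟨t, ht⟩
    exact ⟨s⁻¹ * t, by rw [permComp_mul, ht, ← permComp_mul, inv_mul_cancel, permComp_one]⟩
  · rintro ⟨t, rfl⟩
    exact ⟨s * t, permComp_mul _ _ _⟩

theorem orbit_eq {mu nu : Fin n → ℕ} (h : nu ∈ orbit mu) : orbit nu = orbit mu := by
  obtain ⟨s, rfl⟩ := mem_orbit.1 h
  ext k
  simp only [mem_orbit]
  constructor
  · rintro ⟨t, rfl⟩
    exact ⟨t * s, permComp_mul _ _ _⟩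
  · rintro ⟨t, rfl⟩
    exact ⟨t * s⁻¹, by rw [← permComp_mul, inv_mul_cancel_right]⟩

theorem sum_orbit_permComp {M : Type*} [AddCommMonoid M] (mu : Fin n → ℕ)
    (s : Equiv.Perm (Fin n)) (g : (Fin n → ℕ) → M) :
    ∑ nu ∈ orbit mu, g (permComp s nu) = ∑ nu ∈ orbit mu, g nu := by
  refine Finset.sum_bij' (fun nu _ => permComp s nu) (fun nu _ => permComp s⁻¹ nu)
    (fun nu h => (permComp_mem_orbit s).2 h) (fun nu h => (permComp_mem_orbit s⁻¹).2 h) ?_ ?_ ?_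
  · intro nu _
    rw [← permComp_mul, inv_mul_cancel, permComp_one]
  · intro nu _
    rw [← permComp_mul, mul_inv_cancel, permComp_one]
  · intros; rfl

theorem card_filter_permComp (s : Equiv.Perm (Fin n)) (p : Fin n → Prop) [DecidablePred p] :
    (Finset.univ.filter fun k => p (s k)).card = (Finset.univ.filter p).card := by
  refine Finset.card_bij (fun k _ => s k) (by simp) (fun a _ b _ h => s.injective h) fun b hb =>
    ⟨s.symm b, by simpa using hb, by simp⟩

theorem card_filter_of_mem_orbit {mu nu : Fin n → ℕ} (h : nu ∈ orbit mu) (p : ℕ → Prop)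
    [DecidablePred p] :
    (Finset.univ.filter fun k => p (nu k)).card = (Finset.univ.filter fun k => p (mu k)).card := by
  obtain ⟨s, rfl⟩ := mem_orbit.1 h
  exact card_filter_permComp s⁻¹ (fun k => p (mu k))

theorem dec_permComp (s : Equiv.Perm (Fin n)) (mu : Fin n → ℕ) :
    dec (permComp s mu) = permComp s (dec mu) := rfl

theorem unfixed_permComp (s : Equiv.Perm (Fin n)) (mu nu : Fin n → ℕ) (a : ℕ) :
    unfixed (permComp s mu) (permComp s nu) a = unfixed mu nu a :=
  card_filter_permComp s⁻¹ (fun k => mu k = a ∧ nu k + 1 < a)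

theorem between_permComp (s : Equiv.Perm (Fin n)) (mu : Fin n → ℕ) (a : ℕ) :
    between (permComp s mu) a = between mu a :=
  card_filter_permComp s⁻¹ (fun k => 0 < mu k ∧ mu k < a)

theorem blocked_permComp (s : Equiv.Perm (Fin n)) (mu nu : Fin n → ℕ) :
    Blocked (permComp s mu) (permComp s nu) ↔ Blocked mu nu :=
  ⟨fun ⟨k, h⟩ => ⟨s⁻¹ k, h⟩, fun ⟨k, h⟩ => ⟨s k, by simpa [permComp] using h⟩⟩

theorem pairWeight_permComp (α : ℝ) (R : ℕ) (s : Equiv.Perm (Fin n)) (mu nu : Fin n → ℕ) :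
    pairWeight α R (permComp s mu) (permComp s nu) = pairWeight α R mu nu := by
  rw [pairWeight, pairWeight]
  by_cases h : Blocked mu nu
  · rw [if_pos h, if_pos ((blocked_permComp s mu nu).2 h)]
  · rw [if_neg h, if_neg (mt (blocked_permComp s mu nu).1 h)]
    simp only [unfixed_permComp, between_permComp]

theorem pairWeight_eq_zero {α : ℝ} {R : ℕ} {mu nu : Fin n → ℕ} (h : Blocked mu nu) :
    pairWeight α R mu nu = 0 := if_pos h

theorem pairWeight_congr {α : ℝ} {R : ℕ} {mu nu nu' : Fin n → ℕ} (h : ¬ Blocked mu nu)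
    (h' : ¬ Blocked mu nu') (hu : ∀ a, unfixed mu nu a = unfixed mu nu' a) :
    pairWeight α R mu nu = pairWeight α R mu nu' := by
  rw [pairWeight, pairWeight, if_neg h, if_neg h']
  simp only [hu]

/-- With one unfixed position fewer, the product for a loses its last factor u/(D + u), where D =
(a-1)α + `between mu a`. The weight is therefore multiplied by (D + u)/u = 1 + D/u; positivity of α
keeps D + u nonzero. -/
theorem pairWeight_succ {α : ℝ} (hα : 0 < α) {R : ℕ} {mu nu nu' : Fin n → ℕ}
    (h : ¬ Blocked mu nu) (h' : ¬ Blocked mu nu') {a : ℕ} (ha : 2 ≤ a) (haR : a ≤ R)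
    (hua : unfixed mu nu a = unfixed mu nu' a + 1)
    (hu : ∀ c, c ≠ a → unfixed mu nu c = unfixed mu nu' c) :
    pairWeight α R mu nu' = pairWeight α R mu nu *
      (1 + (((a : ℝ) - 1) * α + between mu a) / unfixed mu nu a) := by
  rw [pairWeight, pairWeight, if_neg h, if_neg h']
  have hm : a ∈ Finset.Icc 2 R := Finset.mem_Icc.2 ⟨ha, haR⟩
  rw [← Finset.mul_prod_erase _ _ hm, ← Finset.mul_prod_erase _ _ hm]
  have hrest : ∏ c ∈ (Finset.Icc 2 R).erase a, ∏ k ∈ Finset.Icc 1 (unfixed mu nu' c),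
      (k : ℝ) / (((c : ℝ) - 1) * α + between mu c + k) =
      ∏ c ∈ (Finset.Icc 2 R).erase a, ∏ k ∈ Finset.Icc 1 (unfixed mu nu c),
        (k : ℝ) / (((c : ℝ) - 1) * α + between mu c + k) :=
    Finset.prod_congr rfl fun c hc => by rw [hu c (Finset.ne_of_mem_erase hc)]
  rw [hrest]
  generalize ∏ c ∈ (Finset.Icc 2 R).erase a, ∏ k ∈ Finset.Icc 1 (unfixed mu nu c),
        (k : ℝ) / (((c : ℝ) - 1) * α + between mu c + k) = Q
  rw [hua, Finset.prod_Icc_succ_top (by omega)]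
  have ha' : (2 : ℝ) ≤ a := by exact_mod_cast ha
  have : 0 < ((a : ℝ) - 1) * α + between mu a + (unfixed mu nu' a + 1 : ℕ) := by
    have : 0 < ((a : ℝ) - 1) * α := mul_pos (by linarith) hα
    positivity
  have h2 : (0 : ℝ) < ((unfixed mu nu' a + 1 : ℕ) : ℝ) := by positivity
  generalize ∏ k ∈ Finset.Icc 1 (unfixed mu nu' a),
        (k : ℝ) / (((a : ℝ) - 1) * α + between mu a + k) = Q'
  generalize ((unfixed mu nu' a + 1 : ℕ) : ℝ) = u at *
  field_simp
  ring

/-! ### Exchanging two entries: counts and exchange identities -/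

theorem sum_swap {M : Type*} [AddCommMonoid M] {i j : Fin n} (hij : i ≠ j) (nu : Fin n → ℕ)
    (g : Fin n → ℕ → M) :
    ∑ k, g k (permComp (Equiv.swap i j) nu k) + (g i (nu i) + g j (nu j)) =
      ∑ k, g k (nu k) + (g i (nu j) + g j (nu i)) := by
  classical
  have key : ∀ f : Fin n → M, ∑ k, f k = (f i + f j) + ∑ k ∈ (Finset.univ.erase i).erase j, f k := by
    intro f
    rw [← Finset.add_sum_erase _ _ (Finset.mem_univ i),
      ← Finset.add_sum_erase _ _ (Finset.mem_erase.2 ⟨hij.symm, Finset.mem_univ j⟩), add_assoc]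
  rw [key, key (fun k => g k (nu k))]
  have : ∑ k ∈ (Finset.univ.erase i).erase j, g k (permComp (Equiv.swap i j) nu k) =
      ∑ k ∈ (Finset.univ.erase i).erase j, g k (nu k) := by
    refine Finset.sum_congr rfl fun k hk => ?_
    simp only [Finset.mem_erase] at hk
    rw [permComp_swap_apply, Equiv.swap_apply_of_ne_of_ne hk.2.1 hk.1]
  rw [this]
  simp only [permComp_swap_apply, Equiv.swap_apply_left, Equiv.swap_apply_right]
  abel

/-- Only positions i and j change their status. Both sides carry the correction terms additively, so
that no truncated subtraction occurs and each case is settled by linear arithmetic. -/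
theorem unfixed_swap {i j : Fin n} (hij : i ≠ j) (mu nu : Fin n → ℕ) (a : ℕ) :
    unfixed mu (permComp (Equiv.swap i j) nu) a +
      ((if mu i = a ∧ nu i + 1 < a then 1 else 0) + (if mu j = a ∧ nu j + 1 < a then 1 else 0)) =
    unfixed mu nu a +
      ((if mu i = a ∧ nu j + 1 < a then 1 else 0) + (if mu j = a ∧ nu i + 1 < a then 1 else 0)) := by
  simp only [unfixed, Finset.card_filter]
  exact sum_swap hij nu fun k v => if mu k = a ∧ v + 1 < a then 1 else 0

theorem not_blocked_iff {mu nu : Fin n → ℕ} : ¬ Blocked mu nu ↔ ∀ k, mu k = 0 ∨ nu k < mu k := by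
  simp only [Blocked, not_exists, not_and, not_le]
  exact forall_congr' fun k => by rw [Nat.pos_iff_ne_zero, or_iff_not_imp_left]

theorem not_blocked_swap {mu nu : Fin n → ℕ} (h : ¬ Blocked mu nu) {i j : Fin n}
    (hi : mu i = 0 ∨ nu j < mu i) (hj : mu j = 0 ∨ nu i < mu j) :
    ¬ Blocked mu (permComp (Equiv.swap i j) nu) := by
  rw [not_blocked_iff] at h ⊢
  intro k
  rw [permComp_swap_apply]
  rcases eq_or_ne k i with rfl | hki
  · simpa using hi
  rcases eq_or_ne k j with rfl | hkj
  · simpa using hj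
  rw [Equiv.swap_apply_of_ne_of_ne hki hkj]
  exact h k

theorem blocked_swap_left {mu nu : Fin n → ℕ} {i j : Fin n} (h0 : 0 < mu i) (h : mu i ≤ nu j) :
    Blocked mu (permComp (Equiv.swap i j) nu) :=
  ⟨i, h0, by rwa [permComp_swap_apply, Equiv.swap_apply_left]⟩

theorem blocked_swap_right {mu nu : Fin n → ℕ} {i j : Fin n} (h0 : 0 < mu j) (h : mu j ≤ nu i) :
    Blocked mu (permComp (Equiv.swap i j) nu) :=
  ⟨j, h0, by rwa [permComp_swap_apply, Equiv.swap_apply_right]⟩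

theorem blocked_swap_of_ne {mu nu : Fin n → ℕ} {i j k : Fin n} (h0 : 0 < mu k) (h : mu k ≤ nu k)
    (hi : k ≠ i) (hj : k ≠ j) : Blocked mu (permComp (Equiv.swap i j) nu) :=
  ⟨k, h0, by rwa [permComp_swap_apply, Equiv.swap_apply_of_ne_of_ne hi hj]⟩

/-- Counts are invariant under rearrangement, and for c > 0 a lowered part is below c exactly when
the original part is at most c. -/
theorem card_le_of_mem_orbit_dec {mu nu : Fin n → ℕ} (h : nu ∈ orbit (dec mu)) {c : ℕ}
    (hc : 0 < c) : (Finset.univ.filter fun k => nu k < c).card =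
      (Finset.univ.filter fun k => mu k < c).card + (Finset.univ.filter fun k => mu k = c).card := by
  rw [card_filter_of_mem_orbit h (fun v => v < c), ← Finset.card_union_of_disjoint]
  · congr 1
    ext k
    simp only [Finset.mem_filter, Finset.mem_univ, true_and, Finset.mem_union]
    simp only [dec]
    omega
  · exact Finset.disjoint_filter.2 fun k _ h => by omega

theorem card_eq_of_mem_orbit_dec {mu nu : Fin n → ℕ} (h : nu ∈ orbit (dec mu)) {a : ℕ}
    (ha : 2 ≤ a) : (Finset.univ.filter fun k => nu k + 1 = a).card =
      (Finset.univ.filter fun k => mu k = a).card := by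
  rw [card_filter_of_mem_orbit h (fun v => v + 1 = a)]
  congr 1
  ext k
  simp only [Finset.mem_filter, Finset.mem_univ, true_and]
  simp only [dec]
  omega

/-- For a ≥ 2, ν has as many entries a-1 as μ has entries a. Removing the positions where both occur
leaves two sets of equal size; when nothing is blocked, an entry of ν over μ_k = a that differs from
a-1 must be smaller. -/
theorem unfixed_eq_card {mu nu : Fin n → ℕ} (h : nu ∈ orbit (dec mu)) (hb : ¬ Blocked mu nu)
    {a : ℕ} (ha : 2 ≤ a) :
    unfixed mu nu a = (Finset.univ.filter fun k => nu k + 1 = a ∧ mu k ≠ a).card := by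
  rw [not_blocked_iff] at hb
  have h1 := card_eq_of_mem_orbit_dec h ha
  rw [← Finset.card_filter_add_card_filter_not (s := Finset.univ.filter fun k => nu k + 1 = a)
      (fun k => mu k = a),
    ← Finset.card_filter_add_card_filter_not (s := Finset.univ.filter fun k => mu k = a)
      (fun k => nu k + 1 = a), Finset.filter_filter, Finset.filter_filter, Finset.filter_filter,
      Finset.filter_filter] at h1
  have h2 : (Finset.univ.filter fun k => nu k + 1 = a ∧ mu k = a) =
      (Finset.univ.filter fun k => mu k = a ∧ nu k + 1 = a) := by
    ext; simp [and_comm]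
  rw [h2, add_right_inj] at h1
  rw [h1, unfixed]
  congr 1
  ext k
  have := hb k
  simp only [Finset.mem_filter, Finset.mem_univ, true_and]
  omega

theorem sum_filter_one_add_sub (s : Finset (Fin n)) (p q : Fin n → Prop) [DecidablePred p]
    [DecidablePred q] (x : ℝ) :
    ∑ j ∈ s, (1 + (if p j then x else 0) - (if q j then 1 else 0)) =
      s.card + (s.filter p).card * x - (s.filter q).card := by
  rw [Finset.sum_sub_distrib, Finset.sum_add_distrib, ← Finset.sum_filter, ← Finset.sum_filter]
  simp

/-- Put a = ν_i + 1. Moving ν_i to position j blocks the pair if 0 < μ_j < a, fixes one more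
position if μ_j = a, and changes nothing otherwise. There are u = `unfixed mu nu a` partners of the
second kind, each gaining D/u with D = (a-1)α + `between mu a`; the blocked partners number `between
mu a` and cancel that part of D, so (a-1)α = ν_i α remains. -/
theorem sum_pairWeight_lower {α : ℝ} (hα : 0 < α) {R : ℕ} {mu nu : Fin n → ℕ}
    (hR : ∀ k, mu k ≤ R) (h : nu ∈ orbit (dec mu)) (hb : ¬ Blocked mu nu) {i : Fin n}
    (hi : mu i = 0 ∨ nu i + 1 < mu i) :
    ∑ j with nu j < nu i, pairWeight α R mu (permComp (Equiv.swap i j) nu) =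
      ((Finset.univ.filter fun j => nu j < nu i).card + nu i * α) * pairWeight α R mu nu := by
  rcases Nat.eq_zero_or_pos (nu i) with h0 | h0
  · simp [h0]
  set a := nu i + 1 with ha
  have ha2 : 2 ≤ a := by omega
  have hb' := not_blocked_iff.1 hb
  have hune : unfixed mu nu a ≠ 0 := by
    -- Position i itself carries the entry a-1 of ν over a part of μ other than a, so the count is
    -- positive and division by it is harmless.
    rw [unfixed_eq_card h hb ha2]
    refine (Finset.card_pos.2 ⟨i, ?_⟩).ne'
    simp only [Finset.mem_filter, Finset.mem_univ, true_and]
    omega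
  have haR : a ≤ R := by
    obtain ⟨k, hk⟩ := Finset.card_pos.1 (Nat.pos_of_ne_zero hune)
    simp only [Finset.mem_filter, Finset.mem_univ, true_and] at hk
    exact hk.1 ▸ hR k
  have hw : ∀ j ∈ Finset.univ.filter (fun j => nu j < nu i),
      pairWeight α R mu (permComp (Equiv.swap i j) nu) = pairWeight α R mu nu *
        (1 + (if mu j = a then ((((a : ℝ) - 1) * α + between mu a) / unfixed mu nu a) else 0) -
          (if 0 < mu j ∧ mu j < a then 1 else 0)) := by
    intro j hj
    have hj : nu j < nu i := by simpa using hj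
    have hij : i ≠ j := by rintro rfl; omega
    have hus := unfixed_swap hij mu nu
    by_cases h1 : 0 < mu j ∧ mu j < a
    · rw [pairWeight_eq_zero (blocked_swap_right h1.1 (by omega)), if_pos h1, if_neg (by omega)]
      simp
    have hnb : ¬ Blocked mu (permComp (Equiv.swap i j) nu) :=
      not_blocked_swap hb (by omega) (by omega)
    rw [if_neg h1, sub_zero]
    by_cases h2 : mu j = a
    · rw [if_pos h2]
      refine pairWeight_succ hα hb hnb ha2 haR ?_ fun c hc => ?_
      · have := hus a
        split_ifs at this <;> omega
      · have := hus c
        split_ifs at this <;> omega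
    · rw [if_neg h2, add_zero, mul_one]
      refine pairWeight_congr hnb hb fun c => ?_
      have := hus c
      split_ifs at this <;> omega
  rw [Finset.sum_congr rfl hw, ← Finset.mul_sum, sum_filter_one_add_sub, Finset.filter_filter,
    Finset.filter_filter]
  have e1 : (Finset.univ.filter fun k => nu k < nu i ∧ mu k = a).card = unfixed mu nu a := by
    rw [unfixed]; congr 1; ext k
    simp only [Finset.mem_filter, Finset.mem_univ, true_and]
    omega
  have e2 : (Finset.univ.filter fun k => nu k < nu i ∧ 0 < mu k ∧ mu k < a).card =
      between mu a := by
    rw [between]; congr 1; ext k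
    have := hb' k
    simp only [Finset.mem_filter, Finset.mem_univ, true_and]
    omega
  rw [e1, e2, mul_div_cancel₀ _ (by exact_mod_cast hune)]
  have : (a : ℝ) = nu i + 1 := by rw [ha]; push_cast; ring
  rw [this]
  ring

/-- The counterpart of `sum_pairWeight_lower` with c = μ_i in place of ν_i + 1. A partner j blocks
when ν_j ≥ c and makes position i fixed when ν_j + 1 = c; by `unfixed_eq_card` there are exactly
`unfixed mu nu c` of the latter. -/
theorem sum_pairWeight_upper {α : ℝ} (hα : 0 < α) {R : ℕ} {mu nu : Fin n → ℕ}
    (hR : ∀ k, mu k ≤ R) (h : nu ∈ orbit (dec mu)) (hb : ¬ Blocked mu nu) {i : Fin n}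
    (hi : nu i + 1 < mu i) :
    ∑ j with mu i < mu j ∨ mu j = 0, pairWeight α R mu (permComp (Equiv.swap i j) nu) =
      ((Finset.univ.filter fun j => mu j < mu i).card + (mu i - 1) * α) *
        pairWeight α R mu nu := by
  set c := mu i with hc
  have hc2 : 2 ≤ c := by omega
  have hb' := not_blocked_iff.1 hb
  have hune : unfixed mu nu c ≠ 0 := by
    refine (Finset.card_pos.2 ⟨i, ?_⟩).ne'
    simp only [Finset.mem_filter, Finset.mem_univ, true_and]
    omega
  have hcR : c ≤ R := hR i
  have hw : ∀ j ∈ Finset.univ.filter (fun j => c < mu j ∨ mu j = 0),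
      pairWeight α R mu (permComp (Equiv.swap i j) nu) = pairWeight α R mu nu *
        (1 + (if nu j + 1 = c then ((((c : ℝ) - 1) * α + between mu c) / unfixed mu nu c) else 0) -
          (if c < nu j + 1 then 1 else 0)) := by
    intro j hj
    have hj : c < mu j ∨ mu j = 0 := by simpa using hj
    have hij : i ≠ j := by rintro rfl; omega
    have hus := unfixed_swap hij mu nu
    by_cases h1 : c < nu j + 1
    · rw [pairWeight_eq_zero (blocked_swap_left (by omega) (by omega)), if_pos h1,
        if_neg (by omega)]
      simp
    have hnb : ¬ Blocked mu (permComp (Equiv.swap i j) nu) :=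
      not_blocked_swap hb (by omega) (by omega)
    rw [if_neg h1, sub_zero]
    by_cases h2 : nu j + 1 = c
    · rw [if_pos h2]
      refine pairWeight_succ hα hb hnb hc2 hcR ?_ fun d hd => ?_
      · have := hus c
        split_ifs at this <;> omega
      · have := hus d
        split_ifs at this <;> omega
    · rw [if_neg h2, add_zero, mul_one]
      refine pairWeight_congr hnb hb fun d => ?_
      have := hus d
      split_ifs at this <;> omega
  rw [Finset.sum_congr rfl hw, ← Finset.mul_sum, sum_filter_one_add_sub, Finset.filter_filter,
    Finset.filter_filter]
  have e1 : (Finset.univ.filter fun k => (c < mu k ∨ mu k = 0) ∧ nu k + 1 = c).card =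
      unfixed mu nu c := by
    rw [unfixed_eq_card h hb hc2]; congr 1; ext k
    have := hb' k
    simp only [Finset.mem_filter, Finset.mem_univ, true_and]
    omega
  -- The conditions on j are disjoint from 0 < μ_j < c and μ_j = c, so comparing how many entries of
  -- ν and of μ lie below c converts the number of admissible partners into the number of j with μ_j
  -- < c.
  have e2 : (Finset.univ.filter fun k => c < mu k ∨ mu k = 0).card + between mu c =
      (Finset.univ.filter fun k => mu k < c).card +
        (Finset.univ.filter fun k => (c < mu k ∨ mu k = 0) ∧ c < nu k + 1).card := by
    have h3 := card_le_of_mem_orbit_dec h (by omega : 0 < c)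
    have h4 : (Finset.univ.filter fun k => nu k < c).card +
        (Finset.univ.filter fun k => (c < mu k ∨ mu k = 0) ∧ c < nu k + 1).card =
        (Finset.univ.filter fun k => c < mu k ∨ mu k = 0).card + between mu c +
        (Finset.univ.filter fun k => mu k = c).card := by
      simp only [between, Finset.card_filter, ← Finset.sum_add_distrib]
      refine Finset.sum_congr rfl fun k _ => ?_
      have := hb' k
      split_ifs <;> omega
    omega
  have e3 : ((Finset.univ.filter fun k => c < mu k ∨ mu k = 0).card : ℝ) + between mu c =
      (Finset.univ.filter fun k => mu k < c).card +
        (Finset.univ.filter fun k => (c < mu k ∨ mu k = 0) ∧ c < nu k + 1).card := by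
    exact_mod_cast e2
  rw [e1, mul_div_cancel₀ _ (by exact_mod_cast hune)]
  linear_combination (pairWeight α R mu nu) * e3

/-- The exchange identity at an empty position. -/
theorem pairWeight_exchange_zero {α : ℝ} (hα : 0 < α) {R : ℕ} {mu nu : Fin n → ℕ}
    (hR : ∀ k, mu k ≤ R) (h : nu ∈ orbit (dec mu)) {i : Fin n} (hi : mu i = 0) :
    ∑ j with nu j < nu i, pairWeight α R mu (permComp (Equiv.swap i j) nu) =
      (nu i * α + (Finset.univ.filter fun j => nu j < nu i).card) * pairWeight α R mu nu := by
  by_cases hb : Blocked mu nu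
  · rw [pairWeight_eq_zero hb, mul_zero]
    obtain ⟨k, hk0, hk⟩ := hb
    refine Finset.sum_eq_zero fun j hj => pairWeight_eq_zero ?_
    have hj : nu j < nu i := by simpa using hj
    rcases eq_or_ne k j with rfl | hkj
    · exact blocked_swap_right hk0 (by omega)
    · exact blocked_swap_of_ne hk0 hk (by rintro rfl; omega) hkj
  · rw [sum_pairWeight_lower hα hR h hb (Or.inl hi)]
    ring

/-- The exchange identity at an occupied position. -/
theorem pairWeight_exchange_pos {α : ℝ} (hα : 0 < α) {R : ℕ} {mu nu : Fin n → ℕ}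
    (hR : ∀ k, mu k ≤ R) (h : nu ∈ orbit (dec mu)) {i : Fin n} (hi : 0 < mu i) :
    ∑ j with nu j < nu i, pairWeight α R mu (permComp (Equiv.swap i j) nu) -
      ∑ j with mu i < mu j ∨ mu j = 0, pairWeight α R mu (permComp (Equiv.swap i j) nu) =
      ((nu i + 1 - mu i) * α + (Finset.univ.filter fun j => nu j < nu i).card -
        (Finset.univ.filter fun j => mu j < mu i).card) * pairWeight α R mu nu := by
  by_cases hb : Blocked mu nu
  -- If the pair is blocked at some k, the two sums agree term by term. An exchange either leaves a
  -- blocked position, giving weight zero, or k = i and the exchange unblocks everything, in which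
  -- case j satisfies both summation conditions.
  · rw [pairWeight_eq_zero hb, mul_zero, sub_eq_zero, Finset.sum_filter, Finset.sum_filter]
    refine Finset.sum_congr rfl fun j _ => ?_
    obtain ⟨k, hk0, hk⟩ := hb
    by_cases hki : k = i
    · subst hki
      by_cases h1 : mu k ≤ nu j
      · rw [pairWeight_eq_zero (blocked_swap_left hk0 h1)]; simp
      · by_cases h2 : 0 < mu j ∧ mu j ≤ nu k
        · rw [pairWeight_eq_zero (blocked_swap_right h2.1 h2.2)]; simp
        · rw [if_pos (by omega), if_pos (by omega)]
    · by_cases hkj : k = j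
      · subst hkj
        have e1 : nu k < nu i → Blocked mu (permComp (Equiv.swap i k) nu) := fun hlt =>
          blocked_swap_right hk0 (by omega)
        have e2 : mu i < mu k ∨ mu k = 0 → Blocked mu (permComp (Equiv.swap i k) nu) := fun hlt =>
          blocked_swap_left hi (by omega)
        split_ifs with h1 h2 h2
        · rfl
        · exact pairWeight_eq_zero (e1 h1)
        · exact (pairWeight_eq_zero (e2 h2)).symm
        · rfl
      · rw [pairWeight_eq_zero (blocked_swap_of_ne hk0 hk hki hkj)]; simp
  have hb' := not_blocked_iff.1 hb
  by_cases hfix : nu i + 1 = mu i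
  · set a := mu i with ha
    -- When position i is fixed, every term of the difference of the two sums is 0 or plus or minus
    -- the original weight, so only two counts have to be compared.
    have hw : ∀ j, ((if nu j < nu i then pairWeight α R mu (permComp (Equiv.swap i j) nu) else 0) -
        (if a < mu j ∨ mu j = 0 then pairWeight α R mu (permComp (Equiv.swap i j) nu) else 0)) =
        ((if mu j = a ∧ nu j + 1 < a then 1 else 0) -
          (if nu j + 1 = a ∧ mu j ≠ a then 1 else 0)) * pairWeight α R mu nu := by
      intro j
      by_cases hij : i = j
      · subst hij
        rw [if_neg (by omega), if_neg (by omega), if_neg (by omega), if_neg (by omega)]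
        simp
      have hus := unfixed_swap hij mu nu
      have hj := hb' j
      rcases lt_trichotomy (nu j + 1) a with h1 | h1 | h1
      · rw [if_pos (by omega), if_neg (by omega : ¬ (nu j + 1 = a ∧ mu j ≠ a)), sub_zero]
        rcases lt_trichotomy (mu j) a with h2 | h2 | h2
        · rw [if_neg (by omega : ¬ (mu j = a ∧ nu j + 1 < a)), zero_mul]
          by_cases h3 : mu j = 0
          · rw [if_pos (Or.inr h3), sub_self]
          · rw [pairWeight_eq_zero (blocked_swap_right (by omega) (by omega))]; simp
        · rw [if_neg (by omega : ¬ (a < mu j ∨ mu j = 0)), if_pos ⟨h2, h1⟩, one_mul, sub_zero]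
          refine pairWeight_congr (not_blocked_swap hb (by omega) (by omega)) hb fun d => ?_
          have := hus d
          split_ifs at this <;> omega
        · rw [if_neg (by omega : ¬ (mu j = a ∧ nu j + 1 < a)), zero_mul, if_pos (Or.inl h2),
            sub_self]
      · rw [if_neg (by omega), if_neg (by omega : ¬ (mu j = a ∧ nu j + 1 < a)),
          permComp_swap_eq_self (by omega)]
        by_cases h2 : mu j = a
        · rw [if_neg (by omega), if_neg (by omega)]; simp
        · rw [if_pos (by omega), if_pos ⟨h1, h2⟩]; simp
      · rw [pairWeight_eq_zero (blocked_swap_left (by omega) (by omega)),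
          if_neg (by omega : ¬ (mu j = a ∧ nu j + 1 < a)),
          if_neg (by omega : ¬ (nu j + 1 = a ∧ mu j ≠ a))]
        simp
    rw [Finset.sum_filter, Finset.sum_filter, ← Finset.sum_sub_distrib,
      Finset.sum_congr rfl fun j _ => hw j, ← Finset.sum_mul, Finset.sum_sub_distrib]
    congr 1
    simp only [Finset.sum_boole]
    have e0 : (nu i : ℝ) + 1 - a = 0 := by rw [← hfix]; push_cast; ring
    rw [e0, zero_mul, zero_add]
    -- The value a = 1 is possible here, where `unfixed_eq_card` is not available; the comparison is
    -- therefore made by counting entries below a directly.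
    have key : (Finset.univ.filter fun j => mu j = a ∧ nu j + 1 < a).card +
        (Finset.univ.filter fun j => mu j < a).card =
        (Finset.univ.filter fun j => nu j < nu i).card +
        (Finset.univ.filter fun j => nu j + 1 = a ∧ mu j ≠ a).card := by
      have h3 := card_le_of_mem_orbit_dec h hi
      have h4 : (Finset.univ.filter fun j => nu j < a).card +
          (Finset.univ.filter fun j => mu j = a ∧ nu j + 1 < a).card =
          (Finset.univ.filter fun j => nu j < nu i).card +
          (Finset.univ.filter fun j => nu j + 1 = a ∧ mu j ≠ a).card +
          (Finset.univ.filter fun k => mu k = a).card := by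
        simp only [Finset.card_filter, ← Finset.sum_add_distrib]
        refine Finset.sum_congr rfl fun k _ => ?_
        have := hb' k
        split_ifs <;> omega
      omega
    have key' : ((Finset.univ.filter fun j => mu j = a ∧ nu j + 1 < a).card : ℝ) +
        (Finset.univ.filter fun j => mu j < a).card =
        (Finset.univ.filter fun j => nu j < nu i).card +
        (Finset.univ.filter fun j => nu j + 1 = a ∧ mu j ≠ a).card := by exact_mod_cast key
    linarith
  · have hlt : nu i + 1 < mu i := by have := hb' i; omega
    rw [sum_pairWeight_lower hα hR h hb (Or.inr hlt), sum_pairWeight_upper hα hR h hb hlt]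
    ring

/-! ### The recursion and the Knizhnik--Zamolodchikov equations -/

/-- The nonsymmetric polynomials `f_mu`; `R` bounds the parts of `mu`. -/
def fPoly (α : ℝ) : ℕ → (Fin n → ℕ) → MvPolynomial (Fin n) ℝ
  | 0, _ => 1
  | R + 1, mu => xMon mu * ∑ nu ∈ orbit (dec mu), pairWeight α (R + 1) mu nu • fPoly α R nu

theorem rename_xMon (s : Equiv.Perm (Fin n)) (mu : Fin n → ℕ) :
    rename s (xMon mu) = xMon (permComp s mu) := by
  simp only [xMon, Finset.prod_filter, map_prod]
  rw [← Equiv.prod_comp s (fun i => if 0 < permComp s mu i then (X i : MvPolynomial (Fin n) ℝ) else 1)]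
  refine Finset.prod_congr rfl fun i _ => ?_
  have : permComp s mu (s i) = mu i := by simp [permComp]
  rw [this, apply_ite (rename s), rename_X, map_one]

/-- Supports, lowered orbits and weights are all compatible with simultaneous permutation of
positions, so equivariance passes through the recursion. -/
theorem rename_fPoly (α : ℝ) (R : ℕ) (s : Equiv.Perm (Fin n)) (mu : Fin n → ℕ) :
    rename s (fPoly α R mu) = fPoly α R (permComp s mu) := by
  induction R generalizing mu with
  | zero => simp [fPoly]
  | succ R ih =>
    rw [fPoly, fPoly, map_mul, rename_xMon, map_sum, dec_permComp,
      orbit_eq ((permComp_mem_orbit s).2 (self_mem_orbit (dec mu))),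
      ← sum_orbit_permComp (dec mu) s
        (fun nu => pairWeight α (R + 1) (permComp s mu) nu • fPoly α R nu)]
    simp only [map_smul, ih, pairWeight_permComp]

/-- Here z collects the variables other than x_i and x_j. Factoring it out reduces the comparison of
x_μ with its exchanged version to rational identities in x_i and x_j. -/
theorem xMon_swap {i j : Fin n} (hij : i ≠ j) (mu : Fin n → ℕ) (x : Fin n → ℝ) :
    ∃ z, eval x (xMon mu) = (if 0 < mu i then x i else 1) * (if 0 < mu j then x j else 1) * z ∧
      eval x (xMon (permComp (Equiv.swap i j) mu)) =
        (if 0 < mu j then x i else 1) * (if 0 < mu i then x j else 1) * z := by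
  classical
  have key : ∀ f : Fin n → ℝ, ∏ k, f k = (f i * f j) * ∏ k ∈ (Finset.univ.erase i).erase j, f k := by
    intro f
    rw [← Finset.mul_prod_erase _ _ (Finset.mem_univ i),
      ← Finset.mul_prod_erase _ _ (Finset.mem_erase.2 ⟨hij.symm, Finset.mem_univ j⟩), mul_assoc]
  refine ⟨∏ k ∈ (Finset.univ.erase i).erase j, if 0 < mu k then x k else 1, ?_, ?_⟩
  · rw [xMon, Finset.prod_filter, map_prod]
    simp only [apply_ite (eval x), eval_X, map_one]
    exact key _
  · rw [xMon, Finset.prod_filter, map_prod]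
    simp only [apply_ite (eval x), eval_X, map_one]
    rw [key]
    simp only [permComp_swap_apply, Equiv.swap_apply_left, Equiv.swap_apply_right]
    congr 1
    refine Finset.prod_congr rfl fun k hk => ?_
    simp only [Finset.mem_erase] at hk
    rw [Equiv.swap_apply_of_ne_of_ne hk.2.1 hk.1]

theorem X_mul_pderiv_xMon (mu : Fin n → ℕ) (i : Fin n) :
    X i * pderiv i (xMon mu) = if 0 < mu i then xMon mu else 0 := by
  classical
  have h0 : ∀ s : Finset (Fin n), i ∉ s → pderiv i (∏ k ∈ s, (X k : MvPolynomial (Fin n) ℝ)) = 0 := by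
    intro s hs
    induction s using Finset.induction_on with
    | empty => simp
    | insert a s ha ih =>
      rw [Finset.prod_insert ha, Derivation.leibniz, ih (by simp_all),
        pderiv_X_of_ne (by rintro rfl; simp at hs)]
      simp
  rw [xMon]
  split_ifs with h
  · rw [← Finset.mul_prod_erase _ _ (Finset.mem_filter.2 ⟨Finset.mem_univ i, h⟩),
      Derivation.leibniz, h0 _ (by simp)]
    simp [mul_comm]
  · rw [h0 _ (by simp [h]), mul_zero]

/-- The Knizhnik--Zamolodchikov equations for a family of polynomials at a point `x`. -/
def KZAt (α : ℝ) (f : (Fin n → ℕ) → MvPolynomial (Fin n) ℝ) (x : Fin n → ℝ) (mu : Fin n → ℕ)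
    (i : Fin n) : Prop :=
  α * (x i * eval x (pderiv i (f mu))) =
    (α * mu i + (Finset.univ.filter fun j => mu j < mu i).card) * eval x (f mu) -
      ∑ j with mu i < mu j, eval x (f (permComp (Equiv.swap i j) mu)) -
      ∑ j, x i / (x i - x j) * (eval x (f mu) - eval x (f (permComp (Equiv.swap i j) mu)))

/-- The equations of the f_ν are averaged against the weights. Since the orbit is stable under
exchanging i and j, reindexing moves the exchange from f_ν onto the weight and reverses the
condition ν_i < ν_j, producing the sums in the exchange identities. The divided differences pass
through the average because weights are invariant under permuting both arguments. -/
theorem kz_sum_exchange {α : ℝ} (R : ℕ) (f : (Fin n → ℕ) → MvPolynomial (Fin n) ℝ)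
    (x : Fin n → ℝ) (mu : Fin n → ℕ) (i : Fin n)
    (hf : ∀ nu ∈ orbit (dec mu), KZAt α f x nu i)
    (H : (Fin n → ℕ) → ℝ)
    (hH : ∀ mu, H mu = ∑ nu ∈ orbit (dec mu), pairWeight α R mu nu * eval x (f nu)) :
    α * (x i * ∑ nu ∈ orbit (dec mu), pairWeight α R mu nu * eval x (pderiv i (f nu))) =
      ∑ nu ∈ orbit (dec mu), ((nu i * α + (Finset.univ.filter fun j => nu j < nu i).card) *
        pairWeight α R mu nu -
        ∑ j with nu j < nu i, pairWeight α R mu (permComp (Equiv.swap i j) nu)) * eval x (f nu) -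
      ∑ j, x i / (x i - x j) * (H mu - H (permComp (Equiv.swap i j) mu)) := by
  have hs : ∀ j, H (permComp (Equiv.swap i j) mu) = ∑ nu ∈ orbit (dec mu),
      pairWeight α R mu nu * eval x (f (permComp (Equiv.swap i j) nu)) := by
    intro j
    rw [hH, dec_permComp, orbit_eq ((permComp_mem_orbit _).2 (self_mem_orbit (dec mu))),
      ← sum_orbit_permComp (dec mu) (Equiv.swap i j)]
    simp only [pairWeight_permComp]
  have h1 : ∑ nu ∈ orbit (dec mu), pairWeight α R mu nu *
      ∑ j with nu i < nu j, eval x (f (permComp (Equiv.swap i j) nu)) =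
      ∑ nu ∈ orbit (dec mu), (∑ j with nu j < nu i,
        pairWeight α R mu (permComp (Equiv.swap i j) nu)) * eval x (f nu) := by
    simp only [Finset.sum_filter, Finset.mul_sum, Finset.sum_mul]
    rw [Finset.sum_comm, Finset.sum_comm (s := orbit (dec mu))]
    refine Finset.sum_congr rfl fun j _ => ?_
    rw [← sum_orbit_permComp (dec mu) (Equiv.swap i j)]
    simp only [permComp_swap_swap, permComp_swap_apply, Equiv.swap_apply_left,
      Equiv.swap_apply_right]
    refine Finset.sum_congr rfl fun nu _ => ?_
    split_ifs <;> simp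
  have h2 : ∑ j, x i / (x i - x j) * (H mu - H (permComp (Equiv.swap i j) mu)) =
      ∑ nu ∈ orbit (dec mu), pairWeight α R mu nu * ∑ j, x i / (x i - x j) *
        (eval x (f nu) - eval x (f (permComp (Equiv.swap i j) nu))) := by
    simp only [hs, hH mu, ← Finset.sum_sub_distrib, Finset.mul_sum]
    rw [Finset.sum_comm]
    refine Finset.sum_congr rfl fun nu _ => Finset.sum_congr rfl fun j _ => by ring
  rw [h2]
  simp only [sub_mul, Finset.sum_sub_distrib]
  rw [← h1, Finset.mul_sum, Finset.mul_sum, ← Finset.sum_sub_distrib, ← Finset.sum_sub_distrib]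
  refine Finset.sum_congr rfl fun nu hnu => ?_
  have := hf nu hnu
  rw [KZAt] at this
  linear_combination (pairWeight α R mu nu) * this

/-- Induction along f_μ = x_μ H(μ): x_i ∂_i acts on x_μ as 1 or 0 according as μ_i is positive or
not, and on H through `kz_sum_exchange`. The exchange identities evaluate the resulting
coefficients; the discrepancy between x_μ and its exchanged version is elementary algebra. -/
theorem kz_fPoly {α : ℝ} (hα : 0 < α) (R : ℕ) (mu : Fin n → ℕ) (hR : ∀ k, mu k ≤ R)
    (x : Fin n → ℝ) (hx : Function.Injective x) (i : Fin n) : KZAt α (fPoly α R) x mu i := by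
  induction R generalizing mu i with
  | zero =>
    have h0 : ∀ k, mu k = 0 := fun k => Nat.le_zero.1 (hR k)
    simp [KZAt, fPoly, h0]
  | succ R ih =>
    have hRdec : ∀ nu ∈ orbit (dec mu), ∀ k, nu k ≤ R := by
      intro nu hnu k
      obtain ⟨s, rfl⟩ := mem_orbit.1 hnu
      have := hR (s⁻¹ k)
      simp only [permComp, dec]
      omega
    set H : (Fin n → ℕ) → ℝ := fun mu =>
      ∑ nu ∈ orbit (dec mu), pairWeight α (R + 1) mu nu * eval x (fPoly α R nu) with hH
    have hev : ∀ mu : Fin n → ℕ, eval x (fPoly α (R + 1) mu) = eval x (xMon mu) * H mu := by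
      intro mu
      simp [fPoly, hH, smul_eval]
    have hex := kz_sum_exchange (R + 1) (fPoly α R) x mu i
      (fun nu hnu => ih nu (hRdec nu hnu) i) H (fun _ => rfl)
    have hd : x i * eval x (pderiv i (fPoly α (R + 1) mu)) =
        (if 0 < mu i then eval x (xMon mu) else 0) * H mu + eval x (xMon mu) *
          (x i * ∑ nu ∈ orbit (dec mu), pairWeight α (R + 1) mu nu *
            eval x (pderiv i (fPoly α R nu))) := by
      have h := congrArg (eval x) (X_mul_pderiv_xMon mu i)
      rw [apply_ite (eval x), map_zero, map_mul, eval_X] at h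
      rw [← h, fPoly, Derivation.leibniz]
      simp only [smul_eq_mul, map_add, map_mul, map_sum, smul_eval, Derivation.map_smul, hH]
      ring
    rw [KZAt, hd, mul_add, ← mul_assoc α, mul_left_comm α (eval x (xMon mu)), hex]
    simp only [hev]
    have hc : ∀ j, i ≠ j → x i - x j ≠ 0 := fun j hj => sub_ne_zero.2 fun h => hj (hx h)
    -- At an empty position the exchange identity annihilates every averaged coefficient, and the
    -- claim holds separately for each j as an identity in x_i and x_j.
    by_cases hi : mu i = 0
    · rw [Finset.sum_eq_zero fun nu hnu => by
        rw [pairWeight_exchange_zero hα hR hnu hi, sub_self, zero_mul]]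
      simp only [hi, lt_irrefl, if_false, Nat.cast_zero, mul_zero, zero_mul, Nat.not_lt_zero,
        Finset.filter_false, Finset.card_empty, add_zero, zero_add, zero_sub, Finset.sum_filter]
      rw [← neg_add', ← Finset.sum_add_distrib, mul_neg, Finset.mul_sum]
      congr 1
      refine Finset.sum_congr rfl fun j _ => ?_
      by_cases hij : i = j
      · subst hij; simp [hi]
      obtain ⟨z, hz, hz'⟩ := xMon_swap hij mu x
      rw [hz, hz']
      have := hc j hij
      simp only [hi, lt_irrefl, if_false]
      split_ifs
      · field_simp
        ring
      · field_simp
        ring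
    · have hi' : 0 < mu i := Nat.pos_of_ne_zero hi
      have hsum : ∑ nu ∈ orbit (dec mu), ((nu i * α +
          (Finset.univ.filter fun j => nu j < nu i).card) * pairWeight α (R + 1) mu nu -
          ∑ j with nu j < nu i, pairWeight α (R + 1) mu (permComp (Equiv.swap i j) nu)) *
            eval x (fPoly α R nu) =
          ((mu i - 1) * α + (Finset.univ.filter fun j => mu j < mu i).card) * H mu -
          ∑ j with mu i < mu j ∨ mu j = 0, H (permComp (Equiv.swap i j) mu) := by
        have hs : ∀ j, H (permComp (Equiv.swap i j) mu) = ∑ nu ∈ orbit (dec mu),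
            pairWeight α (R + 1) mu (permComp (Equiv.swap i j) nu) * eval x (fPoly α R nu) := by
          intro j
          rw [hH]
          simp only []
          rw [dec_permComp, orbit_eq ((permComp_mem_orbit _).2 (self_mem_orbit (dec mu)))]
          refine Finset.sum_congr rfl fun nu _ => ?_
          rw [← pairWeight_permComp α (R + 1) (Equiv.swap i j), permComp_swap_swap]
        rw [Finset.sum_congr rfl fun j _ => hs j, Finset.sum_comm, hH, Finset.mul_sum,
          ← Finset.sum_sub_distrib]
        refine Finset.sum_congr rfl fun nu hnu => ?_
        have := pairWeight_exchange_pos hα hR hnu hi'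
        rw [← Finset.sum_mul]
        linear_combination (-eval x (fPoly α R nu)) * this
      rw [hsum, if_pos hi']
      -- Since μ_i > 0, exchanging i and j changes x_μ only if μ_j = 0. The terms with μ_j = 0 in
      -- the exchange identity are exactly what this change costs in the divided difference.
      have hfin : eval x (xMon mu) * (∑ j with mu i < mu j ∨ mu j = 0,
          H (permComp (Equiv.swap i j) mu)) + eval x (xMon mu) *
          ∑ j, x i / (x i - x j) * (H mu - H (permComp (Equiv.swap i j) mu)) =
          ∑ j with mu i < mu j, eval x (xMon (permComp (Equiv.swap i j) mu)) *
            H (permComp (Equiv.swap i j) mu) +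
          ∑ j, x i / (x i - x j) * (eval x (xMon mu) * H mu -
            eval x (xMon (permComp (Equiv.swap i j) mu)) * H (permComp (Equiv.swap i j) mu)) := by
        simp only [Finset.sum_filter, Finset.mul_sum]
        rw [← Finset.sum_add_distrib, ← Finset.sum_add_distrib]
        refine Finset.sum_congr rfl fun j _ => ?_
        by_cases hij : i = j
        · subst hij; simp [hi]
        obtain ⟨z, hz, hz'⟩ := xMon_swap hij mu x
        rw [hz, hz']
        have := hc j hij
        simp only [hi', if_true]
        by_cases hj : mu j = 0
        · simp only [hj, lt_irrefl, if_false, if_true, or_true, Nat.not_lt_zero]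
          field_simp
          ring
        · simp only [Nat.pos_of_ne_zero hj, if_true, hj, or_false]
          split_ifs
          · field_simp
          · field_simp
            ring
      linear_combination (-1 : ℝ) * hfin

/-! ### The differential equation of the symmetric sum -/

/-- The Euler operator `x_i ∂ / ∂ x_i`. -/
def theta (i : Fin n) : MvPolynomial (Fin n) ℝ →ₗ[ℝ] MvPolynomial (Fin n) ℝ :=
  LinearMap.mulLeft ℝ (X i) ∘ₗ (pderiv i).toLinearMap

theorem theta_apply (i : Fin n) (g : MvPolynomial (Fin n) ℝ) : theta i g = X i * pderiv i g := rfl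

/-- The sum of the `f_nu` over all rearrangements `nu` of `lam`. -/
def symSum (α : ℝ) (R : ℕ) (lam : Fin n → ℕ) : MvPolynomial (Fin n) ℝ :=
  ∑ nu ∈ orbit lam, fPoly α R nu

/-- The value at a point `x` with distinct coordinates of the Laplace--Beltrami operator. -/
def laplaceAt (α : ℝ) (x : Fin n → ℝ) (g : MvPolynomial (Fin n) ℝ) : ℝ :=
  ∑ i, (α * eval x (theta i (theta i g)) +
    ∑ j, x i / (x i - x j) * (eval x (theta i g) - eval x (theta j g)) - n * eval x (theta i g))

/-- The eigenvalue of the Laplace--Beltrami operator. -/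
def eigenval (α : ℝ) (lam : Fin n → ℕ) : ℝ :=
  ∑ i, (α * (lam i : ℝ) ^ 2 - ∑ j, ((min (lam i) (lam j) : ℕ) : ℝ))

/-- The difference times the product of all X_a - X_b with a ≠ b vanishes at every point, and that
product is nonzero in a domain. -/
theorem eq_of_eval_injective {p q : MvPolynomial (Fin n) ℝ}
    (h : ∀ x : Fin n → ℝ, Function.Injective x → eval x p = eval x q) : p = q := by
  classical
  let V : MvPolynomial (Fin n) ℝ := ∏ ij : {ij : Fin n × Fin n // ij.1 ≠ ij.2}, (X ij.1.1 - X ij.1.2)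
  have hV : V ≠ 0 := Finset.prod_ne_zero_iff.2 fun ij _ h => ij.2 (X_injective (sub_eq_zero.1 h))
  have h0 : (p - q) * V = 0 := by
    refine MvPolynomial.funext fun x => ?_
    by_cases hx : Function.Injective x
    · simp [h x hx]
    · simp only [Function.Injective, not_forall] at hx
      obtain ⟨a, b, hab, hne⟩ := hx
      have : eval x V = 0 := by
        simp only [V, map_prod]
        exact Finset.prod_eq_zero (Finset.mem_univ ⟨(a, b), hne⟩) (by simp [hab])
      simp [this]
  exact sub_eq_zero.1 ((mul_eq_zero.1 h0).resolve_right hV)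

theorem le_of_mem_orbit {lam nu : Fin n → ℕ} {R : ℕ} (h : nu ∈ orbit lam) (hR : ∀ k, lam k ≤ R)
    (k : Fin n) : nu k ≤ R := by
  obtain ⟨s, rfl⟩ := mem_orbit.1 h
  exact hR _

/-- In the sum of the Knizhnik–Zamolodchikov equations over the orbit, the divided differences
cancel by symmetry, and reindexing by the exchange of i and j shows that the exchanged terms cancel
the counts. Only α ν_i survives. -/
theorem theta_symSum {α : ℝ} (hα : 0 < α) {R : ℕ} {lam : Fin n → ℕ} (hR : ∀ k, lam k ≤ R)
    (i : Fin n) :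
    theta i (symSum α R lam) = ∑ nu ∈ orbit lam, (nu i : ℝ) • fPoly α R nu := by
  refine eq_of_eval_injective fun x hx => mul_left_cancel₀ hα.ne' ?_
  simp only [symSum, map_sum, theta_apply, map_mul, eval_X, smul_eval, Finset.mul_sum]
  rw [Finset.sum_congr rfl fun nu hnu =>
    kz_fPoly hα R nu (le_of_mem_orbit hnu hR) x hx i]
  rw [Finset.sum_sub_distrib, Finset.sum_sub_distrib]
  have h1 : ∑ nu ∈ orbit lam, ∑ j, x i / (x i - x j) * (eval x (fPoly α R nu) -
      eval x (fPoly α R (permComp (Equiv.swap i j) nu))) = 0 := by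
    rw [Finset.sum_comm]
    refine Finset.sum_eq_zero fun j _ => ?_
    rw [← Finset.mul_sum, Finset.sum_sub_distrib, sum_orbit_permComp lam (Equiv.swap i j)
      (fun nu => eval x (fPoly α R nu)), sub_self, mul_zero]
  have h2 : ∑ nu ∈ orbit lam, ∑ j with nu i < nu j,
      eval x (fPoly α R (permComp (Equiv.swap i j) nu)) =
      ∑ nu ∈ orbit lam, (Finset.univ.filter fun j => nu j < nu i).card *
        eval x (fPoly α R nu) := by
    simp only [Finset.sum_filter, Finset.card_filter, Nat.cast_sum, Finset.sum_mul]
    rw [Finset.sum_comm, Finset.sum_comm (s := orbit lam)]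
    refine Finset.sum_congr rfl fun j _ => ?_
    rw [← sum_orbit_permComp lam (Equiv.swap i j)]
    simp only [permComp_swap_swap, permComp_swap_apply, Equiv.swap_apply_left,
      Equiv.swap_apply_right]
    refine Finset.sum_congr rfl fun nu _ => ?_
    split_ifs <;> simp
  rw [h1, h2, sub_zero, ← Finset.sum_sub_distrib]
  refine Finset.sum_congr rfl fun nu _ => by ring

theorem eigenval_of_mem_orbit {α : ℝ} {lam nu : Fin n → ℕ} (h : nu ∈ orbit lam) :
    eigenval α nu = eigenval α lam := by
  obtain ⟨s, rfl⟩ := mem_orbit.1 h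
  simp only [eigenval, permComp]
  rw [← Equiv.sum_comp s⁻¹ (fun i => α * (lam i : ℝ) ^ 2 - ∑ j, ((min (lam i) (lam j) : ℕ) : ℝ))]
  refine Finset.sum_congr rfl fun i _ => ?_
  rw [← Equiv.sum_comp s⁻¹ (fun j => ((min (lam (s⁻¹ i)) (lam j) : ℕ) : ℝ))]

/-- The equations are summed again, now with weight ν_i. By `theta_symSum` their divided differences
become those of the Euler derivatives and cancel the ones in the operator. What remains is diagonal,
and the term -n θ_i turns it into the negative sum of minima of parts, in which n no longer appears
explicitly. -/
theorem laplaceAt_symSum {α : ℝ} (hα : 0 < α) {R : ℕ} {lam : Fin n → ℕ} (hR : ∀ k, lam k ≤ R)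
    {x : Fin n → ℝ} (hx : Function.Injective x) :
    laplaceAt α x (symSum α R lam) = eigenval α lam * eval x (symSum α R lam) := by
  have hmain : ∀ i, α * eval x (theta i (theta i (symSum α R lam))) +
      ∑ j, x i / (x i - x j) *
        (eval x (theta i (symSum α R lam)) - eval x (theta j (symSum α R lam))) -
        n * eval x (theta i (symSum α R lam)) =
      ∑ nu ∈ orbit lam, (α * (nu i : ℝ) ^ 2 - ∑ j, ((min (nu i) (nu j) : ℕ) : ℝ)) *
        eval x (fPoly α R nu) := by
    intro i
    have h1 : ∀ j, eval x (theta j (symSum α R lam)) =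
        ∑ nu ∈ orbit lam, (nu j : ℝ) * eval x (fPoly α R nu) := by
      intro j
      rw [theta_symSum hα hR]
      simp [smul_eval]
    have h2 : α * eval x (theta i (theta i (symSum α R lam))) =
        ∑ nu ∈ orbit lam, nu i * (α * (x i * eval x (pderiv i (fPoly α R nu)))) := by
      rw [theta_symSum hα hR]
      simp only [map_sum, map_smul, smul_eval, theta_apply, map_mul, eval_X, Finset.mul_sum]
      exact Finset.sum_congr rfl fun nu _ => by ring
    rw [h2, Finset.sum_congr rfl fun nu hnu => by
      rw [kz_fPoly hα R nu (le_of_mem_orbit hnu hR) x hx i]]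
    simp only [h1]
    have h3 : ∑ nu ∈ orbit lam, (nu i : ℝ) * ∑ j with nu i < nu j,
        eval x (fPoly α R (permComp (Equiv.swap i j) nu)) =
        ∑ nu ∈ orbit lam, (∑ j with nu j < nu i, (nu j : ℝ)) * eval x (fPoly α R nu) := by
      simp only [Finset.sum_filter, Finset.sum_mul, Finset.mul_sum]
      rw [Finset.sum_comm, Finset.sum_comm (s := orbit lam)]
      refine Finset.sum_congr rfl fun j _ => ?_
      rw [← sum_orbit_permComp lam (Equiv.swap i j)]
      simp only [permComp_swap_swap, permComp_swap_apply, Equiv.swap_apply_left,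
        Equiv.swap_apply_right]
      refine Finset.sum_congr rfl fun nu _ => ?_
      split_ifs <;> simp
    have h4 : ∑ nu ∈ orbit lam, (nu i : ℝ) * ∑ j, x i / (x i - x j) * (eval x (fPoly α R nu) -
        eval x (fPoly α R (permComp (Equiv.swap i j) nu))) =
        ∑ j, x i / (x i - x j) * (∑ nu ∈ orbit lam, (nu i : ℝ) * eval x (fPoly α R nu) -
          ∑ nu ∈ orbit lam, (nu j : ℝ) * eval x (fPoly α R nu)) := by
      simp only [Finset.mul_sum]
      rw [Finset.sum_comm]
      refine Finset.sum_congr rfl fun j _ => ?_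
      have h5 : ∑ nu ∈ orbit lam, (nu i : ℝ) *
          eval x (fPoly α R (permComp (Equiv.swap i j) nu)) =
          ∑ nu ∈ orbit lam, (nu j : ℝ) * eval x (fPoly α R nu) := by
        rw [← sum_orbit_permComp lam (Equiv.swap i j)]
        simp only [permComp_swap_swap, permComp_swap_apply, Equiv.swap_apply_left]
      rw [← h5, ← Finset.sum_sub_distrib, Finset.mul_sum]
      exact Finset.sum_congr rfl fun nu _ => by ring
    simp only [mul_sub, Finset.sum_sub_distrib] at h4 ⊢
    rw [h3, h4]
    simp only [Finset.mul_sum, ← Finset.sum_sub_distrib, sub_mul]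
    rw [sub_add_cancel, ← Finset.sum_sub_distrib]
    refine Finset.sum_congr rfl fun nu _ => ?_
    have h6 : (nu i : ℝ) * (Finset.univ.filter fun j => nu j < nu i).card -
        ∑ j with nu j < nu i, (nu j : ℝ) = n * nu i - ∑ j, ((min (nu i) (nu j) : ℕ) : ℝ) := by
      have hn : (n : ℝ) * nu i = ∑ j : Fin n, (nu i : ℝ) := by simp
      rw [hn, Finset.card_filter, Nat.cast_sum, Finset.mul_sum, Finset.sum_filter,
        ← Finset.sum_sub_distrib, ← Finset.sum_sub_distrib]
      refine Finset.sum_congr rfl fun j _ => ?_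
      split_ifs with h
      · rw [min_eq_right h.le]; simp
      · rw [min_eq_left (not_lt.1 h)]; simp
    linear_combination (eval x (fPoly α R nu)) * h6
  rw [laplaceAt, Finset.sum_congr rfl fun i _ => hmain i, Finset.sum_comm, symSum, map_sum,
    Finset.mul_sum]
  refine Finset.sum_congr rfl fun nu hnu => ?_
  rw [← Finset.sum_mul, ← eigenval_of_mem_orbit hnu, eigenval]

/-! ### Diagonal forms on symmetric functions -/

/-- The bilinear form for which products of power sums are orthogonal with squared norms `w`. -/
def diagForm (w : (ℕ+ →₀ ℕ) → ℝ) : SymFun →ₗ[ℝ] SymFun →ₗ[ℝ] ℝ :=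
  LinearMap.mk₂ ℝ (fun f g => ∑ m ∈ f.support, coeff m f * coeff m g * w m)
    (fun f f' g => by
      classical
      have key : ∀ (f : SymFun) (s : Finset (ℕ+ →₀ ℕ)), f.support ⊆ s →
          ∑ m ∈ f.support, coeff m f * coeff m g * w m = ∑ m ∈ s, coeff m f * coeff m g * w m := by
        intro f s h
        refine Finset.sum_subset h fun m _ hm => ?_
        rw [notMem_support_iff.1 hm]
        simp
      rw [key (f + f') (f.support ∪ f'.support) support_add,
        key f _ Finset.subset_union_left, key f' _ Finset.subset_union_right,
        ← Finset.sum_add_distrib]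
      exact Finset.sum_congr rfl fun m _ => by rw [coeff_add]; ring)
    (fun c f g => by
      rw [smul_eq_mul, Finset.mul_sum]
      refine Finset.sum_subset_zero_on_sdiff support_smul (fun m hm => ?_) fun m _ => by
        rw [coeff_smul, smul_eq_mul]; ring
      have := notMem_support_iff.1 (Finset.mem_sdiff.1 hm).2
      rw [coeff_smul, smul_eq_mul] at this
      rw [← mul_assoc, ← mul_assoc, this, zero_mul, zero_mul])
    (fun f g g' => by
      rw [← Finset.sum_add_distrib]
      exact Finset.sum_congr rfl fun m _ => by rw [coeff_add]; ring)
    (fun c f g => by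
      rw [smul_eq_mul, Finset.mul_sum]
      exact Finset.sum_congr rfl fun m _ => by rw [coeff_smul, smul_eq_mul]; ring)

theorem diagForm_apply (w : (ℕ+ →₀ ℕ) → ℝ) (f g : SymFun) :
    diagForm w f g = ∑ m ∈ f.support, coeff m f * coeff m g * w m := rfl

theorem diagForm_monomial (w : (ℕ+ →₀ ℕ) → ℝ) (m : ℕ+ →₀ ℕ) (a : ℝ) (g : SymFun) :
    diagForm w (monomial m a) g = a * coeff m g * w m := by
  classical
  rw [diagForm_apply]
  rcases eq_or_ne a 0 with rfl | ha
  · simp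
  · rw [support_monomial, if_neg ha]
    simp

theorem diagForm_comm (w : (ℕ+ →₀ ℕ) → ℝ) (f g : SymFun) : diagForm w f g = diagForm w g f := by
  induction f using MvPolynomial.induction_on' with
  | add f f' hf hf' => rw [map_add, LinearMap.add_apply, hf, hf', map_add]
  | monomial m a =>
    rw [diagForm_monomial]
    induction g using MvPolynomial.induction_on' with
    | add g g' hg hg' => rw [map_add, LinearMap.add_apply, ← hg, ← hg', coeff_add]; ring
    | monomial m' b =>
      classical
      rw [diagForm_monomial, coeff_monomial, coeff_monomial]
      by_cases h : m = m'
      · subst h; simp [mul_comm]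
      · rw [if_neg h, if_neg (Ne.symm h)]; simp

/-- The squared norms of products of power sums for the Jack scalar product. -/
def jackNorm (α : ℝ) (m : ℕ+ →₀ ℕ) : ℝ :=
  m.prod fun k e => ((k : ℕ) : ℝ) ^ e * (e.factorial : ℝ) * α ^ e

theorem jackNorm_add_single (α : ℝ) (m : ℕ+ →₀ ℕ) (k : ℕ+) :
    jackNorm α (m + Finsupp.single k 1) = α * (k : ℕ) * (m k + 1) * jackNorm α m := by
  classical
  have key : ∀ m : ℕ+ →₀ ℕ, jackNorm α m = (((k : ℕ) : ℝ) ^ m k * ((m k).factorial : ℝ) *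
      α ^ m k) * jackNorm α (m.erase k) := fun m =>
    (Finsupp.mul_prod_erase' m k (fun k e => ((k : ℕ) : ℝ) ^ e * (e.factorial : ℝ) * α ^ e)
      (by simp)).symm
  rw [key, key m, Finsupp.erase_add, Finsupp.erase_single, add_zero]
  simp only [Finsupp.add_apply, Finsupp.single_eq_same, Nat.factorial_succ, pow_succ]
  push_cast
  ring

/-- The adjoint of multiplication by p_k is αk ∂/∂p_k, because adding one part k multiplies the norm
by αk(m_k + 1). -/
theorem diagForm_X_mul (α : ℝ) (k : ℕ+) (f g : SymFun) :
    diagForm (jackNorm α) (X k * f) g = α * (k : ℕ) * diagForm (jackNorm α) f (pderiv k g) := by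
  induction f using MvPolynomial.induction_on' with
  | add f f' hf hf' => simp only [mul_add, map_add, LinearMap.add_apply, hf, hf']
  | monomial m a =>
    rw [mul_comm, X, monomial_mul, diagForm_monomial, diagForm_monomial, jackNorm_add_single,
      coeff_pderiv]
    ring

/-! ### The Laplace--Beltrami operator on symmetric functions -/

/-- The pairs `(a, b)` of positive integers with `a + b ≤ D`. -/
def pairsUpTo (D : ℕ+) : Finset (ℕ+ × ℕ+) :=
  (Finset.Icc 1 D ×ˢ Finset.Icc 1 D).filter fun p => p.1 + p.2 ≤ D

/-- The Laplace--Beltrami operator in the power sums, truncated to `p_1, …, p_D`. -/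
def symLaplace (α : ℝ) (D : ℕ+) (f : SymFun) : SymFun :=
  ∑ k ∈ Finset.Icc 1 D, ((α - 1) * ((k : ℕ) : ℝ) ^ 2) • (X k * pderiv k f) +
    ∑ p ∈ pairsUpTo D, ((α * (p.1 : ℕ) * (p.2 : ℕ)) •
        (X (p.1 + p.2) * pderiv p.1 (pderiv p.2 f)) +
      (((p.1 : ℕ) : ℝ) + (p.2 : ℕ)) • (X p.1 * (X p.2 * pderiv (p.1 + p.2) f)))

/-- Each p_k ∂_k is self-adjoint, and the joining term αab p_{a+b} ∂_a ∂_b is adjoint to the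
splitting term (a+b) p_a p_b ∂_{a+b}. -/
theorem diagForm_symLaplace (α : ℝ) (D : ℕ+) (f g : SymFun) :
    diagForm (jackNorm α) (symLaplace α D f) g = diagForm (jackNorm α) f (symLaplace α D g) := by
  have hX : ∀ (k : ℕ+) (f g : SymFun), diagForm (jackNorm α) f (X k * g) =
      α * (k : ℕ) * diagForm (jackNorm α) (pderiv k f) g := by
    intro k f g
    rw [diagForm_comm, diagForm_X_mul, diagForm_comm]
  have hc : ∀ (a b : ℕ+) (f : SymFun), pderiv a (pderiv b f) = pderiv b (pderiv a f) := by
    intro a b f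
    rcases eq_or_ne a b with rfl | hab
    · rfl
    ext m
    simp only [coeff_pderiv, Finsupp.add_apply, Finsupp.single_eq_of_ne hab,
      Finsupp.single_eq_of_ne hab.symm, add_right_comm m]
    ring_nf
  simp only [symLaplace, map_add, map_sum, map_smul, LinearMap.add_apply, LinearMap.sum_apply,
    LinearMap.smul_apply, diagForm_X_mul, hX, smul_eq_mul]
  congr 1
  refine Finset.sum_congr rfl fun p _ => ?_
  rw [hc p.2 p.1 g, hc p.2 p.1 f]
  push_cast
  ring

theorem pderiv_mem_supported {s : Set ℕ+} {f : SymFun} (hf : f ∈ supported ℝ s) (k : ℕ+) :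
    pderiv k f ∈ supported ℝ s := by
  classical
  induction hf using Algebra.adjoin_induction with
  | mem f hf =>
    obtain ⟨l, -, rfl⟩ := hf
    rw [pderiv_X, Pi.single_apply]
    split_ifs
    · exact one_mem _
    · exact zero_mem _
  | algebraMap r => rw [Derivation.map_algebraMap]; exact zero_mem _
  | add f g _ _ hf hg => rw [map_add]; exact add_mem hf hg
  | mul f g hf' hg' hf hg =>
    rw [Derivation.leibniz]
    exact add_mem (mul_mem hf' hg) (mul_mem hg' hf)

theorem pderiv_eq_zero_of_mem_supported {s : Set ℕ+} {f : SymFun} (hf : f ∈ supported ℝ s)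
    {k : ℕ+} (hk : k ∉ s) : pderiv k f = 0 :=
  pderiv_eq_zero_of_notMem_vars fun h => hk (mem_supported.1 hf h)

/-- The chain rule with θ_i p_k = k x_i^k; the bound D only makes the sum over k finite. -/
theorem theta_toVars {D : ℕ+} {f : SymFun} (hf : f ∈ supported ℝ {k | k ≤ D}) (i : Fin n) :
    theta i (toVars n f) =
      ∑ k ∈ Finset.Icc 1 D, ((k : ℕ) : ℝ) • (X i ^ (k : ℕ) * toVars n (pderiv k f)) := by
  classical
  induction hf using Algebra.adjoin_induction with
  | mem f hf =>
    obtain ⟨l, hl, rfl⟩ := hf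
    rw [Finset.sum_eq_single l]
    · rw [pderiv_X_self, map_one, mul_one, theta_apply, toVars, aeval_X, psum, map_sum,
        Finset.sum_eq_single i]
      · rw [Derivation.leibniz_pow, pderiv_X_self]
        obtain ⟨m, hm⟩ : ∃ m, (l : ℕ) = m + 1 := ⟨l - 1, by have := l.pos; omega⟩
        rw [hm, Nat.add_sub_cancel, smul_eq_mul, mul_one, smul_eq_C_mul, nsmul_eq_mul]
        simp only [map_natCast]
        ring
      · intro j _ hj
        rw [Derivation.leibniz_pow, pderiv_X_of_ne hj]
        simp
      · simp
    · intro k _ hk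
      rw [pderiv_X_of_ne hk.symm]
      simp
    · intro h
      exact absurd (Finset.mem_Icc.2 ⟨(one_le : 1 ≤ l), hl⟩) h
  | algebraMap r =>
    simp only [theta_apply, AlgHom.commutes, Derivation.map_algebraMap, map_zero, mul_zero,
      smul_zero, Finset.sum_const_zero]
  | add f g _ _ hf hg =>
    simp only [map_add, hf, hg, mul_add, smul_add, Finset.sum_add_distrib]
  | mul f g _ _ hf hg =>
    have h1 : theta i (toVars n (f * g)) =
        toVars n f * theta i (toVars n g) + toVars n g * theta i (toVars n f) := by
      simp only [theta_apply, map_mul, Derivation.leibniz, smul_eq_mul]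
      ring
    rw [h1, hf, hg, Finset.mul_sum, Finset.mul_sum, ← Finset.sum_add_distrib]
    refine Finset.sum_congr rfl fun k _ => ?_
    simp only [Derivation.leibniz, smul_eq_mul, map_add, map_mul, smul_eq_C_mul]
    ring

theorem theta_X_pow_mul (i : Fin n) (k : ℕ) (g : MvPolynomial (Fin n) ℝ) :
    theta i (X i ^ k * g) = (k : ℝ) • (X i ^ k * g) + X i ^ k * theta i g := by
  rw [theta_apply, theta_apply, Derivation.leibniz, Derivation.leibniz_pow, pderiv_X_self]
  rcases Nat.eq_zero_or_pos k with rfl | hk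
  · simp
  obtain ⟨m, rfl⟩ : ∃ m, k = m + 1 := ⟨k - 1, by omega⟩
  rw [Nat.add_sub_cancel, smul_eq_C_mul, nsmul_eq_mul]
  simp only [map_natCast, smul_eq_mul]
  ring

theorem sum_pairs_eq {M : Type*} [AddCommMonoid M] {D k : ℕ+} (hk : k ≤ D) (g : ℕ → ℕ → M) :
    ∑ p ∈ pairsUpTo D with p.1 + p.2 = k, g p.1 p.2 =
      ∑ a ∈ Finset.range ((k : ℕ) - 1), g (a + 1) (k - 1 - a) := by
  have hk' : (k : ℕ) ≤ D := hk
  refine Finset.sum_bij' (fun p _ => (p.1 : ℕ) - 1)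
    (fun a ha => (⟨a + 1, Nat.succ_pos _⟩, ⟨k - 1 - a, by
      have := Finset.mem_range.1 ha; omega⟩)) ?_ ?_ ?_ ?_ ?_
  · intro p hp
    have h : p.1 + p.2 = k := (Finset.mem_filter.1 hp).2
    have h : (p.1 : ℕ) + p.2 = k := by rw [← h]; rfl
    have := p.1.pos
    have := p.2.pos
    simp only [Finset.mem_range]
    omega
  · intro a ha
    have := Finset.mem_range.1 ha
    have h1 : a + 1 ≤ (D : ℕ) := by omega
    have h2 : (k : ℕ) - 1 - a ≤ D := by omega
    have h3 : a + 1 + ((k : ℕ) - 1 - a) = k := by omega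
    refine Finset.mem_filter.2 ⟨Finset.mem_filter.2 ⟨Finset.mem_product.2
      ⟨Finset.mem_Icc.2 ⟨one_le, h1⟩, Finset.mem_Icc.2 ⟨one_le, h2⟩⟩, ?_⟩, PNat.eq h3⟩
    change a + 1 + ((k : ℕ) - 1 - a) ≤ D
    omega
  · intro p hp
    have h : p.1 + p.2 = k := (Finset.mem_filter.1 hp).2
    have h : (p.1 : ℕ) + p.2 = k := by rw [← h]; rfl
    have := p.1.pos
    have := p.2.pos
    refine Prod.ext (PNat.eq ?_) (PNat.eq ?_)
    · simp only [PNat.mk_coe]; omega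
    · simp only [PNat.mk_coe]; omega
  · intro a _
    simp
  · intro p hp
    have h : p.1 + p.2 = k := (Finset.mem_filter.1 hp).2
    have h : (p.1 : ℕ) + p.2 = k := by rw [← h]; rfl
    have := p.1.pos
    have := p.2.pos
    congr 1 <;> omega

/-- For i ≠ j the quotient is the geometric sum of x_i^(a+1) x_j^(k-1-a). At i = j the left term is
0 by the convention on division by zero, while the geometric sum is k x_i^k, whence the correction.
The top term a = k-1 is free of x_j and is cancelled by n x_i^k. -/
theorem sum_div_sub_mul_pow_sub (x : Fin n → ℝ) (hx : Function.Injective x) {k : ℕ} (hk : 0 < k) :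
    ∑ i, (∑ j, x i / (x i - x j) * (x i ^ k - x j ^ k) - n * x i ^ k) =
      ∑ a ∈ Finset.range (k - 1), (∑ i, x i ^ (a + 1)) * (∑ i, x i ^ (k - 1 - a)) -
        k * ∑ i, x i ^ k := by
  obtain ⟨m, rfl⟩ : ∃ m, k = m + 1 := ⟨k - 1, by omega⟩
  have h1 : ∀ i j, x i / (x i - x j) * (x i ^ (m + 1) - x j ^ (m + 1)) =
      ∑ a ∈ Finset.range (m + 1), x i ^ (a + 1) * x j ^ (m - a) -
        (if i = j then ((m + 1 : ℕ) : ℝ) * x i ^ (m + 1) else 0) := by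
    intro i j
    split_ifs with h
    · subst h
      rw [sub_self, div_zero, zero_mul, eq_comm, sub_eq_zero]
      rw [Finset.sum_congr rfl fun a ha => by
        rw [← pow_add, show a + 1 + (m - a) = m + 1 by have := Finset.mem_range.1 ha; omega]]
      simp
    · have hne : x i - x j ≠ 0 := sub_ne_zero.2 fun e => h (hx e)
      rw [← (Commute.all (x i) (x j)).geom_sum₂_mul, sub_zero, Finset.sum_mul, Finset.mul_sum]
      refine Finset.sum_congr rfl fun a _ => ?_
      rw [Nat.add_sub_cancel]
      field_simp
      ring
  simp only [h1, Finset.sum_sub_distrib, Finset.sum_ite_eq, Finset.mem_univ, if_true,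
    Finset.sum_range_succ, Finset.sum_add_distrib, Nat.add_sub_cancel]
  have h2 : ∑ i, ∑ j, ∑ a ∈ Finset.range m, x i ^ (a + 1) * x j ^ (m - a) =
      ∑ a ∈ Finset.range m, (∑ i, x i ^ (a + 1)) * (∑ i, x i ^ (m - a)) := by
    simp only [Finset.sum_mul_sum]
    rw [Finset.sum_congr rfl fun i _ => Finset.sum_comm, Finset.sum_comm]
  rw [h2, ← Finset.mul_sum]
  simp only [Nat.sub_self, pow_zero, mul_one, Finset.sum_const, Finset.card_univ,
    Fintype.card_fin, nsmul_eq_mul, ← Finset.mul_sum]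
  ring

/-- Both sides are expanded with `theta_toVars`: second derivatives yield the joining terms, and the
geometric sums of `sum_div_sub_mul_pow_sub` yield the splitting terms. The condition 2k ≤ D on the
variables of f ensures that truncation loses nothing. -/
theorem laplaceAt_toVars (α : ℝ) {D : ℕ+} {f : SymFun} (hf : f ∈ supported ℝ {k | k + k ≤ D})
    {x : Fin n → ℝ} (hx : Function.Injective x) :
    laplaceAt α x (toVars n f) = eval x (toVars n (symLaplace α D f)) := by
  have hsub : {k : ℕ+ | k + k ≤ D} ⊆ {k | k ≤ D} := fun k (hk : k + k ≤ D) => by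
    have hk : (k : ℕ) + k ≤ D := hk
    change (k : ℕ) ≤ D
    omega
  have hf1 := supported_mono hsub hf
  set E : ℕ+ → ℝ := fun k => eval x (toVars n (pderiv k f)) with hE
  set E2 : ℕ+ → ℕ+ → ℝ := fun k l => eval x (toVars n (pderiv l (pderiv k f))) with hE2
  set p : ℕ → ℝ := fun k => ∑ i, x i ^ k with hp
  have h1 : ∀ i, eval x (theta i (toVars n f)) =
      ∑ k ∈ Finset.Icc 1 D, ((k : ℕ) : ℝ) * (x i ^ (k : ℕ) * E k) := by
    intro i
    rw [theta_toVars hf1]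
    simp only [map_sum, smul_eval, map_mul, map_pow, eval_X, hE]
  have h2 : ∀ i, eval x (theta i (theta i (toVars n f))) =
      ∑ k ∈ Finset.Icc 1 D, (((k : ℕ) : ℝ) ^ 2 * (x i ^ (k : ℕ) * E k) +
        ∑ l ∈ Finset.Icc 1 D, ((k : ℕ) : ℝ) * (l : ℕ) * (x i ^ ((k : ℕ) + l) * E2 k l)) := by
    intro i
    rw [theta_toVars hf1]
    simp only [map_sum, map_smul, theta_X_pow_mul, theta_toVars (pderiv_mem_supported hf1 _),
      smul_eval, map_mul, map_pow, eval_X, map_add]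
    refine Finset.sum_congr rfl fun k _ => ?_
    rw [mul_add, Finset.mul_sum, Finset.mul_sum]
    congr 1
    · ring
    · refine Finset.sum_congr rfl fun l _ => by ring
  have h3 : ∑ i, eval x (theta i (theta i (toVars n f))) =
      ∑ k ∈ Finset.Icc 1 D, ((k : ℕ) : ℝ) ^ 2 * (p k * E k) +
      ∑ q ∈ pairsUpTo D, ((q.1 : ℕ) : ℝ) * (q.2 : ℕ) * (p ((q.1 : ℕ) + q.2) * E2 q.1 q.2) := by
    simp only [h2, Finset.sum_add_distrib]
    congr 1
    · rw [Finset.sum_comm]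
      simp only [hp, Finset.sum_mul, Finset.mul_sum]
    -- A pair with a + b > D has 2a > D or 2b > D, so the corresponding second derivative of f is
    -- zero.
    · rw [pairsUpTo, Finset.sum_filter_of_ne, Finset.sum_product, Finset.sum_comm]
      · refine Finset.sum_congr rfl fun k _ => ?_
        rw [Finset.sum_comm]
        simp only [hp, Finset.sum_mul, Finset.mul_sum]
      · intro q _ hq
        by_contra hD
        refine hq ?_
        have hzero : E2 q.1 q.2 = 0 := by
          have hcases : ¬ (q.1 + q.1 ≤ D) ∨ ¬ (q.2 + q.2 ≤ D) := by
            simp only [← PNat.coe_le_coe, PNat.add_coe] at hD ⊢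
            omega
          rcases hcases with h | h
          · simp only [hE2]
            rw [pderiv_eq_zero_of_mem_supported hf h]
            simp
          · simp only [hE2]
            rw [pderiv_eq_zero_of_mem_supported (pderiv_mem_supported hf _) h]
            simp
        rw [hzero, mul_zero, mul_zero]
  have h4 : ∑ i, (∑ j, x i / (x i - x j) * (eval x (theta i (toVars n f)) -
      eval x (theta j (toVars n f))) - n * eval x (theta i (toVars n f))) =
      ∑ k ∈ Finset.Icc 1 D, ((k : ℕ) : ℝ) * E k *
        (∑ q ∈ pairsUpTo D with q.1 + q.2 = k, p q.1 * p q.2 - (k : ℕ) * p k) := by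
    have h5 : ∀ k ∈ Finset.Icc 1 D, ((k : ℕ) : ℝ) * E k *
        (∑ q ∈ pairsUpTo D with q.1 + q.2 = k, p q.1 * p q.2 - (k : ℕ) * p k) =
        ((k : ℕ) : ℝ) * E k * ∑ i, (∑ j, x i / (x i - x j) * (x i ^ (k : ℕ) - x j ^ (k : ℕ)) -
          n * x i ^ (k : ℕ)) := by
      intro k hk
      rw [sum_div_sub_mul_pow_sub x hx k.pos,
        sum_pairs_eq (Finset.mem_Icc.1 hk).2 (fun a b => p a * p b)]
    rw [Finset.sum_congr rfl h5]
    simp only [Finset.mul_sum]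
    rw [Finset.sum_comm]
    refine Finset.sum_congr rfl fun i _ => ?_
    simp only [h1, ← Finset.sum_sub_distrib, Finset.mul_sum, mul_sub]
    rw [Finset.sum_sub_distrib, Finset.sum_comm]
    congr 1
    · refine Finset.sum_congr rfl fun k _ => ?_
      refine Finset.sum_congr rfl fun j _ => by ring
    · refine Finset.sum_congr rfl fun k _ => by ring
  have h6 : laplaceAt α x (toVars n f) = α * ∑ i, eval x (theta i (theta i (toVars n f))) +
      ∑ i, (∑ j, x i / (x i - x j) * (eval x (theta i (toVars n f)) -
        eval x (theta j (toVars n f))) - n * eval x (theta i (toVars n f))) := by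
    rw [laplaceAt, Finset.mul_sum, ← Finset.sum_add_distrib]
    exact Finset.sum_congr rfl fun i _ => by ring
  have hpX : ∀ k : ℕ+, eval x (toVars n (X k)) = p k := by
    intro k
    simp [toVars, psum, hp]
  have h7 : ∑ k ∈ Finset.Icc 1 D, ((k : ℕ) : ℝ) * E k *
        ∑ q ∈ pairsUpTo D with q.1 + q.2 = k, p q.1 * p q.2 =
      ∑ q ∈ pairsUpTo D, (((q.1 : ℕ) : ℝ) + (q.2 : ℕ)) * (p q.1 * (p q.2 * E (q.1 + q.2))) := by
    rw [← Finset.sum_fiberwise_of_maps_to (s := pairsUpTo D) (t := Finset.Icc 1 D)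
      (g := fun q => q.1 + q.2) fun q hq => Finset.mem_Icc.2
        ⟨one_le, (Finset.mem_filter.1 hq).2⟩]
    refine Finset.sum_congr rfl fun k _ => ?_
    rw [Finset.mul_sum]
    refine Finset.sum_congr rfl fun q hq => ?_
    rw [← (Finset.mem_filter.1 hq).2, PNat.add_coe]
    push_cast
    ring
  rw [h6, h3, h4]
  simp only [mul_sub, Finset.sum_sub_distrib]
  rw [h7]
  simp only [symLaplace, map_add, map_sum, map_smul, map_mul, smul_eval, hpX]
  have h8 : ∀ q : ℕ+ × ℕ+, eval x (toVars n (pderiv q.1 (pderiv q.2 f))) = E2 q.2 q.1 := fun _ => rfl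
  have h9 : ∑ q ∈ pairsUpTo D, ((q.1 : ℕ) : ℝ) * (q.2 : ℕ) * (p ((q.1 : ℕ) + q.2) * E2 q.1 q.2) =
      ∑ q ∈ pairsUpTo D, ((q.1 : ℕ) : ℝ) * (q.2 : ℕ) * (p ((q.1 : ℕ) + q.2) * E2 q.2 q.1) := by
    refine Finset.sum_bij' (fun q _ => q.swap) (fun q _ => q.swap) ?_ ?_ ?_ ?_ ?_
    · intro q hq
      simp only [pairsUpTo, Finset.mem_filter, Finset.mem_product, Prod.fst_swap,
        Prod.snd_swap] at hq ⊢
      exact ⟨hq.1.symm, by rw [add_comm]; exact hq.2⟩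
    · intro q hq
      simp only [pairsUpTo, Finset.mem_filter, Finset.mem_product, Prod.fst_swap,
        Prod.snd_swap] at hq ⊢
      exact ⟨hq.1.symm, by rw [add_comm]; exact hq.2⟩
    · simp
    · simp
    · intro q _
      simp only [Prod.fst_swap, Prod.snd_swap]
      rw [add_comm (q.1 : ℕ)]
      ring
  rw [h9, mul_add, Finset.mul_sum, Finset.mul_sum, Finset.sum_add_distrib]
  simp only [h8, PNat.add_coe]
  have h10 : ∀ k : ℕ+, eval x (toVars n (pderiv k f)) = E k := fun _ => rfl
  simp only [h10]
  -- The αk² from differentiating x_i^k again and the -k² from the excluded diagonal combine to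
  -- (α-1)k².
  have h11 : ∑ k ∈ Finset.Icc 1 D, α * (((k : ℕ) : ℝ) ^ 2 * (p k * E k)) -
      ∑ k ∈ Finset.Icc 1 D, ((k : ℕ) : ℝ) * E k * ((k : ℕ) * p k) =
      ∑ k ∈ Finset.Icc 1 D, (α - 1) * ((k : ℕ) : ℝ) ^ 2 * (p k * E k) := by
    rw [← Finset.sum_sub_distrib]
    exact Finset.sum_congr rfl fun k _ => by ring
  have h12 : ∑ q ∈ pairsUpTo D, α * (((q.1 : ℕ) : ℝ) * (q.2 : ℕ) *
      (p ((q.1 : ℕ) + q.2) * E2 q.2 q.1)) =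
      ∑ q ∈ pairsUpTo D, α * ((q.1 : ℕ) : ℝ) * (q.2 : ℕ) *
        (p ((q.1 : ℕ) + q.2) * E2 q.2 q.1) :=
    Finset.sum_congr rfl fun k _ => by ring
  rw [← h12]
  linear_combination h11

/-! ### Parts of compositions -/

/-- The multiset of nonzero parts of a composition. -/
def partsOf (mu : Fin n → ℕ) : Multiset ℕ := (Finset.univ.val.map mu).filter (· ≠ 0)

theorem count_partsOf (mu : Fin n → ℕ) {v : ℕ} (hv : v ≠ 0) :
    (partsOf mu).count v = (Finset.univ.filter fun k => mu k = v).card := by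
  rw [partsOf, Multiset.count_filter_of_pos (p := (· ≠ 0)) hv, Multiset.count_map, Finset.card_def,
    Finset.filter_val]
  simp only [eq_comm]

theorem zero_notMem_partsOf (mu : Fin n → ℕ) : 0 ∉ partsOf mu := by simp [partsOf]

theorem partsOf_eq_iff {mu : Fin n → ℕ} {s : Multiset ℕ} (hs : 0 ∉ s) :
    partsOf mu = s ↔ ∀ v ≠ 0, (Finset.univ.filter fun k => mu k = v).card = s.count v := by
  rw [Multiset.ext]
  refine forall_congr' fun v => ?_
  rcases eq_or_ne v 0 with rfl | hv
  · simp [Multiset.count_eq_zero_of_notMem hs,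
      Multiset.count_eq_zero_of_notMem (zero_notMem_partsOf mu)]
  · rw [count_partsOf mu hv]
    simp [hv]

theorem sum_partsOf {M : Type*} [AddCommMonoid M] (mu : Fin n → ℕ) (g : ℕ → M) (hg : g 0 = 0) :
    ((partsOf mu).map g).sum = ∑ k, g (mu k) := by
  have h : ((partsOf mu).map g).sum + (((Finset.univ.val.map mu).filter (¬ · ≠ 0)).map g).sum =
      ((Finset.univ.val.map mu).map g).sum := by
    rw [← Multiset.sum_add, ← Multiset.map_add, partsOf, Multiset.filter_add_not]
  have h0 : (((Finset.univ.val.map mu).filter (¬ · ≠ 0)).map g).sum = 0 := by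
    refine Multiset.sum_eq_zero fun x hx => ?_
    obtain ⟨v, hv, rfl⟩ := Multiset.mem_map.1 hx
    rw [not_not.1 (Multiset.mem_filter.1 hv).2, hg]
  rw [h0, add_zero, Multiset.map_map] at h
  exact h

/-- The parts determine the multiplicity of each nonzero value, and the length n then determines the
number of zeros; bijections between fibres assemble to a permutation. -/
theorem mem_orbit_iff {mu nu : Fin n → ℕ} : nu ∈ orbit mu ↔ partsOf nu = partsOf mu := by
  constructor
  · intro h
    rw [partsOf_eq_iff (zero_notMem_partsOf mu)]
    intro v hv
    rw [count_partsOf mu hv]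
    exact card_filter_of_mem_orbit h (fun w => w = v)
  · intro h
    have hc : ∀ v, (Finset.univ.filter fun k => nu k = v).card =
        (Finset.univ.filter fun k => mu k = v).card := by
      intro v
      rcases eq_or_ne v 0 with rfl | hv
      · have key : ∀ mu : Fin n → ℕ, (Finset.univ.filter fun k => mu k = 0).card +
            ((partsOf mu).map fun v => if v = 0 then 0 else 1).sum = n := by
          intro mu
          rw [sum_partsOf mu _ (by simp), Finset.card_filter, ← Finset.sum_add_distrib,
            Finset.sum_congr rfl fun k _ => show _ = 1 by split_ifs <;> rfl]
          simp
        have h1 := key mu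
        have h2 := key nu
        rw [h] at h2
        omega
      · rw [← count_partsOf nu hv, ← count_partsOf mu hv, h]
    have e : ∀ v, {k // nu k = v} ≃ {k // mu k = v} := fun v =>
      Fintype.equivOfCardEq (by simpa [Fintype.card_subtype] using hc v)
    refine mem_orbit.2 ⟨(Equiv.ofFiberEquiv e)⁻¹, ?_⟩
    funext k
    rw [permComp, inv_inv]
    exact Equiv.ofFiberEquiv_map e k

theorem exists_partsOf {s : Multiset ℕ} (hs : 0 ∉ s) (hn : s.card ≤ n) :
    ∃ mu : Fin n → ℕ, partsOf mu = s := by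
  induction s using Quotient.inductionOn with
  | h l =>
    simp only [Multiset.quot_mk_to_coe, Multiset.coe_card] at hn
    refine ⟨fun k => l.getD k 0, ?_⟩
    have h1 : Finset.univ.val.map (fun k : Fin n => l.getD k 0) =
        (l ++ List.replicate (n - l.length) 0 : List ℕ) := by
      rw [Fin.univ_val_map]
      congr 1
      refine List.ext_getElem (by simp; omega) fun i h1 h2 => ?_
      simp only [List.getElem_ofFn, List.getElem_append, List.getElem_replicate]
      split_ifs with h
      · exact List.getD_eq_getElem _ _ h
      · exact List.getD_eq_default _ _ (not_lt.1 h)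
    rw [partsOf, h1, ← Multiset.coe_add, Multiset.filter_add]
    have h2 : Multiset.filter (· ≠ 0) ((List.replicate (n - l.length) 0 : List ℕ) : Multiset ℕ) =
        0 := by
      rw [Multiset.filter_eq_nil]
      intro a ha
      simpa using List.eq_of_mem_replicate (by simpa using ha)
    rw [h2, add_zero]
    refine Multiset.filter_eq_self.2 ?_
    rintro a ha rfl
    exact hs ha

/-! ### Dominance -/

/-- The sum of the excesses of the parts over `c`. -/
def excess (s : Multiset ℕ) (c : ℕ) : ℕ := (s.map (· - c)).sum

theorem excess_cons (a : ℕ) (s : Multiset ℕ) (c : ℕ) :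
    excess (a ::ₘ s) c = a - c + excess s c := by simp [excess]

theorem excess_coe_cons (a : ℕ) (l : List ℕ) (c : ℕ) :
    excess ((a :: l : List ℕ) : Multiset ℕ) c = a - c + excess (l : Multiset ℕ) c := by
  rw [← Multiset.cons_coe, excess_cons]

theorem excess_eq_zero {s : Multiset ℕ} {c : ℕ} (h : ∀ x ∈ s, x ≤ c) : excess s c = 0 := by
  refine Multiset.sum_eq_zero fun x hx => ?_
  obtain ⟨v, hv, rfl⟩ := Multiset.mem_map.1 hx
  exact Nat.sub_eq_zero_of_le (h v hv)

theorem sum_take_le (l : List ℕ) (k c : ℕ) : (l.take k).sum ≤ k * c + excess l c := by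
  induction l generalizing k with
  | nil => simp
  | cons a l ih =>
    rcases k with _ | k
    · simp
    · rw [List.take_succ_cons, List.sum_cons, excess_coe_cons]
      have := ih k
      have : (k + 1) * c = k * c + c := by ring
      omega

theorem exists_sum_take_eq {l : List ℕ} (hl : l.Pairwise (· ≥ ·)) (k : ℕ) :
    ∃ c, (∀ b, (∀ x ∈ l, x ≤ b) → c ≤ b) ∧ (l.take k).sum = k * c + excess l c := by
  induction l generalizing k with
  | nil => exact ⟨0, by simp, by simp [excess]⟩
  | cons a l ih =>
    rw [List.pairwise_cons] at hl
    rcases k with _ | k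
    · refine ⟨a, fun b hb => hb a (by simp), ?_⟩
      rw [excess_eq_zero]
      · simp
      · intro x hx
        rcases List.mem_cons.1 (Multiset.mem_coe.1 hx) with rfl | hx
        · exact le_rfl
        · exact hl.1 x hx
    · obtain ⟨c, hc, h⟩ := ih hl.2 k
      have hca := hc a hl.1
      refine ⟨c, fun b hb => hc b fun x hx => hb x (List.mem_cons_of_mem _ hx), ?_⟩
      rw [List.take_succ_cons, List.sum_cons, excess_coe_cons, h]
      have : (k + 1) * c = k * c + c := by ring
      omega

theorem exists_excess_add_eq {l : List ℕ} (hl : l.Pairwise (· ≥ ·)) (c : ℕ) :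
    ∃ k, excess l c + k * c = (l.take k).sum := by
  induction l with
  | nil => exact ⟨0, by simp [excess]⟩
  | cons a l ih =>
    rw [List.pairwise_cons] at hl
    by_cases h : c < a
    · obtain ⟨k, hk⟩ := ih hl.2
      refine ⟨k + 1, ?_⟩
      rw [List.take_succ_cons, List.sum_cons, excess_coe_cons, ← hk]
      have : (k + 1) * c = k * c + c := by ring
      omega
    · refine ⟨0, ?_⟩
      rw [excess_eq_zero]
      · simp
      · intro x hx
        rcases List.mem_cons.1 (Multiset.mem_coe.1 hx) with rfl | hx
        · omega
        · have := hl.1 x hx; omega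

/-- Partial sums and excesses are dual: the sum of the k largest parts is at most kc + excess(c) for
all c, with equality for a suitable c given k and for a suitable k given c. Hence either family of
inequalities implies the other. -/
theorem domLE_iff {d : ℕ} {mu lam : d.Partition} :
    DomLE mu lam ↔ ∀ c, excess mu.parts c ≤ excess lam.parts c := by
  have hs : ∀ nu : d.Partition, (nu.parts.sort (· ≥ ·)).Pairwise (· ≥ ·) := fun nu =>
    Multiset.pairwise_sort _ _
  have he : ∀ (nu : d.Partition) c, excess nu.parts c = excess (nu.parts.sort (· ≥ ·)) c := by
    intro nu c
    rw [Multiset.sort_eq]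
  constructor
  · intro h c
    obtain ⟨k, hk⟩ := exists_excess_add_eq (hs mu) c
    have h1 := h k
    have h2 := sum_take_le (lam.parts.sort (· ≥ ·)) k c
    rw [partialSum, partialSum] at h1
    rw [he, he]
    omega
  · intro h k
    obtain ⟨c, -, hc⟩ := exists_sum_take_eq (hs lam) k
    have h1 := h c
    have h2 := sum_take_le (mu.parts.sort (· ≥ ·)) k c
    rw [he, he] at h1
    rw [partialSum, partialSum]
    omega

theorem excess_succ (s : Multiset ℕ) (c : ℕ) :
    excess s c = excess s (c + 1) + s.countP (c < ·) := by
  induction s using Multiset.induction_on with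
  | empty => simp [excess]
  | cons a s ih =>
    rw [excess_cons, excess_cons, Multiset.countP_cons, ih]
    split_ifs <;> omega

/-- First differences of the excess count the parts above c, and second differences give the
multiplicities. -/
theorem eq_of_excess_eq {s t : Multiset ℕ} (hs : 0 ∉ s) (ht : 0 ∉ t)
    (h : ∀ c, excess s c = excess t c) : s = t := by
  have hcount : ∀ c, s.countP (c < ·) = t.countP (c < ·) := by
    intro c
    have h1 := excess_succ s c
    have h2 := excess_succ t c
    rw [h, h (c + 1)] at h1
    omega
  have key : ∀ (s : Multiset ℕ) c, s.countP (c < ·) = s.countP (c + 1 < ·) + s.count (c + 1) := by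
    intro s c
    induction s using Multiset.induction_on with
    | empty => simp
    | cons a s ih =>
      rw [Multiset.countP_cons, Multiset.countP_cons, Multiset.count_cons, ih]
      split_ifs <;> omega
  ext v
  rcases v with _ | v
  · rw [Multiset.count_eq_zero_of_notMem hs, Multiset.count_eq_zero_of_notMem ht]
  · have h1 := key s v
    have h2 := key t v
    rw [hcount, hcount (v + 1)] at h1
    omega

theorem zero_notMem_parts {d : ℕ} (lam : d.Partition) : 0 ∉ lam.parts := fun h =>
  (lam.parts_pos h).ne' rfl

theorem domLT_of_excess_le {d : ℕ} {mu lam : d.Partition}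
    (h : ∀ c, excess mu.parts c ≤ excess lam.parts c) (hne : mu ≠ lam) : DomLT mu lam := by
  refine ⟨domLE_iff.2 h, fun h' => hne ?_⟩
  rw [domLE_iff] at h'
  exact Nat.Partition.ext (eq_of_excess_eq (zero_notMem_parts _) (zero_notMem_parts _)
    fun c => le_antisymm (h c) (h' c))

/-- The sum of `min x y` over the parts `x` of `s` and `y` of `t`. -/
def minSum (s t : Multiset ℕ) : ℕ := (s.map fun x => (t.map fun y => min x y).sum).sum

theorem minSum_comm (s t : Multiset ℕ) : minSum s t = minSum t s := by
  rw [minSum, Multiset.sum_map_sum_map]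
  simp only [min_comm, minSum]

theorem sum_min_add_excess (t : Multiset ℕ) (x : ℕ) :
    (t.map fun y => min x y).sum + excess t x = t.sum := by
  rw [excess, ← Multiset.sum_map_add]
  conv_rhs => rw [← Multiset.map_id t]
  congr 1
  refine Multiset.map_congr rfl fun y _ => ?_
  simp only [id]
  omega

/-- By `sum_min_add_excess`, the sum of min(x, y) over y in t is |t| minus the excess of t over x,
so it decreases as t goes up in dominance. -/
theorem minSum_le_minSum_right {s t : Multiset ℕ} (hsum : s.sum = t.sum)
    (h : ∀ c, excess s c ≤ excess t c) (u : Multiset ℕ) : minSum u t ≤ minSum u s := by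
  refine Multiset.sum_map_le_sum_map _ _ fun x _ => ?_
  have h1 := sum_min_add_excess s x
  have h2 := sum_min_add_excess t x
  have := h x
  omega

theorem mul_self_eq_add_sum {x B : ℕ} (h : x ≤ B) :
    x * x = x + 2 * ∑ c ∈ Finset.range B, (x - (c + 1)) := by
  induction B with
  | zero => simp [Nat.le_zero.1 h]
  | succ B ih =>
    rcases Nat.lt_or_ge B x with hx | hx
    · obtain rfl : x = B + 1 := by omega
      have := Finset.sum_range_reflect (fun i => i) (B + 1)
      rw [Finset.sum_congr rfl fun c hc => show B + 1 - (c + 1) = B + 1 - 1 - c by omega, this,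
        mul_comm 2, Finset.sum_range_id_mul_two, Nat.add_sub_cancel]
      ring
    · rw [ih hx, Finset.sum_range_succ]
      omega

/-- From x² = x + 2((x-1) + (x-2) + ⋯), summed over the parts: the sum of squares is monotone in the
excesses. -/
theorem sum_sq_eq {s : Multiset ℕ} {B : ℕ} (h : ∀ x ∈ s, x ≤ B) :
    (s.map fun x => x * x).sum = s.sum + 2 * ∑ c ∈ Finset.range B, excess s (c + 1) := by
  induction s using Multiset.induction_on with
  | empty => simp [excess]
  | cons a s ih =>
    rw [Multiset.map_cons, Multiset.sum_cons, Multiset.sum_cons,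
      ih fun x hx => h x (Multiset.mem_cons_of_mem hx),
      mul_self_eq_add_sum (h a (Multiset.mem_cons_self a s))]
    simp only [excess_cons, Finset.sum_add_distrib]
    ring

/-- The eigenvalue of the Laplace--Beltrami operator in terms of the parts. -/
def partsEigenval (α : ℝ) (s : Multiset ℕ) : ℝ :=
  α * ((s.map fun x => x * x).sum : ℕ) - (minSum s s : ℕ)

theorem eigenval_eq (α : ℝ) (mu : Fin n → ℕ) : eigenval α mu = partsEigenval α (partsOf mu) := by
  rw [eigenval, partsEigenval, minSum, sum_partsOf mu _ (by simp), sum_partsOf mu _ (by simp)]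
  simp only [sum_partsOf mu (fun y => min _ y) (by simp)]
  push_cast
  rw [Finset.sum_sub_distrib, Finset.mul_sum]
  simp only [sq]

/-- Going up in dominance weakly decreases the sum of minima and strictly increases the sum of
squares, which has the positive coefficient α. -/
theorem partsEigenval_lt {α : ℝ} (hα : 0 < α) {d : ℕ} {mu lam : d.Partition}
    (h : DomLT mu lam) : partsEigenval α mu.parts < partsEigenval α lam.parts := by
  have hle := domLE_iff.1 h.1
  have hsum : mu.parts.sum = lam.parts.sum := by rw [mu.parts_sum, lam.parts_sum]
  have hmin : minSum lam.parts lam.parts ≤ minSum mu.parts mu.parts := by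
    refine (minSum_le_minSum_right hsum hle _).trans ?_
    rw [minSum_comm]
    exact minSum_le_minSum_right hsum hle _
  obtain ⟨c, hc⟩ : ∃ c, excess mu.parts c < excess lam.parts c := by
    by_contra! hcon
    exact h.2 (domLE_iff.2 hcon)
  have hbd : ∀ (nu : d.Partition) x, x ∈ nu.parts → x ≤ d := fun nu x hx => nu.le_of_mem_parts hx
  -- The excess over 0 is d for both partitions and the excess over any c > d is 0, so a strict
  -- inequality occurs at a level that enters the sum of squares.
  have hc0 : c ≠ 0 := by
    rintro rfl
    simp [excess, mu.parts_sum, lam.parts_sum] at hc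
  have hcd : c ≤ d := by
    by_contra hcd
    rw [excess_eq_zero (s := lam.parts) fun x hx => by have := hbd lam x hx; omega] at hc
    omega
  have hsq : (mu.parts.map fun x => x * x).sum < (lam.parts.map fun x => x * x).sum := by
    rw [sum_sq_eq (hbd mu), sum_sq_eq (hbd lam), hsum]
    have : ∑ c ∈ Finset.range d, excess mu.parts (c + 1) <
        ∑ c ∈ Finset.range d, excess lam.parts (c + 1) :=
      Finset.sum_lt_sum (fun c _ => hle _) ⟨c - 1, Finset.mem_range.2 (by omega), by
        rwa [Nat.sub_add_cancel (by omega)]⟩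
    omega
  have h1 : ((minSum lam.parts lam.parts : ℕ) : ℝ) ≤ (minSum mu.parts mu.parts : ℕ) := by
    exact_mod_cast hmin
  have h2 : (((mu.parts.map fun x => x * x).sum : ℕ) : ℝ) <
      ((lam.parts.map fun x => x * x).sum : ℕ) := by exact_mod_cast hsq
  rw [partsEigenval, partsEigenval]
  have := mul_lt_mul_of_pos_left h2 hα
  linarith

/-! ### Monomial symmetric functions -/

theorem sum_partsOf_eq (mu : Fin n → ℕ) : (partsOf mu).sum = ∑ k, mu k := by
  have := sum_partsOf mu (fun v => v) rfl
  simpa using this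

theorem ofSym_parts_eq {d : ℕ} (a : Sym (Fin n) d) :
    (Nat.Partition.ofSym a).parts = partsOf fun k => (a : Multiset (Fin n)).count k := by
  have h : (Finset.univ.val.filter fun k => (a : Multiset (Fin n)).count k ≠ 0) =
      (a : Multiset (Fin n)).dedup := by
    refine (Multiset.Nodup.ext (Multiset.Nodup.filter _ Finset.univ.nodup)
      (Multiset.nodup_dedup _)).2 fun k => ?_
    simp
  rw [partsOf, Multiset.filter_map]
  change _ = Multiset.map _ (Finset.univ.val.filter fun k => (a : Multiset (Fin n)).count k ≠ 0)
  rw [h]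
  rfl

theorem coeff_msymm {d : ℕ} (lam : d.Partition) (k : Fin n →₀ ℕ) :
    coeff k (msymm (Fin n) ℝ lam) = if partsOf k = lam.parts then 1 else 0 := by
  classical
  have hprod : ∀ s : Multiset (Fin n), (s.map X).prod =
      monomial (Multiset.toFinsupp s) (1 : ℝ) := by
    intro s
    induction s using Multiset.induction_on with
    | empty => simp
    | cons a s ih =>
      rw [Multiset.map_cons, Multiset.prod_cons, ih, ← Multiset.singleton_add, map_add,
        Multiset.toFinsupp_singleton, X, monomial_mul, one_mul]
  simp only [msymm, hprod, coeff_sum, coeff_monomial]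
  split_ifs with h
  · have hcard : Multiset.card (Finsupp.toMultiset k) = d := by
      rw [Finsupp.card_toMultiset, Finsupp.sum_fintype _ _ (by simp)]
      exact (sum_partsOf_eq k).symm.trans (h ▸ lam.parts_sum)
    have hcount : (fun i => (Finsupp.toMultiset k).count i) = k := by
      funext i; exact Finsupp.count_toMultiset k i
    rw [Finset.sum_eq_single ⟨⟨Finsupp.toMultiset k, hcard⟩, Nat.Partition.ext
      ((ofSym_parts_eq (Sym.mk (Finsupp.toMultiset k) hcard)).trans
        ((congrArg partsOf hcount).trans h))⟩]
    · simp
    · intro b _ hb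
      refine if_neg fun e => hb (Subtype.ext (Subtype.ext ?_))
      exact (Multiset.toFinsupp_toMultiset _).symm.trans (congrArg Finsupp.toMultiset e)
    · simp
  · refine Finset.sum_eq_zero fun b _ => if_neg fun e => h ?_
    rw [← b.2, ofSym_parts_eq]
    congr 1
    funext i
    rw [← e]
    simp

/-- The coefficient of `m_t` in the product of `p_k` and `m_s`. -/
def pieriCoeff (k : ℕ) (s t : Multiset ℕ) : ℕ :=
  (t.map fun v => if k ≤ v ∧ t.erase v + (if v = k then 0 else {v - k}) = s then 1 else 0).sum

theorem partsOf_sub {mu nu : Fin n → ℕ} {i : Fin n} {k : ℕ} (hi : k ≤ mu i)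
    (hnu : ∀ j, nu j = if j = i then mu i - k else mu j) :
    partsOf nu = (partsOf mu).erase (mu i) + (if mu i = k then 0 else {mu i - k}) := by
  rw [partsOf_eq_iff]
  · intro v hv
    rw [Multiset.count_add]
    have hsplit : ∀ f : Fin n → ℕ, (Finset.univ.filter fun j => f j = v).card =
        (if f i = v then 1 else 0) + ((Finset.univ.erase i).filter fun j => f j = v).card := by
      intro f
      rw [Finset.card_filter, Finset.card_filter,
        Finset.add_sum_erase _ (fun j => if f j = v then 1 else 0) (Finset.mem_univ i)]
    have h1 : ((Finset.univ.erase i).filter fun j => nu j = v).card =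
        ((Finset.univ.erase i).filter fun j => mu j = v).card := by
      congr 1
      refine Finset.filter_congr fun j hj => ?_
      rw [hnu, if_neg (Finset.ne_of_mem_erase hj)]
    have h2 := count_partsOf mu hv
    rw [hsplit nu, h1, hnu i, if_pos rfl]
    rw [hsplit mu] at h2
    have h3 : Multiset.count v (if mu i = k then 0 else ({mu i - k} : Multiset ℕ)) =
        if mu i - k = v then 1 else 0 := by
      split_ifs with h4 h5 h5
      · omega
      · simp
      · simp [h5]
      · rw [Multiset.count_singleton, if_neg (Ne.symm h5)]
    rw [h3]
    by_cases h : mu i = v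
    · rw [h, Multiset.count_erase_self, h2, if_pos h]
      omega
    · rw [Multiset.count_erase_of_ne (Ne.symm h), h2, if_neg h]
      omega
  · rw [Multiset.mem_add, not_or]
    refine ⟨fun h => zero_notMem_partsOf mu (Multiset.mem_of_mem_erase h), ?_⟩
    split_ifs
    · simp
    · simp only [Multiset.mem_singleton]; omega

/-- A monomial of p_k m_s arises by raising one exponent by k. Counting the positions where this can
be undone involves only the parts of the exponent vector, so the coefficient is the same in every
number of variables. -/
theorem coeff_psum_mul {k : ℕ} (hk : 0 < k) {s : Multiset ℕ} {g : MvPolynomial (Fin n) ℝ}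
    (hg : ∀ l : Fin n →₀ ℕ, coeff l g = if partsOf l = s then 1 else 0) (l : Fin n →₀ ℕ) :
    coeff l (psum (Fin n) ℝ k * g) = pieriCoeff k s (partsOf l) := by
  classical
  rw [pieriCoeff, sum_partsOf (l : Fin n → ℕ)
    (fun v => if k ≤ v ∧ (partsOf l).erase v + (if v = k then 0 else {v - k}) = s then 1 else 0)
    (if_neg (by omega)), psum, Finset.sum_mul, coeff_sum,
    Nat.cast_sum]
  refine Finset.sum_congr rfl fun i _ => ?_
  rw [X_pow_eq_monomial, coeff_monomial_mul']
  by_cases h : k ≤ l i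
  · rw [if_pos (Finsupp.single_le_iff.2 h), one_mul, hg]
    have : partsOf (l - Finsupp.single i k : Fin n →₀ ℕ) =
        (partsOf l).erase (l i) + (if l i = k then 0 else {l i - k}) := by
      refine partsOf_sub h fun j => ?_
      rw [Finsupp.tsub_apply]
      split_ifs with hj
      · subst hj; simp
      · rw [Finsupp.single_eq_of_ne hj, Nat.sub_zero]
    rw [this]
    simp [h]
  · rw [if_neg (mt Finsupp.single_le_iff.1 h), if_neg (by tauto), Nat.cast_zero]

theorem pieriCoeff_ne_zero {k : ℕ} {s t : Multiset ℕ} (h : pieriCoeff k s t ≠ 0) :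
    t = k ::ₘ s ∨ ∃ w ∈ s, t = (w + k) ::ₘ s.erase w := by
  obtain ⟨x, hx, hx0⟩ : ∃ x ∈ t, (if k ≤ x ∧ t.erase x + (if x = k then 0 else {x - k}) = s
      then 1 else 0) ≠ 0 := by
    by_contra! hcon
    refine h (Multiset.sum_eq_zero fun y hy => ?_)
    obtain ⟨x, hx, rfl⟩ := Multiset.mem_map.1 hy
    exact hcon x hx
  have hx1 : k ≤ x ∧ t.erase x + (if x = k then 0 else {x - k}) = s := by
    by_contra hcon
    exact hx0 (if_neg hcon)
  obtain ⟨hkx, hs⟩ := hx1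
  by_cases hxk : x = k
  · left
    rw [if_pos hxk, add_zero] at hs
    rw [← hs, ← hxk, Multiset.cons_erase hx]
  · right
    rw [if_neg hxk, Multiset.add_comm, Multiset.singleton_add] at hs
    refine ⟨x - k, hs ▸ Multiset.mem_cons_self _ _, ?_⟩
    rw [← hs, Multiset.erase_cons_head, Nat.sub_add_cancel hkx, Multiset.cons_erase hx]

/-- Induction on the number of parts: p_k m_s is a positive multiple of m_{s ∪ k} plus monomial
functions obtained by adding k to a part of s, which have fewer parts. Solving for m_{s ∪ k}
expresses it in power sums uniformly in n. -/
theorem exists_symMon (s : Multiset ℕ) (hs : 0 ∉ s) : ∃ M : SymFun, ∀ (n : ℕ) (l : Fin n →₀ ℕ),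
    coeff l (toVars n M) = if partsOf l = s then 1 else 0 := by
  classical
  induction hc : s.card using Nat.strong_induction_on generalizing s with
  | _ c ih =>
    rcases Multiset.empty_or_exists_mem s with rfl | ⟨k, hk⟩
    · refine ⟨1, fun n l => ?_⟩
      rw [map_one, coeff_one]
      refine if_congr ?_ rfl rfl
      constructor
      · rintro rfl
        rw [partsOf_eq_iff hs]
        intro v hv
        simp [Ne.symm hv]
      · intro h
        ext i
        by_contra hi
        have : l i ∈ partsOf l := by
          simp only [partsOf, Multiset.mem_filter, Multiset.mem_map]
          exact ⟨⟨i, Finset.mem_univ_val i, rfl⟩, fun e => hi e.symm⟩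
        rw [h] at this
        simp at this
    · obtain ⟨s, rfl⟩ := Multiset.exists_cons_of_mem hk
      rw [Multiset.card_cons] at hc
      have hk0 : 0 < k := Nat.pos_of_ne_zero fun e => hs (by simp [e])
      have hs0 : 0 ∉ s := fun h => hs (Multiset.mem_cons_of_mem h)
      obtain ⟨M, hM⟩ := ih s.card (by omega) s hs0 rfl
      set T : Finset (Multiset ℕ) := s.toFinset.image fun w => (w + k) ::ₘ s.erase w with hT
      have hT' : ∀ t ∈ T, t.card = s.card ∧ 0 ∉ t := by
        intro t ht
        obtain ⟨w, hw, rfl⟩ := Finset.mem_image.1 ht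
        have hw := Multiset.mem_toFinset.1 hw
        refine ⟨?_, ?_⟩
        · rw [Multiset.card_cons, Multiset.card_erase_add_one hw]
        · rw [Multiset.mem_cons, not_or]
          exact ⟨by omega, fun h => hs0 (Multiset.mem_of_mem_erase h)⟩
      have hex : ∀ t ∈ T, ∃ M : SymFun, ∀ (n : ℕ) (l : Fin n →₀ ℕ),
          coeff l (toVars n M) = if partsOf l = t then 1 else 0 := fun t ht =>
        ih s.card (by omega) t (hT' t ht).2 (hT' t ht).1
      choose! N hN using hex
      -- Deleting the new part k already contributes 1 to a sum of natural numbers.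
      have ha : pieriCoeff k s (k ::ₘ s) ≠ 0 := by
        rw [pieriCoeff, Multiset.map_cons, Multiset.sum_cons, if_pos]
        · omega
        · simp
      refine ⟨((pieriCoeff k s (k ::ₘ s) : ℝ)⁻¹) • (X (k.toPNat hk0) * M -
        ∑ t ∈ T, (pieriCoeff k s t : ℝ) • N t), fun n l => ?_⟩
      have hp : toVars n (X (k.toPNat hk0)) = psum (Fin n) ℝ k := by
        rw [toVars, aeval_X]; rfl
      rw [map_smul, map_sub, map_mul, hp, coeff_smul, coeff_sub, coeff_psum_mul hk0 (hM n), map_sum,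
        coeff_sum]
      have hsum : ∑ t ∈ T, coeff l (toVars n ((pieriCoeff k s t : ℝ) • N t)) =
          if partsOf l ∈ T then (pieriCoeff k s (partsOf l) : ℝ) else 0 := by
        rw [Finset.sum_congr rfl fun t ht => by
          rw [map_smul, coeff_smul, hN t ht, smul_eq_mul, mul_ite, mul_one, mul_zero]]
        rw [Finset.sum_ite_eq]
      rw [hsum, smul_eq_mul]
      by_cases h1 : partsOf l = k ::ₘ s
      · have h2 : partsOf l ∉ T := fun h => by
          have := (hT' _ h).1
          rw [h1, Multiset.card_cons] at this
          omega
        rw [if_neg h2, if_pos h1, h1, sub_zero, inv_mul_cancel₀ (by exact_mod_cast ha)]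
      · rw [if_neg h1]
        by_cases h2 : partsOf l ∈ T
        · rw [if_pos h2, sub_self, mul_zero]
        · rw [if_neg h2, sub_zero]
          have h3 : pieriCoeff k s (partsOf l) = 0 := by
            by_contra h3
            rcases pieriCoeff_ne_zero h3 with h | ⟨w, hw, h⟩
            · exact h1 h
            · exact h2 (Finset.mem_image.2 ⟨w, Multiset.mem_toFinset.2 hw, h.symm⟩)
          rw [h3, Nat.cast_zero, mul_zero]

/-- The monomial symmetric function `m_lam`. -/
def symMon {d : ℕ} (lam : d.Partition) : SymFun :=
  (exists_symMon lam.parts (zero_notMem_parts lam)).choose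

theorem toVars_symMon {d : ℕ} (lam : d.Partition) (n : ℕ) :
    toVars n (symMon lam) = msymm (Fin n) ℝ lam := by
  ext l
  rw [coeff_msymm]
  exact (exists_symMon lam.parts (zero_notMem_parts lam)).choose_spec n l

/-! ### The coefficients of the recursion -/

/-- The coefficient of the monomial with exponents `k`. -/
def coeffAt (k : Fin n → ℕ) (g : MvPolynomial (Fin n) ℝ) : ℝ :=
  coeff (Finsupp.equivFunOnFinite.symm k) g

theorem coeff_eq_coeffAt (k : Fin n →₀ ℕ) (g : MvPolynomial (Fin n) ℝ) :
    coeff k g = coeffAt k g := by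
  rw [coeffAt, Finsupp.equivFunOnFinite_symm_coe]

/-- Lower the exponents of `k` at the nonzero parts of `mu`. -/
def strip (mu k : Fin n → ℕ) : Fin n → ℕ := fun i => k i - if 0 < mu i then 1 else 0

open Classical in
theorem coeffAt_xMon_mul (mu k : Fin n → ℕ) (g : MvPolynomial (Fin n) ℝ) :
    coeffAt k (xMon mu * g) =
      if ∀ i, 0 < mu i → 0 < k i then coeffAt (strip mu k) g else 0 := by
  have hx : xMon mu = monomial
      (Finsupp.equivFunOnFinite.symm fun i => if 0 < mu i then 1 else 0) (1 : ℝ) := by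
    rw [monomial_eq, map_one, one_mul, Finsupp.prod_fintype _ _ (by simp), xMon,
      Finset.prod_filter]
    refine Finset.prod_congr rfl fun i _ => ?_
    rw [Finsupp.equivFunOnFinite_symm_apply_apply]
    split_ifs <;> simp
  have hle : (Finsupp.equivFunOnFinite.symm (fun i => if 0 < mu i then 1 else 0) ≤
      Finsupp.equivFunOnFinite.symm k) ↔ ∀ i, 0 < mu i → 0 < k i := by
    rw [Finsupp.le_def]
    refine forall_congr' fun i => ?_
    simp only [Finsupp.equivFunOnFinite_symm_apply_apply]
    split_ifs with h
    · simp only [h, true_implies]; omega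
    · simp [h]
  rw [coeffAt, hx, coeff_monomial_mul', one_mul]
  by_cases h : ∀ i, 0 < mu i → 0 < k i
  · rw [if_pos (hle.2 h), if_pos h, coeffAt]
    congr 1
    ext i
    simp [strip]
  · rw [if_neg (mt hle.1 h), if_neg h]

open Classical in
theorem coeffAt_fPoly_succ (α : ℝ) (R : ℕ) (mu k : Fin n → ℕ) :
    coeffAt k (fPoly α (R + 1) mu) = if ∀ i, 0 < mu i → 0 < k i then
      ∑ nu ∈ orbit (dec mu), pairWeight α (R + 1) mu nu * coeffAt (strip mu k) (fPoly α R nu)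
      else 0 := by
  rw [fPoly, coeffAt_xMon_mul]
  simp only [coeffAt, coeff_sum, coeff_smul, smul_eq_mul]

theorem coeffAt_one (k : Fin n → ℕ) (h : coeffAt k 1 ≠ 0) : k = 0 := by
  classical
  rw [coeffAt, coeff_one] at h
  by_contra hk
  refine h (if_neg fun e => hk ?_)
  exact Finsupp.equivFunOnFinite.symm.injective (e.symm.trans (by ext; simp))

theorem coeffAt_zero_one : coeffAt (0 : Fin n → ℕ) 1 = 1 := by
  have h : Finsupp.equivFunOnFinite.symm (0 : Fin n → ℕ) = 0 := by ext; simp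
  rw [coeffAt, h, coeff_zero_one]

theorem dec_le_of_mem_orbit {mu nu : Fin n → ℕ} {R : ℕ} (hR : ∀ k, mu k ≤ R + 1)
    (h : nu ∈ orbit (dec mu)) (k : Fin n) : nu k ≤ R :=
  le_of_mem_orbit h (fun k => by have := hR k; simp only [dec]; omega) k

theorem sum_of_mem_orbit {M : Type*} [AddCommMonoid M] {mu nu : Fin n → ℕ} (h : nu ∈ orbit mu)
    (g : ℕ → M) : ∑ i, g (nu i) = ∑ i, g (mu i) := by
  obtain ⟨s, rfl⟩ := mem_orbit.1 h
  exact Equiv.sum_comp s⁻¹ fun i => g (mu i)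

/-- Only monomials dominated by `mu` occur in `f_mu`. -/
theorem excess_le_of_coeffAt_fPoly_ne_zero {α : ℝ} {R : ℕ} {mu k : Fin n → ℕ}
    (hR : ∀ i, mu i ≤ R) (h : coeffAt k (fPoly α R mu) ≠ 0) :
    ∑ i, k i = ∑ i, mu i ∧ ∀ c, ∑ i, (k i - c) ≤ ∑ i, (mu i - c) := by
  induction R generalizing mu k with
  | zero =>
    have h0 : mu = 0 := funext fun i => Nat.le_zero.1 (hR i)
    rw [h0, coeffAt_one k h]
    simp
  | succ R ih =>
    classical
    rw [coeffAt_fPoly_succ] at h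
    have hpos : ∀ i, 0 < mu i → 0 < k i := by
      by_contra hcon
      exact h (if_neg hcon)
    rw [if_pos hpos] at h
    obtain ⟨nu, hnu, hne⟩ := Finset.exists_ne_zero_of_sum_ne_zero h
    obtain ⟨h1, h2⟩ := ih (dec_le_of_mem_orbit hR hnu) (right_ne_zero_of_mul hne)
    rw [sum_of_mem_orbit hnu (fun v => v)] at h1
    have hsum : ∑ i, k i = ∑ i, mu i := by
      have e1 : ∑ i, k i = ∑ i, strip mu k i + ∑ i, (if 0 < mu i then 1 else 0) := by
        rw [← Finset.sum_add_distrib]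
        refine Finset.sum_congr rfl fun i _ => ?_
        have := hpos i
        simp only [strip]
        split_ifs with h
        · have := this h; omega
        · rfl
      have e2 : ∑ i, mu i = ∑ i, dec mu i + ∑ i, (if 0 < mu i then 1 else 0) := by
        rw [← Finset.sum_add_distrib]
        refine Finset.sum_congr rfl fun i _ => ?_
        simp only [dec]
        split_ifs <;> omega
      rw [e1, e2, h1]
    refine ⟨hsum, fun c => ?_⟩
    rcases c with _ | c
    · exact hsum.le
    · have h3 := h2 c
      rw [sum_of_mem_orbit hnu (fun v => v - c)] at h3
      -- Stripping lowers an exponent by at most one, while `dec` lowers every nonzero part by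
      -- exactly one; level c of the induction hypothesis therefore gives level c + 1.
      calc ∑ i, (k i - (c + 1)) ≤ ∑ i, (strip mu k i - c) := by
            refine Finset.sum_le_sum fun i _ => ?_
            simp only [strip]
            split_ifs <;> omega
        _ ≤ ∑ i, (dec mu i - c) := h3
        _ = ∑ i, (mu i - (c + 1)) := by
            refine Finset.sum_congr rfl fun i _ => ?_
            simp only [dec]
            omega

theorem unfixed_dec (mu : Fin n → ℕ) (a : ℕ) : unfixed mu (dec mu) a = 0 := by
  rw [unfixed, Finset.card_eq_zero, Finset.filter_eq_empty_iff]
  intro k _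
  simp only [dec]
  omega

theorem pairWeight_dec (α : ℝ) (R : ℕ) (mu : Fin n → ℕ) : pairWeight α R mu (dec mu) = 1 := by
  rw [pairWeight, if_neg]
  · simp [unfixed_dec]
  · rw [not_blocked_iff]
    intro k
    simp only [dec]
    omega

theorem dec_injective_of_support {mu k : Fin n → ℕ} (hpos : ∀ i, 0 < mu i ↔ 0 < k i) :
    strip mu k = dec k := by
  funext i
  simp only [strip, dec, hpos]
  split_ifs <;> omega

open Classical in
-- Divisibility by x_μ forces the supports of μ and its rearrangement k to coincide. By induction
-- only ν = `dec k` contributes; if it is not blocked, then k ≤ μ entrywise, and equality of sums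
-- forces k = μ, where the weight is 1.
theorem coeffAt_fPoly_of_mem_orbit {α : ℝ} {R : ℕ} {mu k : Fin n → ℕ} (hR : ∀ i, mu i ≤ R)
    (hk : k ∈ orbit mu) : coeffAt k (fPoly α R mu) = if k = mu then 1 else 0 := by
  induction R generalizing mu k with
  | zero =>
    have h0 : mu = 0 := funext fun i => Nat.le_zero.1 (hR i)
    have hk0 : k = 0 := funext fun i => Nat.le_zero.1 (le_of_mem_orbit hk hR i)
    rw [if_pos (by rw [h0, hk0]), hk0, fPoly, coeffAt_zero_one]
  | succ R ih =>
    rw [coeffAt_fPoly_succ]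
    by_cases hpos : ∀ i, 0 < mu i → 0 < k i
    · have hpos' : ∀ i, 0 < mu i ↔ 0 < k i := by
        have hsub : (Finset.univ.filter fun i => 0 < mu i) ⊆ Finset.univ.filter fun i => 0 < k i :=
          fun i hi => by
            simp only [Finset.mem_filter, Finset.mem_univ, true_and] at hi ⊢
            exact hpos i hi
        have := Finset.eq_of_subset_of_card_le hsub
          (card_filter_of_mem_orbit hk (fun v => 0 < v)).le
        intro i
        have := Finset.ext_iff.1 this i
        simpa using this
      rw [if_pos hpos, dec_injective_of_support hpos']
      have hdec : dec k ∈ orbit (dec mu) := by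
        obtain ⟨s, rfl⟩ := mem_orbit.1 hk
        exact mem_orbit.2 ⟨s, rfl⟩
      rw [Finset.sum_eq_single (dec k)]
      · rw [ih (dec_le_of_mem_orbit hR hdec) (self_mem_orbit _), if_pos rfl, mul_one]
        split_ifs with h
        · rw [h, pairWeight_dec]
        · by_cases hb : Blocked mu (dec k)
          · exact pairWeight_eq_zero hb
          · refine absurd ?_ h
            rw [not_blocked_iff] at hb
            have hle : ∀ i ∈ Finset.univ, k i ≤ mu i := by
              intro i _
              have h1 := hb i
              have h2 := hpos' i
              simp only [dec] at h1
              omega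
            have := (Finset.sum_eq_sum_iff_of_le hle).1 (sum_of_mem_orbit hk fun v => v)
            exact funext fun i => this i (Finset.mem_univ i)
      · intro nu hnu hne
        rw [ih (dec_le_of_mem_orbit hR hnu) (by rwa [orbit_eq hnu]), if_neg (Ne.symm hne), mul_zero]
      · exact fun h => absurd hdec h
    · rw [if_neg hpos, if_neg]
      rintro rfl
      exact hpos fun _ h => h

theorem coeffAt_symSum_of_mem_orbit {α : ℝ} {R : ℕ} {mu k : Fin n → ℕ} (hR : ∀ i, mu i ≤ R)
    (hk : k ∈ orbit mu) : coeffAt k (symSum α R mu) = 1 := by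
  classical
  have h : coeffAt k (symSum α R mu) = ∑ nu ∈ orbit mu, coeffAt k (fPoly α R nu) := by
    simp [symSum, coeffAt, coeff_sum]
  rw [h, Finset.sum_congr rfl fun nu hnu => coeffAt_fPoly_of_mem_orbit (le_of_mem_orbit hnu hR)
    (by rwa [orbit_eq hnu])]
  rw [Finset.sum_ite_eq, if_pos hk]

theorem excess_le_of_coeffAt_symSum_ne_zero {α : ℝ} {R : ℕ} {mu k : Fin n → ℕ}
    (hR : ∀ i, mu i ≤ R) (h : coeffAt k (symSum α R mu) ≠ 0) :
    ∑ i, k i = ∑ i, mu i ∧ ∀ c, ∑ i, (k i - c) ≤ ∑ i, (mu i - c) := by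
  have he : coeffAt k (symSum α R mu) = ∑ nu ∈ orbit mu, coeffAt k (fPoly α R nu) := by
    simp [symSum, coeffAt, coeff_sum]
  rw [he] at h
  obtain ⟨nu, hnu, hne⟩ := Finset.exists_ne_zero_of_sum_ne_zero h
  obtain ⟨h1, h2⟩ := excess_le_of_coeffAt_fPoly_ne_zero (le_of_mem_orbit hnu hR) hne
  exact ⟨h1.trans (sum_of_mem_orbit hnu fun v => v),
    fun c => (h2 c).trans (sum_of_mem_orbit hnu fun v => v - c).le⟩

theorem coeffAt_symSum_permComp (α : ℝ) (R : ℕ) (mu k : Fin n → ℕ) (s : Equiv.Perm (Fin n)) :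
    coeffAt (permComp s k) (symSum α R mu) = coeffAt k (symSum α R mu) := by
  have h1 : rename s (symSum α R mu) = symSum α R mu := by
    simp only [symSum, map_sum, rename_fPoly]
    exact sum_orbit_permComp mu s _
  have h2 := coeff_rename_mapDomain s s.injective (symSum α R mu)
    (Finsupp.equivFunOnFinite.symm k)
  rw [h1] at h2
  rw [coeffAt, coeffAt, ← h2]
  congr 1
  ext i
  obtain ⟨j, rfl⟩ := s.surjective i
  rw [Finsupp.mapDomain_apply s.injective]
  simp [permComp]

/-! ### Stability in the number of variables -/

/-- Extend a composition by zeros. -/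
def extendZero (e : Fin n ↪ Fin m) (mu : Fin n → ℕ) : Fin m → ℕ := Function.extend e mu 0

theorem extendZero_apply (e : Fin n ↪ Fin m) (mu : Fin n → ℕ) (i : Fin n) :
    extendZero e mu (e i) = mu i := e.injective.extend_apply _ _ _

theorem extendZero_of_notMem (e : Fin n ↪ Fin m) (mu : Fin n → ℕ) {i : Fin m}
    (hi : i ∉ Set.range e) : extendZero e mu i = 0 := Function.extend_apply' _ _ _ hi

theorem extendZero_injective (e : Fin n ↪ Fin m) : Function.Injective (extendZero e) := by
  intro mu nu h
  funext i
  rw [← extendZero_apply e mu, h, extendZero_apply]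

theorem card_filter_extend (e : Fin n ↪ Fin m) (p : Fin m → Prop) [DecidablePred p]
    (hp : ∀ i, i ∉ Set.range e → ¬ p i) :
    (Finset.univ.filter p).card = (Finset.univ.filter fun i => p (e i)).card := by
  rw [← Finset.card_map e]
  congr 1
  ext i
  simp only [Finset.mem_filter, Finset.mem_univ, true_and, Finset.mem_map]
  constructor
  · intro h
    obtain ⟨j, rfl⟩ : i ∈ Set.range e := by_contra fun hi => hp i hi h
    exact ⟨j, h, rfl⟩
  · rintro ⟨j, hj, rfl⟩
    exact hj

theorem partsOf_extendZero (e : Fin n ↪ Fin m) (mu : Fin n → ℕ) :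
    partsOf (extendZero e mu) = partsOf mu := by
  rw [partsOf_eq_iff (zero_notMem_partsOf mu)]
  intro v hv
  rw [count_partsOf mu hv, card_filter_extend e _ fun i hi => by
    rw [extendZero_of_notMem e mu hi]; exact hv.symm]
  simp only [extendZero_apply]

theorem forall_extendZero (e : Fin n ↪ Fin m) (mu nu : Fin n → ℕ) (p : ℕ → ℕ → Prop)
    (h0 : p 0 0) : (∀ i, p (extendZero e mu i) (extendZero e nu i)) ↔ ∀ i, p (mu i) (nu i) := by
  constructor
  · intro h i
    simpa only [extendZero_apply] using h (e i)
  · intro h i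
    by_cases hi : i ∈ Set.range e
    · obtain ⟨j, rfl⟩ := hi
      simpa only [extendZero_apply] using h j
    · rwa [extendZero_of_notMem e mu hi, extendZero_of_notMem e nu hi]

/-- At the added positions both compositions are 0; such positions neither block nor enter any
count. -/
theorem pairWeight_extendZero (α : ℝ) (R : ℕ) (e : Fin n ↪ Fin m) (mu nu : Fin n → ℕ) :
    pairWeight α R (extendZero e mu) (extendZero e nu) = pairWeight α R mu nu := by
  have hb : Blocked (extendZero e mu) (extendZero e nu) ↔ Blocked mu nu := by
    rw [← not_iff_not, not_blocked_iff, not_blocked_iff]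
    exact forall_extendZero e mu nu (fun a b => a = 0 ∨ b < a) (Or.inl rfl)
  have hu : ∀ a, unfixed (extendZero e mu) (extendZero e nu) a = unfixed mu nu a := by
    intro a
    rw [unfixed, card_filter_extend e _ fun i hi => by
      rw [extendZero_of_notMem e mu hi]; omega]
    simp only [extendZero_apply, unfixed]
  have hw : ∀ a, between (extendZero e mu) a = between mu a := by
    intro a
    rw [between, card_filter_extend e _ fun i hi => by
      rw [extendZero_of_notMem e mu hi]; omega]
    simp only [extendZero_apply, between]
  rw [pairWeight, pairWeight]
  by_cases h : Blocked mu nu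
  · rw [if_pos h, if_pos (hb.2 h)]
  · rw [if_neg h, if_neg (mt hb.1 h)]
    simp only [hu, hw]

theorem support_of_coeffAt_fPoly_ne_zero {α : ℝ} {R : ℕ} {mu k : Fin n → ℕ}
    (hR : ∀ i, mu i ≤ R) (h : coeffAt k (fPoly α R mu) ≠ 0) (i : Fin n) (hi : k i = 0) :
    mu i = 0 := by
  classical
  rcases R with _ | R
  · exact Nat.le_zero.1 (hR i)
  · rw [coeffAt_fPoly_succ] at h
    by_contra hmu
    exact h (if_neg fun hpos => by have := hpos i; omega)

theorem exists_extendZero (e : Fin n ↪ Fin m) {mu : Fin m → ℕ}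
    (h : ∀ i, i ∉ Set.range e → mu i = 0) : ∃ nu, extendZero e nu = mu := by
  refine ⟨mu ∘ e, funext fun i => ?_⟩
  by_cases hi : i ∈ Set.range e
  · obtain ⟨j, rfl⟩ := hi
    rw [extendZero_apply]; rfl
  · rw [extendZero_of_notMem e _ hi, h i hi]

theorem sum_orbit_extendZero (e : Fin n ↪ Fin m) (mu : Fin n → ℕ) (g : (Fin m → ℕ) → ℝ)
    (hg : ∀ nu ∈ orbit (extendZero e mu), g nu ≠ 0 → ∀ i, i ∉ Set.range e → nu i = 0) :
    ∑ nu ∈ orbit (extendZero e mu), g nu = ∑ nu ∈ orbit mu, g (extendZero e nu) := by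
  symm
  rw [← Finset.sum_image (f := g) fun a _ b _ h => extendZero_injective e h]
  refine Finset.sum_subset (fun nu hnu => ?_) fun nu hnu hnot => ?_
  · obtain ⟨k, hk, rfl⟩ := Finset.mem_image.1 hnu
    rw [mem_orbit_iff, partsOf_extendZero, partsOf_extendZero]
    exact mem_orbit_iff.1 hk
  · by_contra hne
    obtain ⟨k, rfl⟩ := exists_extendZero e (hg nu hnu hne)
    refine hnot (Finset.mem_image.2 ⟨k, ?_, rfl⟩)
    rw [mem_orbit_iff] at hnu ⊢
    rwa [partsOf_extendZero, partsOf_extendZero] at hnu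

theorem extendZero_le {e : Fin n ↪ Fin m} {mu : Fin n → ℕ} {R : ℕ} (hR : ∀ i, mu i ≤ R)
    (i : Fin m) : extendZero e mu i ≤ R := by
  by_cases hi : i ∈ Set.range e
  · obtain ⟨j, rfl⟩ := hi
    rw [extendZero_apply]; exact hR j
  · rw [extendZero_of_notMem e _ hi]; exact Nat.zero_le _

/-- The larger orbit also contains compositions with nonzero entries at new positions, but f_ν is
divisible by x_ν, so these do not contribute to monomials in the old variables. -/
theorem coeffAt_fPoly_extendZero {α : ℝ} {R : ℕ} (e : Fin n ↪ Fin m) {mu : Fin n → ℕ}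
    (hR : ∀ i, mu i ≤ R) (k : Fin n → ℕ) :
    coeffAt (extendZero e k) (fPoly α R (extendZero e mu)) = coeffAt k (fPoly α R mu) := by
  classical
  induction R generalizing mu k with
  | zero =>
    rw [fPoly, fPoly]
    by_cases hk : k = 0
    · subst hk
      have : extendZero e (0 : Fin n → ℕ) = 0 := by
        funext i
        exact Nat.le_zero.1 (extendZero_le (fun _ => le_rfl) i)
      rw [this, coeffAt_zero_one, coeffAt_zero_one]
    · have h1 : coeffAt k 1 = 0 := by_contra fun h => hk (coeffAt_one k h)
      have h2 : coeffAt (extendZero e k) 1 = 0 := by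
        by_contra h
        refine hk (funext fun i => ?_)
        have := congrFun (coeffAt_one _ h) (e i)
        rwa [extendZero_apply] at this
      rw [h1, h2]
  | succ R ih =>
    rw [coeffAt_fPoly_succ, coeffAt_fPoly_succ]
    have hcond := forall_extendZero e mu k (fun a b => 0 < a → 0 < b) id
    by_cases hpos : ∀ i, 0 < mu i → 0 < k i
    · rw [if_pos hpos, if_pos (hcond.2 hpos)]
      have hdec : dec (extendZero e mu) = extendZero e (dec mu) := by
        funext i
        by_cases hi : i ∈ Set.range e
        · obtain ⟨j, rfl⟩ := hi
          simp only [dec, extendZero_apply]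
        · simp only [dec, extendZero_of_notMem e _ hi, Nat.zero_sub]
      have hstrip : strip (extendZero e mu) (extendZero e k) = extendZero e (strip mu k) := by
        funext i
        by_cases hi : i ∈ Set.range e
        · obtain ⟨j, rfl⟩ := hi
          simp only [strip, extendZero_apply]
        · simp only [strip, extendZero_of_notMem e _ hi, Nat.zero_sub]
      have hRd : ∀ i, dec mu i ≤ R := fun i => by have := hR i; simp only [dec]; omega
      rw [hdec, hstrip, sum_orbit_extendZero]
      · refine Finset.sum_congr rfl fun nu hnu => ?_
        rw [pairWeight_extendZero, ih (le_of_mem_orbit hnu hRd)]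
      · intro nu hnu hne i hi
        exact support_of_coeffAt_fPoly_ne_zero (le_of_mem_orbit hnu (extendZero_le hRd))
          (right_ne_zero_of_mul hne) i (extendZero_of_notMem e _ hi)
    · rw [if_neg hpos, if_neg (mt hcond.1 hpos)]

theorem coeffAt_symSum_extendZero {α : ℝ} {R : ℕ} (e : Fin n ↪ Fin m) {mu : Fin n → ℕ}
    (hR : ∀ i, mu i ≤ R) (k : Fin n → ℕ) :
    coeffAt (extendZero e k) (symSum α R (extendZero e mu)) = coeffAt k (symSum α R mu) := by
  have he : ∀ (n : ℕ) (mu k : Fin n → ℕ), coeffAt k (symSum α R mu) =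
      ∑ nu ∈ orbit mu, coeffAt k (fPoly α R nu) := fun n mu k => by
    simp [symSum, coeffAt, coeff_sum]
  rw [he, he, sum_orbit_extendZero]
  · exact Finset.sum_congr rfl fun nu hnu =>
      coeffAt_fPoly_extendZero e (le_of_mem_orbit hnu hR) k
  · intro nu hnu hne i hi
    exact support_of_coeffAt_fPoly_ne_zero (le_of_mem_orbit hnu (extendZero_le hR)) hne i
      (extendZero_of_notMem e _ hi)

theorem symSum_congr {α : ℝ} {R : ℕ} {mu nu : Fin n → ℕ} (h : partsOf nu = partsOf mu) :
    symSum α R nu = symSum α R mu := by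
  rw [symSum, orbit_eq (mem_orbit_iff.2 h), symSum]

/-- The coefficients of the symmetric sum depend only on the parts, not on the number of
variables. -/
theorem coeffAt_symSum_congr {α : ℝ} {R : ℕ} {mu k : Fin n → ℕ} {mu' k' : Fin m → ℕ}
    (hR : ∀ i, mu i ≤ R) (hR' : ∀ i, mu' i ≤ R) (hmu : partsOf mu = partsOf mu')
    (hk : partsOf k = partsOf k') :
    coeffAt k (symSum α R mu) = coeffAt k' (symSum α R mu') := by
  -- Both sides are compared in n + m variables, where the extended compositions become
  -- rearrangements of one another.
  set e : Fin n ↪ Fin (n + m) := Fin.castAddEmb m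
  set e' : Fin m ↪ Fin (n + m) := Fin.natAddEmb n
  rw [← coeffAt_symSum_extendZero e hR, ← coeffAt_symSum_extendZero e' hR',
    symSum_congr (mu := extendZero e' mu') (nu := extendZero e mu)
      (by rw [partsOf_extendZero, partsOf_extendZero, hmu])]
  have : extendZero e k ∈ orbit (extendZero e' k') := by
    rw [mem_orbit_iff, partsOf_extendZero, partsOf_extendZero, hk]
  obtain ⟨s, hs⟩ := mem_orbit.1 this
  rw [← hs, coeffAt_symSum_permComp]

/-! ### The symmetric functions given by the sum formula -/

theorem card_parts_le {d : ℕ} (lam : d.Partition) : lam.parts.card ≤ d := by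
  have h := Multiset.card_nsmul_le_sum (s := lam.parts) (a := 1) fun x hx => lam.parts_pos hx
  rwa [lam.parts_sum, smul_eq_mul, mul_one] at h

/-- A composition with `d` entries whose nonzero entries are the parts of `lam`. -/
def compOf {d : ℕ} (lam : d.Partition) : Fin d → ℕ :=
  (exists_partsOf (zero_notMem_parts lam) (card_parts_le lam)).choose

theorem partsOf_compOf {d : ℕ} (lam : d.Partition) : partsOf (compOf lam) = lam.parts :=
  (exists_partsOf (zero_notMem_parts lam) (card_parts_le lam)).choose_spec

theorem le_of_partsOf {mu : Fin n → ℕ} {R : ℕ} (h : ∀ x ∈ partsOf mu, x ≤ R) (i : Fin n) :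
    mu i ≤ R := by
  by_cases hi : mu i = 0
  · omega
  · refine h _ ?_
    simp only [partsOf, Multiset.mem_filter, Multiset.mem_map]
    exact ⟨⟨i, Finset.mem_univ_val i, rfl⟩, hi⟩

theorem le_of_partsOf_eq {d : ℕ} {lam : d.Partition} {mu : Fin n → ℕ} {R : ℕ}
    (h : ∀ x ∈ lam.parts, x ≤ R) (hmu : partsOf mu = lam.parts) (i : Fin n) : mu i ≤ R :=
  le_of_partsOf (by rwa [hmu]) i

theorem excess_partsOf (mu : Fin n → ℕ) (c : ℕ) : excess (partsOf mu) c = ∑ i, (mu i - c) :=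
  sum_partsOf mu (· - c) (Nat.zero_sub c)

/-- The coefficients of the sum formula in the monomial symmetric functions. -/
def sumCoeff (α : ℝ) (R : ℕ) {d : ℕ} (lam kap : d.Partition) : ℝ :=
  coeffAt (compOf kap) (symSum α R (compOf lam))

/-- The symmetric function given by the sum formula. -/
def sumSym (α : ℝ) (R : ℕ) {d : ℕ} (lam : d.Partition) : SymFun :=
  ∑ kap, sumCoeff α R lam kap • symMon kap

theorem toVars_sumSym {α : ℝ} {R d : ℕ} {lam : d.Partition} (hR : ∀ x ∈ lam.parts, x ≤ R)
    {mu : Fin n → ℕ} (hmu : partsOf mu = lam.parts) :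
    toVars n (sumSym α R lam) = symSum α R mu := by
  classical
  have hRmu := le_of_partsOf_eq hR hmu
  ext k
  rw [sumSym, map_sum, coeff_sum]
  simp only [map_smul, toVars_symMon, coeff_smul, coeff_msymm, smul_eq_mul, mul_ite, mul_one,
    mul_zero]
  by_cases hk : ∑ i, k i = d
  · let kap : d.Partition := ⟨partsOf k, fun {i} hi => Nat.pos_of_ne_zero fun e =>
      zero_notMem_partsOf k (e ▸ hi), by rw [sum_partsOf_eq, hk]⟩
    rw [Finset.sum_eq_single kap]
    · rw [if_pos rfl, coeff_eq_coeffAt, sumCoeff]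
      exact coeffAt_symSum_congr (le_of_partsOf_eq hR (partsOf_compOf lam)) hRmu
        (by rw [partsOf_compOf, hmu]) (partsOf_compOf kap)
    · intro nu _ hne
      exact if_neg fun e => hne (Nat.Partition.ext e.symm)
    · simp
  · rw [Finset.sum_eq_zero]
    · rw [coeff_eq_coeffAt]
      by_contra hne
      refine hk ?_
      rw [(excess_le_of_coeffAt_symSum_ne_zero hRmu (Ne.symm hne)).1, ← sum_partsOf_eq, hmu,
        lam.parts_sum]
    · intro nu _
      refine if_neg fun e => hk ?_
      rw [← sum_partsOf_eq, e, nu.parts_sum]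

theorem sumCoeff_self {α : ℝ} {R d : ℕ} {lam : d.Partition} (hR : ∀ x ∈ lam.parts, x ≤ R) :
    sumCoeff α R lam lam = 1 :=
  coeffAt_symSum_of_mem_orbit (le_of_partsOf_eq hR (partsOf_compOf lam)) (self_mem_orbit _)

theorem domLT_of_sumCoeff_ne_zero {α : ℝ} {R d : ℕ} {lam kap : d.Partition}
    (hR : ∀ x ∈ lam.parts, x ≤ R) (h : sumCoeff α R lam kap ≠ 0) (hne : kap ≠ lam) :
    DomLT kap lam := by
  refine domLT_of_excess_le (fun c => ?_) hne
  rw [← partsOf_compOf kap, ← partsOf_compOf lam, excess_partsOf, excess_partsOf]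
  exact (excess_le_of_coeffAt_symSum_ne_zero
    (le_of_partsOf_eq hR (partsOf_compOf lam)) h).2 c

open Classical in
theorem sumSym_eq {α : ℝ} {R d : ℕ} {lam : d.Partition} (hR : ∀ x ∈ lam.parts, x ≤ R) :
    sumSym α R lam = symMon lam + ∑ kap with DomLT kap lam, sumCoeff α R lam kap • symMon kap := by
  rw [sumSym, ← Finset.add_sum_erase _ _ (Finset.mem_univ lam), sumCoeff_self hR, one_smul]
  congr 1
  symm
  refine Finset.sum_subset (fun kap hk => ?_) fun kap hk hnot => ?_
  · refine Finset.mem_erase.2 ⟨?_, Finset.mem_univ _⟩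
    rintro rfl
    have := (Finset.mem_filter.1 hk).2
    exact this.2 this.1
  · have : sumCoeff α R lam kap = 0 := by
      by_contra h
      exact hnot (Finset.mem_filter.2 ⟨Finset.mem_univ _,
        domLT_of_sumCoeff_ne_zero hR h (Finset.ne_of_mem_erase hk)⟩)
    rw [this, zero_smul]

/-- Setting the additional variables to 0 recovers the image in n variables. Identities may thus be
checked with enough variables to accommodate all parts. -/
theorem toVars_eq_zero_of_add {n j : ℕ} {f : SymFun} (h : toVars (n + j) f = 0) :
    toVars n f = 0 := by
  obtain ⟨G, hl, hr⟩ : ∃ G : MvPolynomial (Fin (n + j)) ℝ →ₐ[ℝ] MvPolynomial (Fin n) ℝ,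
      (∀ i, G (X (Fin.castAdd j i)) = X i) ∧ ∀ i, G (X (Fin.natAdd n i)) = 0 :=
    ⟨aeval (Fin.addCases (motive := fun _ => MvPolynomial (Fin n) ℝ) (fun i => X i) (fun _ => 0)),
      fun i => by rw [aeval_X, Fin.addCases_left], fun i => by rw [aeval_X, Fin.addCases_right]⟩
  have hG : G.comp (toVars (n + j)) = toVars n := by
    refine algHom_ext fun k => ?_
    rw [AlgHom.comp_apply, toVars, toVars, aeval_X, aeval_X, psum, psum, map_sum, Fin.sum_univ_add,
      Finset.sum_eq_zero (s := Finset.univ) (f := fun i => G (X (Fin.natAdd n i) ^ (k : ℕ))), add_zero]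
    · exact Finset.sum_congr rfl fun i _ => by rw [map_pow, hl]
    · intro i _
      rw [map_pow, hr, zero_pow k.pos.ne']
  rw [← hG, AlgHom.comp_apply, h, map_zero]

theorem exists_mem_supported (f : SymFun) :
    ∃ D₀ : ℕ+, ∀ D, D₀ ≤ D → f ∈ supported ℝ {k : ℕ+ | k + k ≤ D} := by
  refine ⟨(∑ k ∈ f.vars, ((k : ℕ) + k)).succPNat, fun D hD => mem_supported.2 fun k hk => ?_⟩
  have h1 := Finset.single_le_sum (f := fun k : ℕ+ => (k : ℕ) + k) (fun _ _ => Nat.zero_le _)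
    (Finset.mem_coe.1 hk)
  have h2 : (∑ k ∈ f.vars, ((k : ℕ) + k)) + 1 ≤ (D : ℕ) := hD
  change (k : ℕ) + k ≤ D
  omega

theorem symLaplace_sumSym {α : ℝ} (hα : 0 < α) {R d : ℕ} {lam : d.Partition}
    (hR : ∀ x ∈ lam.parts, x ≤ R) {D : ℕ+}
    (hD : sumSym α R lam ∈ supported ℝ {k : ℕ+ | k + k ≤ D}) :
    symLaplace α D (sumSym α R lam) = partsEigenval α lam.parts • sumSym α R lam := by
  rw [← sub_eq_zero]
  refine eq_zero_of_toVars fun n => toVars_eq_zero_of_add (j := d) ?_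
  obtain ⟨mu, hmu⟩ := exists_partsOf (n := n + d) (zero_notMem_parts lam)
    ((card_parts_le lam).trans (Nat.le_add_left _ _))
  rw [map_sub, sub_eq_zero, map_smul]
  refine eq_of_eval_injective fun x hx => ?_
  rw [← laplaceAt_toVars α hD hx, toVars_sumSym hR hmu,
    laplaceAt_symSum hα (le_of_partsOf_eq hR hmu) hx, eigenval_eq, hmu, smul_eval]

/-- Eigenfunctions of a self-adjoint operator with distinct eigenvalues are orthogonal; D is taken
large enough for both functions. -/
theorem diagForm_sumSym {α : ℝ} (hα : 0 < α) {R R' d : ℕ} {lam mu : d.Partition}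
    (hR : ∀ x ∈ lam.parts, x ≤ R) (hR' : ∀ x ∈ mu.parts, x ≤ R') (h : DomLT mu lam) :
    diagForm (jackNorm α) (sumSym α R lam) (sumSym α R' mu) = 0 := by
  obtain ⟨D₁, h1⟩ := exists_mem_supported (sumSym α R lam)
  obtain ⟨D₂, h2⟩ := exists_mem_supported (sumSym α R' mu)
  have h3 := diagForm_symLaplace α (max D₁ D₂) (sumSym α R lam) (sumSym α R' mu)
  rw [symLaplace_sumSym hα hR (h1 _ (le_max_left _ _)),
    symLaplace_sumSym hα hR' (h2 _ (le_max_right _ _)), map_smul, map_smul, LinearMap.smul_apply,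
    smul_eq_mul, smul_eq_mul] at h3
  have h4 := partsEigenval_lt hα h
  have h5 : (partsEigenval α lam.parts - partsEigenval α mu.parts) *
      diagForm (jackNorm α) (sumSym α R lam) (sumSym α R' mu) = 0 := by
    rw [sub_mul, h3, sub_self]
  exact (mul_eq_zero.1 h5).resolve_left (sub_pos.2 h4).ne'

theorem domLT_trans {d : ℕ} {a b c : d.Partition} (h1 : DomLT a b) (h2 : DomLT b c) : DomLT a c :=
  ⟨fun k => (h1.1 k).trans (h2.1 k), fun h => h1.2 fun k => (h2.1 k).trans (h k)⟩

/-- Induction along dominance: m_μ is the symmetric function of the sum formula for μ minus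
multiples of lower m_κ, and all of these are orthogonal to the one for λ. -/
theorem diagForm_sumSym_symMon {α : ℝ} (hα : 0 < α) {R d : ℕ} {lam : d.Partition}
    (hR : ∀ x ∈ lam.parts, x ≤ R) (mu : d.Partition) (h : DomLT mu lam) :
    diagForm (jackNorm α) (sumSym α R lam) (symMon mu) = 0 := by
  classical
  induction mu using domLT_wf.induction with
  | _ mu ih =>
    have hd : ∀ x ∈ mu.parts, x ≤ d := fun x hx => mu.le_of_mem_parts hx
    have h1 := diagForm_sumSym hα hR hd h
    rw [sumSym_eq hd, map_add, map_sum, Finset.sum_eq_zero, add_zero] at h1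
    · exact h1
    · intro kap hk
      have hk := (Finset.mem_filter.1 hk).2
      rw [map_smul, ih kap hk (domLT_trans hk h), smul_zero]

/-! ### Gram--Schmidt orthogonalization and its limit -/

theorem diagForm_self_pos {w : (ℕ+ →₀ ℕ) → ℝ} (hw : ∀ m, 0 < w m) {f : SymFun}
    (h : diagForm w f f = 0) : f = 0 := by
  rw [diagForm_apply, Finset.sum_eq_zero_iff_of_nonneg
    (fun m _ => mul_nonneg (mul_self_nonneg _) (hw m).le)] at h
  by_contra hf
  obtain ⟨m, hm⟩ := Finset.nonempty_iff_ne_empty.2 (support_eq_empty.not.2 hf)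
  have := h m hm
  have h2 := mem_support_iff.1 hm
  simp [h2, (hw m).ne'] at this

/-- The partitions strictly below `lam`. -/
abbrev Below {d : ℕ} (lam : d.Partition) : Type := {kap : d.Partition // DomLT kap lam}

instance {d : ℕ} (lam : d.Partition) : Fintype (Below lam) := Fintype.ofFinite _

open Classical in
instance {d : ℕ} (lam : d.Partition) : DecidableEq (Below lam) := inferInstance

/-- The Gram matrix of the monomial symmetric functions below `m_lam`. -/
def gram (w : (ℕ+ →₀ ℕ) → ℝ) {d : ℕ} (lam : d.Partition) : Matrix (Below lam) (Below lam) ℝ :=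
  Matrix.of fun i j => diagForm w (symMon i.1) (symMon j.1)

/-- The products of `m_lam` with the monomial symmetric functions below it. -/
def gramVec (w : (ℕ+ →₀ ℕ) → ℝ) {d : ℕ} (lam : d.Partition) : Below lam → ℝ :=
  fun j => diagForm w (symMon lam) (symMon j.1)

/-- The coefficients of the Gram--Schmidt orthogonalization. -/
def gramCoeff (w : (ℕ+ →₀ ℕ) → ℝ) {d : ℕ} (lam : d.Partition) : Below lam → ℝ :=
  -(Matrix.vecMul (gramVec w lam) (gram w lam)⁻¹)

theorem eq_zero_of_sum_symMon {d : ℕ} {lam : d.Partition} {c : Below lam → ℝ}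
    (h : ∑ i, c i • symMon i.1 = 0) : c = 0 := by
  funext i
  have h1 := congrArg (fun f => coeffAt (compOf i.1) (toVars d f)) h
  simp only [map_sum, map_smul, toVars_symMon, map_zero, coeffAt, coeff_sum, coeff_smul,
    coeff_msymm, smul_eq_mul, coeff_zero, Finsupp.coe_equivFunOnFinite_symm, partsOf_compOf] at h1
  rw [Finset.sum_eq_single i] at h1
  · simpa using h1
  · intro j _ hj
    rw [if_neg, mul_zero]
    exact fun e => hj (Subtype.ext (Nat.Partition.ext e.symm))
  · simp

/-- A null vector of the Gram matrix would give a combination of the m_κ of norm zero, hence zero by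
positivity, contradicting linear independence. -/
theorem det_gram_ne_zero {w : (ℕ+ →₀ ℕ) → ℝ} (hw : ∀ m, 0 < w m) {d : ℕ} (lam : d.Partition) :
    (gram w lam).det ≠ 0 := by
  intro h
  obtain ⟨c, hc, hc0⟩ := Matrix.exists_vecMul_eq_zero_iff.2 h
  refine hc (eq_zero_of_sum_symMon (diagForm_self_pos hw ?_))
  have h1 : ∀ j : Below lam, diagForm w (∑ i, c i • symMon i.1) (symMon j.1) = 0 := by
    intro j
    have := congrFun hc0 j
    simpa [Matrix.vecMul, dotProduct, gram, map_sum, LinearMap.sum_apply] using this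
  rw [map_sum]
  exact Finset.sum_eq_zero fun j _ => by rw [map_smul, h1, smul_zero]

theorem eq_gramCoeff {w : (ℕ+ →₀ ℕ) → ℝ} (hw : ∀ m, 0 < w m) {d : ℕ} {lam : d.Partition}
    {c : Below lam → ℝ} (h : ∀ j : Below lam,
      diagForm w (symMon lam + ∑ i, c i • symMon i.1) (symMon j.1) = 0) :
    c = gramCoeff w lam := by
  have h1 : Matrix.vecMul c (gram w lam) = -gramVec w lam := by
    funext j
    have := h j
    simp only [map_add, map_sum, map_smul, LinearMap.add_apply, LinearMap.sum_apply,
      LinearMap.smul_apply, smul_eq_mul] at this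
    simp only [Matrix.vecMul, dotProduct, gram, Matrix.of_apply, Pi.neg_apply, gramVec]
    linarith
  have hu : IsUnit (gram w lam).det := isUnit_iff_ne_zero.2 (det_gram_ne_zero hw lam)
  rw [gramCoeff, ← Matrix.neg_vecMul, ← h1, Matrix.vecMul_vecMul, Matrix.mul_nonsing_inv _ hu,
    Matrix.vecMul_one]

theorem diagForm_gramCoeff {w : (ℕ+ →₀ ℕ) → ℝ} (hw : ∀ m, 0 < w m) {d : ℕ} {lam : d.Partition}
    (j : Below lam) :
    diagForm w (symMon lam + ∑ i, gramCoeff w lam i • symMon i.1) (symMon j.1) = 0 := by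
  have hu : IsUnit (gram w lam).det := isUnit_iff_ne_zero.2 (det_gram_ne_zero hw lam)
  have h1 : Matrix.vecMul (gramCoeff w lam) (gram w lam) = -gramVec w lam := by
    rw [gramCoeff, Matrix.neg_vecMul, Matrix.vecMul_vecMul, Matrix.nonsing_inv_mul _ hu,
      Matrix.vecMul_one]
  have h2 := congrFun h1 j
  simp only [Matrix.vecMul, dotProduct, gram, Matrix.of_apply, Pi.neg_apply, gramVec] at h2
  simp only [map_add, map_sum, map_smul, LinearMap.add_apply, LinearMap.sum_apply,
    LinearMap.smul_apply, smul_eq_mul]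
  linarith

theorem finsum_domLT {M : Type*} [AddCommMonoid M] {d : ℕ} (lam : d.Partition)
    (g : d.Partition → M) :
    ∑ᶠ (mu : d.Partition) (_ : DomLT mu lam), g mu = ∑ i : Below lam, g i.1 := by
  classical
  simp only [finsum_eq_sum_of_fintype, finsum_eq_if]
  rw [← Finset.sum_filter]
  exact Finset.sum_subtype _ (fun _ => Finset.mem_filter.trans (and_iff_right (Finset.mem_univ _))) g

theorem macdonaldSym_eq {q t : ℝ}
    (hpos : ∀ k : ℕ+, 0 < (1 - q ^ (k : ℕ)) / (1 - t ^ (k : ℕ))) {d : ℕ} (lam : d.Partition) :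
    macdonaldSym q t lam =
      symMon lam + ∑ i : Below lam, gramCoeff (powerSumNorm q t) lam i • symMon i.1 := by
  classical
  have hw : ∀ m, 0 < powerSumNorm q t m := fun m => by
    refine Finset.prod_pos fun k _ => ?_
    have := hpos k
    have := k.pos
    positivity
  have hP : IsMacdonald q t lam
      (symMon lam + ∑ i : Below lam, gramCoeff (powerSumNorm q t) lam i • symMon i.1) := by
    refine ⟨⟨fun mu => if h : DomLT mu lam then gramCoeff (powerSumNorm q t) lam ⟨mu, h⟩ else 0,
      fun n => ?_⟩, fun Q ⟨c, hc⟩ => ?_⟩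
    · rw [map_add, toVars_symMon, finsum_domLT, map_sum]
      congr 1
      refine Finset.sum_congr rfl fun i _ => ?_
      simp only [dif_pos i.2, map_smul, toVars_symMon]
    · have hQ : Q = ∑ i : Below lam, c i.1 • symMon i.1 := by
        rw [← sub_eq_zero]
        refine eq_zero_of_toVars fun n => ?_
        rw [map_sub, hc, finsum_domLT, map_sum, sub_eq_zero]
        simp only [map_smul, toVars_symMon]
      change diagForm (powerSumNorm q t) _ Q = 0
      rw [hQ, map_sum]
      exact Finset.sum_eq_zero fun i _ => by rw [map_smul, diagForm_gramCoeff hw, smul_zero]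
  have hex : ∃! P, IsMacdonald q t lam P := ⟨_, hP, fun P hP' => isMacdonald_unique hpos hP' hP⟩
  rw [macdonaldSym, dif_pos hex]
  exact isMacdonald_unique hpos hex.choose_spec.1 hP

/-- Only the limiting Gram matrix has to be invertible. -/
theorem tendsto_gramCoeff {ι : Type*} {l : Filter ι} {w : ι → (ℕ+ →₀ ℕ) → ℝ}
    {w₀ : (ℕ+ →₀ ℕ) → ℝ} (hw : ∀ m, 0 < w₀ m) (h : ∀ m, Tendsto (fun i => w i m) l (𝓝 (w₀ m)))
    {d : ℕ} (lam : d.Partition) (j : Below lam) :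
    Tendsto (fun i => gramCoeff (w i) lam j) l (𝓝 (gramCoeff w₀ lam j)) := by
  have hd : ∀ f g : SymFun, Tendsto (fun i => diagForm (w i) f g) l (𝓝 (diagForm w₀ f g)) :=
    fun f g => tendsto_finsetSum _ fun m _ => (h m).const_mul _
  have hG : Tendsto (fun i => gram (w i) lam) l (𝓝 (gram w₀ lam)) :=
    tendsto_pi_nhds.2 fun a => tendsto_pi_nhds.2 fun b => hd _ _
  have hV : Tendsto (fun i => gramVec (w i) lam) l (𝓝 (gramVec w₀ lam)) :=
    tendsto_pi_nhds.2 fun a => hd _ _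
  have hdet := ((continuous_id.matrix_det).tendsto (gram w₀ lam)).comp hG
  have hadj := ((continuous_id.matrix_adjugate).tendsto (gram w₀ lam)).comp hG
  -- The inverse is the adjugate divided by the determinant, both polynomial in the entries, and the
  -- limiting determinant is nonzero.
  have hinv : Tendsto (fun i => (gram (w i) lam)⁻¹) l (𝓝 (gram w₀ lam)⁻¹) := by
    simp only [Matrix.inv_def, Ring.inverse_eq_inv']
    exact (hdet.inv₀ (det_gram_ne_zero hw lam)).smul hadj
  have hc : Continuous fun p : (Below lam → ℝ) × Matrix (Below lam) (Below lam) ℝ =>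
      -(Matrix.vecMul p.1 p.2) := (continuous_fst.matrix_vecMul continuous_snd).neg
  exact tendsto_pi_nhds.1 ((hc.tendsto _).comp (hV.prodMk_nhds hinv)) j

/-! ### Limits of the norms as t → 1 -/

theorem tendsto_one_sub_rpow_div {a b : ℝ} (hb : b ≠ 0) :
    Tendsto (fun t : ℝ => (1 - t ^ a) / (1 - t ^ b)) (𝓝[≠] 1) (𝓝 (a / b)) := by
  -- Numerator and denominator, each divided by 1 - t, are difference quotients of powers at 1, with
  -- limits a and b.
  have key : ∀ a : ℝ, Tendsto (slope (fun t : ℝ => t ^ a) 1) (𝓝[≠] 1) (𝓝 a) := by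
    intro a
    have := hasDerivAt_iff_tendsto_slope.1 (Real.hasDerivAt_rpow_const (x := 1) (p := a)
      (Or.inl one_ne_zero))
    simpa using this
  refine ((key a).div (key b) hb).congr' ?_
  filter_upwards [self_mem_nhdsWithin] with t ht
  have ht : t - 1 ≠ 0 := sub_ne_zero.2 ht
  simp only [Pi.div_apply, slope_def_field, Real.one_rpow]
  rw [div_div_div_cancel_right₀ ht, ← neg_div_neg_eq, neg_sub, neg_sub]

theorem eventually_pos_nhdsNE_one : ∀ᶠ t : ℝ in 𝓝[≠] 1, 0 < t ∧ t ≠ 1 :=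
  ((eventually_gt_nhds one_pos).filter_mono nhdsWithin_le_nhds).and self_mem_nhdsWithin

theorem tendsto_powerSumNorm (α : ℝ) (m : ℕ+ →₀ ℕ) :
    Tendsto (fun t : ℝ => powerSumNorm (t ^ α) t m) (𝓝[≠] 1) (𝓝 (jackNorm α m)) := by
  refine tendsto_finsetProd _ fun k _ => Tendsto.const_mul _ (Tendsto.pow ?_ _)
  have hk : ((k : ℕ) : ℝ) ≠ 0 := by exact_mod_cast k.pos.ne'
  have h := tendsto_one_sub_rpow_div (a := α * (k : ℕ)) hk
  rw [mul_div_cancel_right₀ _ hk] at h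
  refine h.congr' ?_
  filter_upwards [eventually_pos_nhdsNE_one] with t ht
  rw [Real.rpow_mul ht.1.le, Real.rpow_natCast, Real.rpow_natCast]

theorem jackNorm_pos {α : ℝ} (hα : 0 < α) (m : ℕ+ →₀ ℕ) : 0 < jackNorm α m := by
  refine Finset.prod_pos fun k _ => ?_
  have := k.pos
  positivity

theorem one_sub_pow_div_pos {α : ℝ} (hα : 0 < α) {t : ℝ} (ht : 0 < t) (ht1 : t ≠ 1) (k : ℕ+) :
    0 < (1 - (t ^ α) ^ (k : ℕ)) / (1 - t ^ (k : ℕ)) := by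
  have hk := k.pos.ne'
  rcases lt_or_gt_of_ne ht1 with h | h
  · exact div_pos (sub_pos.2 (pow_lt_one₀ (Real.rpow_nonneg ht.le _)
      (Real.rpow_lt_one ht.le h hα) hk)) (sub_pos.2 (pow_lt_one₀ ht.le h hk))
  · exact div_pos_of_neg_of_neg (sub_neg.2 (one_lt_pow₀ (Real.one_lt_rpow h hα) hk))
      (sub_neg.2 (one_lt_pow₀ h hk))

/-- The symmetric sum is the Jack polynomial. -/
theorem isJackPoly_symSum {α : ℝ} (hα : 0 < α) {R : ℕ} {lam : Fin n → ℕ} (hR : ∀ i, lam i ≤ R) :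
    IsJackPoly α lam (symSum α R lam) := by
  classical
  intro k
  have hparts : partsOf lam = (toPartition lam).parts := rfl
  have hR' : ∀ x ∈ (toPartition lam).parts, x ≤ R := by
    intro x hx
    rw [← hparts, partsOf, Multiset.mem_filter, Multiset.mem_map] at hx
    obtain ⟨⟨i, -, rfl⟩, -⟩ := hx
    exact hR i
  have hsub : ∀ g : (Multiset.map lam Finset.univ.val).sum.Partition → SymFun,
      ∑ kap with DomLT kap (toPartition lam), g kap = ∑ i : Below (toPartition lam), g i.1 := by
    intro g
    exact Finset.sum_subtype _
      (fun _ => Finset.mem_filter.trans (and_iff_right (Finset.mem_univ _))) g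
  have hsym : sumSym α R (toPartition lam) = symMon (toPartition lam) +
      ∑ i : Below (toPartition lam),
        gramCoeff (jackNorm α) (toPartition lam) i • symMon i.1 := by
    have h1 := sumSym_eq (α := α) hR'
    rw [hsub] at h1
    have h2 : (fun i : Below (toPartition lam) => sumCoeff α R (toPartition lam) i.1) =
        gramCoeff (jackNorm α) (toPartition lam) :=
      eq_gramCoeff (jackNorm_pos hα) fun j => by
        rw [← h1]
        exact diagForm_sumSym_symMon hα hR' j.1 j.2
    rw [h1, ← h2]
  rw [← toVars_sumSym hR' hparts, hsym]
  have hcoeff : ∀ c : Below (toPartition lam) → ℝ, coeff k (toVars n (symMon (toPartition lam) +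
      ∑ i : Below (toPartition lam), c i • symMon i.1)) =
      coeff k (toVars n (symMon (toPartition lam))) +
        ∑ i : Below (toPartition lam), c i * coeff k (toVars n (symMon i.1)) := by
    intro c
    simp only [map_add, map_sum, map_smul, coeff_add, coeff_sum, coeff_smul, smul_eq_mul]
  rw [hcoeff]
  refine Tendsto.congr' (f₁ := fun t : ℝ => coeff k (toVars n (symMon (toPartition lam))) +
    ∑ i : Below (toPartition lam), gramCoeff (powerSumNorm (t ^ α) t) (toPartition lam) i *
      coeff k (toVars n (symMon i.1))) ?_ ?_
  · filter_upwards [eventually_pos_nhdsNE_one] with t ht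
    rw [macdonaldPoly, macdonaldSym_eq (one_sub_pow_div_pos hα ht.1 ht.2), hcoeff]
  · exact tendsto_const_nhds.add (tendsto_finsetSum _ fun i _ =>
      (tendsto_gramCoeff (jackNorm_pos hα) (tendsto_powerSumNorm α) _ i).mul_const _)

/-! ### The limit of the coefficients -/

theorem conj_antitone (mu : Fin n → ℕ) {i j : ℕ} (h : i ≤ j) : conj mu j ≤ conj mu i :=
  Finset.card_le_card fun k hk => by
    simp only [Finset.mem_filter, Finset.mem_univ, true_and] at hk ⊢
    omega

theorem tendsto_macdonaldCoeff {α : ℝ} (hα : 0 < α) (r i : ℕ) (mu nu : Fin n → ℕ) :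
    Tendsto (fun t : ℝ => macdonaldCoeff (t ^ α) t r i mu nu) (𝓝[≠] 1)
      (𝓝 (jackCoeff α r i mu nu)) := by
  by_cases h : ∃ k, 0 < mu k ∧ mu k < nu k
  · simp only [macdonaldCoeff, jackCoeff, if_pos h]
    exact tendsto_const_nhds
  simp only [macdonaldCoeff, jackCoeff, if_neg h]
  refine tendsto_finsetProd _ fun j hj => ?_
  have hij : i + 1 ≤ j := (Finset.mem_Icc.1 hj).1
  rw [← one_mul (∏ k ∈ Finset.Icc 1 (bFun j mu nu), _)]
  refine Tendsto.mul ?_ (tendsto_finsetProd _ fun k hk => ?_)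
  · have h1 : Tendsto (fun t : ℝ => t ^ α) (𝓝[≠] 1) (𝓝 1) := by
      have := (Real.continuousAt_rpow_const 1 α (Or.inl one_ne_zero)).tendsto
      rw [Real.one_rpow] at this
      exact this.mono_left nhdsWithin_le_nhds
    simpa using h1.pow ((j - i) * aFun j mu nu)
  · have hk1 : 1 ≤ k := (Finset.mem_Icc.1 hk).1
    have hk1' : (1 : ℝ) ≤ k := by exact_mod_cast hk1
    have hij' : (i : ℝ) + 1 ≤ j := by exact_mod_cast hij
    have hconj := conj_antitone mu (Nat.le_of_succ_le hij)
    have hconj' : (conj mu j : ℝ) ≤ conj mu i := by exact_mod_cast hconj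
    have hpos : 0 < ((j : ℝ) - i) * α + conj mu i - conj mu j + k := by
      have : 0 < ((j : ℝ) - i) * α := mul_pos (by linarith) hα
      linarith
    refine (tendsto_one_sub_rpow_div (a := k) hpos.ne').congr' ?_
    filter_upwards [eventually_pos_nhdsNE_one] with t ht
    -- At q = t^α the denominator is 1 minus a single real power of t, whose exponent is the
    -- denominator of the Jack factor; antitonicity of the conjugate parts makes the natural
    -- subtraction exact.
    have he : t ^ (((j : ℝ) - i) * α + conj mu i - conj mu j + k) =
        (t ^ α) ^ (j - i) * t ^ (conj mu i - conj mu j + k) := by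
      rw [← Real.rpow_natCast (t ^ α), ← Real.rpow_mul ht.1.le, ← Real.rpow_natCast t,
        ← Real.rpow_add ht.1, Nat.cast_sub (Nat.le_of_succ_le hij), Nat.cast_add,
        Nat.cast_sub hconj]
      congr 1
      ring
    rw [he, Real.rpow_natCast]

/-! ### The nested form of the sum formula -/

/-- All parts are lowered by `i`. -/
def lower (lam : Fin n → ℕ) (i : ℕ) : Fin n → ℕ := fun k => lam k - i

/-- Substitute j = a + i. Subtracting i from all parts turns the truncations into lowered
compositions, strict excess of the truncated parts into blocking, and the difference of conjugate
parts at i + 1 and j into the number of lowered parts strictly between 0 and a. -/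
theorem jackCoeff_trunc (α : ℝ) {r i s : ℕ} (hr : i + s = r) (lam : Fin n → ℕ)
    (sigma : Equiv.Perm (Fin n)) :
    jackCoeff α r (i + 1) (trunc lam i) (permComp sigma (trunc lam (i + 1))) =
      pairWeight α s (lower lam i) (permComp sigma (lower lam (i + 1))) := by
  have hb : (∃ k, 0 < trunc lam i k ∧ trunc lam i k < permComp sigma (trunc lam (i + 1)) k) ↔
      Blocked (lower lam i) (permComp sigma (lower lam (i + 1))) := by
    refine exists_congr fun k => ?_
    simp only [trunc, permComp, lower]
    split_ifs <;> omega
  rw [jackCoeff, pairWeight]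
  by_cases h : Blocked (lower lam i) (permComp sigma (lower lam (i + 1)))
  · rw [if_pos h, if_pos (hb.2 h)]
  rw [if_neg h, if_neg (mt hb.1 h)]
  refine Finset.prod_bij' (fun j _ => j - i) (fun a _ => a + i) ?_ ?_ ?_ ?_ ?_
  · intro j hj
    simp only [Finset.mem_Icc] at hj ⊢
    omega
  · intro a ha
    simp only [Finset.mem_Icc] at ha ⊢
    omega
  · intro j hj
    simp only [Finset.mem_Icc] at hj
    omega
  · intro a _
    omega
  · intro j hj
    simp only [Finset.mem_Icc] at hj
    have h1 : bFun j (trunc lam i) (permComp sigma (trunc lam (i + 1))) =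
        unfixed (lower lam i) (permComp sigma (lower lam (i + 1))) (j - i) := by
      rw [bFun, unfixed]
      congr 1
      refine Finset.filter_congr fun k _ => ?_
      simp only [trunc, permComp, lower]
      split_ifs <;> omega
    have h2 : conj (trunc lam i) (i + 1) =
        conj (trunc lam i) j + between (lower lam i) (j - i) := by
      simp only [conj, between, Finset.card_filter, ← Finset.sum_add_distrib]
      refine Finset.sum_congr rfl fun k _ => ?_
      clear hb h h1
      have hl : lower lam i k = lam k - i := rfl
      rcases le_or_gt (lam k) i with hk | hk
      · rw [show trunc lam i k = 0 from if_pos hk, if_neg (by omega), if_neg (by omega),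
          if_neg (by omega)]
      · rw [show trunc lam i k = lam k from if_neg (by omega), if_pos (by omega)]
        rcases le_or_gt j (lam k) with hj' | hj'
        · rw [if_pos hj', if_neg (by omega)]
        · rw [if_neg (by omega), if_pos (by omega)]
    rw [h1, h2, Nat.cast_sub (by omega)]
    refine Finset.prod_congr rfl fun k _ => ?_
    push_cast
    congr 1
    ring

/-- Truncating at i and subtracting i identify the same values of the parts, so the two compositions
have the same stabilizer and the same coset representatives. -/
theorem IsReps.lower {lam : Fin n → ℕ} {i : ℕ} {S : Finset (Equiv.Perm (Fin n))}
    (h : IsReps (trunc lam i) S) : IsReps (lower lam i) S := by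
  have key : ∀ s t : Equiv.Perm (Fin n), permComp s (JackSum.lower lam i) = permComp t (JackSum.lower lam i) ↔
      permComp s (trunc lam i) = permComp t (trunc lam i) := by
    intro s t
    rw [funext_iff, funext_iff]
    refine forall_congr' fun k => ?_
    simp only [permComp, JackSum.lower, trunc]
    split_ifs <;> omega
  intro tau
  simpa only [key] using h tau

theorem IsReps.sum_eq {M : Type*} [AddCommMonoid M] {mu : Fin n → ℕ}
    {S : Finset (Equiv.Perm (Fin n))} (h : IsReps mu S) (g : (Fin n → ℕ) → M) :
    ∑ s ∈ S, g (permComp s mu) = ∑ nu ∈ orbit mu, g nu := by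
  refine Finset.sum_bij (fun s _ => permComp s mu)
    (fun s _ => mem_orbit.2 ⟨s, rfl⟩) (fun s hs t ht e => ?_) (fun nu hnu => ?_) fun _ _ => rfl
  · obtain ⟨u, -, hu⟩ := h t
    exact (hu s ⟨hs, e⟩).trans (hu t ⟨ht, rfl⟩).symm
  · obtain ⟨t, rfl⟩ := mem_orbit.1 hnu
    obtain ⟨u, ⟨hu, he⟩, -⟩ := h t
    exact ⟨u, hu, he⟩

theorem xMon_trunc (lam : Fin n → ℕ) (i : ℕ) : xMon (trunc lam i) = xMon (lower lam i) := by
  rw [xMon, xMon]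
  congr 1
  refine Finset.filter_congr fun k _ => ?_
  simp only [trunc, lower]
  split_ifs <;> omega

theorem fPoly_one (α : ℝ) {mu : Fin n → ℕ} (h : ∀ k, mu k ≤ 1) : fPoly α 1 mu = xMon mu := by
  have hd : dec mu = 0 := funext fun k => by
    have := h k
    simp only [dec, Pi.zero_apply]
    omega
  rw [fPoly, hd, Finset.sum_eq_single 0]
  · rw [← hd, pairWeight_dec, one_smul, fPoly, mul_one]
  · intro nu hnu hne
    exact absurd (funext fun k => Nat.le_zero.1 (le_of_mem_orbit hnu (fun _ => le_rfl) k)) hne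
  · exact fun h => absurd (self_mem_orbit _) h

/-- The nested operators are the recursion of f unrolled at λ lowered by i: equivariance turns each
renamed inner factor into f of a permuted composition, and representatives enumerate its orbit once.
-/
theorem xMon_mul_jackNestedTail (α : ℝ) (lam : Fin n → ℕ) (S : ℕ → Finset (Equiv.Perm (Fin n)))
    (hS : ∀ i ≤ largestPart lam - 1, IsReps (trunc lam i) (S i)) (i s : ℕ)
    (his : i + s = largestPart lam - 1) :
    xMon (trunc lam i) * jackNestedTail α lam S i s = fPoly α (s + 1) (lower lam i) := by
  have hle : ∀ k, lam k ≤ largestPart lam := fun k => Finset.le_sup (f := lam) (Finset.mem_univ k)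
  induction s generalizing i with
  | zero =>
    rw [jackNestedTail, mul_one, xMon_trunc, fPoly_one]
    intro k
    have := hle k
    simp only [lower]
    omega
  | succ s ih =>
    rw [jackNestedTail, fPoly, xMon_trunc]
    congr 1
    have hdec : dec (lower lam i) = lower lam (i + 1) := by
      funext k
      simp only [dec, lower]
      omega
    rw [hdec, ← (hS (i + 1) (by omega)).lower.sum_eq
      fun nu => pairWeight α (s + 1 + 1) (lower lam i) nu • fPoly α (s + 1) nu]
    refine Finset.sum_congr rfl fun sigma _ => ?_
    rw [jackCoeff_trunc α (s := s + 1 + 1) (by omega), ih (i + 1) (by omega), rename_fPoly]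

theorem jackNestedSum_eq (α : ℝ) (lam : Fin n → ℕ) (S : ℕ → Finset (Equiv.Perm (Fin n)))
    (hS : ∀ i ≤ largestPart lam - 1, IsReps (trunc lam i) (S i)) :
    jackNestedSum α lam S = symSum α (largestPart lam - 1 + 1) lam := by
  have h0 : trunc lam 0 = lam := funext fun k => by
    simp only [trunc]
    split_ifs <;> omega
  have h1 := xMon_mul_jackNestedTail α lam S hS 0 (largestPart lam - 1) (zero_add _)
  have h2 : IsReps lam (S 0) := by
    have := hS 0 (Nat.zero_le _)
    rwa [h0] at this
  rw [h0] at h1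
  rw [jackNestedSum, symSum, ← h2.sum_eq fun nu => fPoly α (largestPart lam - 1 + 1) nu]
  refine Finset.sum_congr rfl fun sigma _ => ?_
  rw [h1, rename_fPoly]
  rfl

/-! ### The multiple sum -/

theorem sum_piFinset_succ {P M : Type*} [AddCommMonoid M] {s : ℕ}
    (A : Fin (s + 1) → Finset P) (g : (Fin (s + 1) → P) → M) :
    ∑ sigma ∈ Fintype.piFinset A, g sigma =
      ∑ a ∈ A 0, ∑ tau ∈ Fintype.piFinset fun k : Fin s => A k.succ,
        g (Fin.cons (α := fun _ => P) a tau) := by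
  rw [← Finset.sum_product']
  refine Finset.sum_bij' (fun sigma _ => (sigma 0, Fin.tail sigma))
    (fun p _ => Fin.cons (α := fun _ => P) p.1 p.2) ?_ ?_ ?_ ?_ ?_
  · intro sigma h
    rw [Fintype.mem_piFinset] at h
    exact Finset.mem_product.2 ⟨h 0, Fintype.mem_piFinset.2 fun k => h k.succ⟩
  · intro p h
    rw [Finset.mem_product, Fintype.mem_piFinset] at h
    exact Fintype.mem_piFinset.2 (Fin.cases h.1 h.2)
  · intro sigma _
    exact Fin.cons_self_tail sigma
  · intro p _
    simp
  · intro sigma _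
    rw [Fin.cons_self_tail]

theorem partialProd_cons {G : Type*} [Monoid G] {s : ℕ} (a : G) (tau : Fin s → G)
    (j : Fin (s + 1)) :
    Fin.partialProd (Fin.cons (α := fun _ => G) a tau : Fin (s + 1) → G) j.succ =
      a * Fin.partialProd tau j := by
  rw [Fin.partialProd_succ']
  rfl

theorem rename_mul_perm (a b : Equiv.Perm (Fin n)) (g : MvPolynomial (Fin n) ℝ) :
    rename (a * b : Equiv.Perm (Fin n)) g = rename a (rename b g) := by
  rw [rename_rename]
  rfl

/-- Expanding the nested sums one layer at a time prefixes a permutation to the list, which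
multiplies every partial product on the left, just as the outer renaming acts on all inner
monomials. -/
theorem jackNestedTail_eq_sum (α : ℝ) (lam : Fin n → ℕ) (S : ℕ → Finset (Equiv.Perm (Fin n)))
    (i s : ℕ) :
    jackNestedTail α lam S i s =
      ∑ sigma ∈ Fintype.piFinset fun k : Fin s => S (i + 1 + k),
        (∏ k : Fin s, jackCoeff α (largestPart lam) (i + 1 + k) (trunc lam (i + k))
          (permComp (sigma k) (trunc lam (i + 1 + k)))) •
        ∏ k : Fin s, rename (Fin.partialProd sigma k.succ : Equiv.Perm (Fin n))
          (xMon (trunc lam (i + 1 + k))) := by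
  induction s generalizing i with
  | zero => simp [jackNestedTail]
  | succ s ih =>
    rw [jackNestedTail, sum_piFinset_succ]
    have e1 : ∀ k : Fin s, i + 1 + ((k : ℕ) + 1) = i + 1 + 1 + k := fun k => by omega
    have e2 : ∀ k : Fin s, i + ((k : ℕ) + 1) = i + 1 + k := fun k => by omega
    simp only [Fin.val_zero, add_zero, Fin.val_succ, e1, e2, Fin.prod_univ_succ, Fin.cons_zero,
      Fin.cons_succ, partialProd_cons, Fin.partialProd_zero, mul_one]
    refine Finset.sum_congr rfl fun a _ => ?_
    rw [ih, map_mul, map_sum, Finset.mul_sum, Finset.smul_sum]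
    refine Finset.sum_congr rfl fun tau _ => ?_
    rw [map_smul, map_prod, mul_smul, mul_smul_comm]
    simp only [rename_mul_perm]

theorem jackMultiSum_eq (α : ℝ) (lam : Fin n → ℕ) (S : ℕ → Finset (Equiv.Perm (Fin n))) :
    jackMultiSum α lam S = jackNestedSum α lam S := by
  have h0 : trunc lam 0 = lam := funext fun k => by
    simp only [trunc]
    split_ifs <;> omega
  rw [jackMultiSum, jackNestedSum, sum_piFinset_succ]
  refine Finset.sum_congr rfl fun a _ => ?_
  rw [jackNestedTail_eq_sum, map_mul, map_sum, Finset.mul_sum]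
  have e : ∀ k : ℕ, 0 + 1 + k = k + 1 := fun k => by omega
  simp only [e, zero_add, Fin.val_succ]
  refine Finset.sum_congr rfl fun tau _ => ?_
  rw [map_smul, map_prod, mul_smul_comm, Fin.prod_univ_succ (fun k : Fin (largestPart lam - 1 + 1) =>
    rename (Fin.partialProd (Fin.cons (α := fun _ => Equiv.Perm (Fin n)) a tau) k.succ :
      Equiv.Perm (Fin n)) (xMon (trunc lam k)))]
  simp only [partialProd_cons, Fin.partialProd_zero, mul_one, Fin.val_zero, h0, Fin.val_succ,
    rename_mul_perm, Fin.cons_succ]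

end JackSum

end

open JackSum in
theorem mainTheorem2 (n : ℕ) (lam : Fin n → ℕ) (hlam : Antitone lam) (α : ℝ) (hα : 0 < α) :
    (∀ (r i : ℕ) (mu nu : Fin n → ℕ),
      Filter.Tendsto (fun t : ℝ => macdonaldCoeff (t ^ α) t r i mu nu)
        (nhdsWithin 1 {1}ᶜ) (nhds (jackCoeff α r i mu nu))) ∧
    ∀ S : ℕ → Finset (Equiv.Perm (Fin n)),
      (∀ i ≤ largestPart lam - 1, IsReps (trunc lam i) (S i)) →
        IsJackPoly α lam (jackNestedSum α lam S) ∧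
        IsJackPoly α lam (jackMultiSum α lam S) := by
  refine ⟨tendsto_macdonaldCoeff hα, fun S hS => ?_⟩
  rw [jackMultiSum_eq, jackNestedSum_eq α lam S hS, and_self_iff]
  -- The bound on the parts is r - 1 + 1 with truncated subtraction, which is r for r ≥ 1 and 1 for
  -- r = 0; any upper bound serves.
  refine isJackPoly_symSum hα fun i => ?_
  have : lam i ≤ largestPart lam := Finset.le_sup (f := lam) (Finset.mem_univ i)
  omega
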